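/- **Setting.** Let $d\ge 1$, $p_1,\dots,p_d\ge 1$, $p:=\max_i p_i$, $\widehat\Omega:=(0,1)^d$. For each $i$ let $(t^0_{i,j})_{j=0}^{N^0_i+p_i}$ be a $p_i$-open knot vector on $[0,1]$, i.e. it is non-decreasing, its first $p_i+1$ knots are $0$, its last $p_i+1$ knots are $1$, and its interior knots have multiplicity at most $p_i$. The knot vectors of level $k+1$ arise from those of level $k$ by inserting the midpoint of each non-trivial knot span once. Let $\widehat{\mathcal B}^k$ be the tensor-product B-spline basis (normalized, of degrees $p_1,\dots,p_d$) of level $k$, $\widehat{\mathcal Y}^k:=\operatorname{span}\widehat{\mathcal B}^k$, and $\widehat{\mathcal T}^k$ the set of non-trivial closed cells of level $k$; put $\widehat{\mathcal T}_0:=\widehat{\mathcal T}^0$. At the end point $1$, B-splines are continuous from the left. A hierarchical mesh is given by closed sets $[0,1]^d=\widehat\Omega^0_\bullet\supseteq\widehat\Omega^1_\bullet\supseteq\cdots$ such that, for $k\ge 1$, $\widehat\Omega_\bullet^k$ is the union of the cells in $\widehat{\mathcal T}^{k-1}$ that it contains, and $\widehat\Omega_\bullet^{M_\bullet}=\emptyset$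 for some minimal $M_\bullet$. Its elements are $\widehat{\mathcal T}_\bullet:=\bigcup_k\{\widehat T\in\widehat{\mathcal T}^k:\widehat T\subseteq\widehat\Omega^k_\bullet,\ \widehat T\not\subseteq\widehat\Omega^{k+1}_\bullet\}$, where $k$ is the level of $\widehat T$. The hierarchical B-splines are $\widehat{\mathcal H}_\bullet:=\widehat{\mathcal H}_\bullet^{M_\bullet-1}$, where $\widehat{\mathcal H}_\bullet^0:=\widehat{\mathcal B}^0$ and $\widehat{\mathcal H}_\bullet^{k+1}:=\{\beta\in\widehat{\mathcal H}_\bullet^k:\operatorname{supp}\beta\not\subseteq\widehat\Omega^{k+1}_\bullet\}\cup\{\beta\in\widehat{\mathcal B}^{k+1}:\operatorname{supp}\beta\subseteq\widehat\Omega^{k+1}_\bullet\}$. Let $\widehat{\mathcal X}_\bullet:=\{V\in\operatorname{span}\widehat{\mathcal H}_\bullet: V|_{\partial\widehat\Omega}=0\}$. The mesh is admissible if the levels of any two elements contained in the support of one common $\beta\in\widehat{\mathcal H}_\bullet$ differ by at most $1$. Patches are defined by $\pi_\bullet^0(\omega):=\omega$ and $\pi_\bullet^{n+1}(\omega):=\bigcup\{\widehat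 T\in\widehat{\mathcal T}_\bullet:\widehat T\cap\pi_\bullet^{n}(\omega)\ne\emptyset\}$. For $V=\sum_{\beta\in\widehat{\mathcal B}^{k+1}}c_\beta\beta\in\widehat{\mathcal Y}^k\subset\widehat{\mathcal Y}^{k+1}$ let $\operatorname{trunc}^{k+1}_\bullet V$ be the sum of those $c_\beta\beta$ with $\operatorname{supp}\beta\not\subseteq\widehat\Omega_\bullet^{k+1}$; for $\beta\in\widehat{\mathcal H}_\bullet$ of level $k$ let $\operatorname{Trunc}_\bullet(\beta):=\operatorname{trunc}_\bullet^{M_\bullet-1}(\cdots\operatorname{trunc}_\bullet^{k+1}(\beta)\cdots)$. For each $k$ and $\beta\in\widehat{\mathcal B}^k$ fix an arbitrary cell $\widehat T_\beta\in\widehat{\mathcal T}^k$ with $\widehat T_\beta\subseteq\operatorname{supp}\beta$, and with $\widehat T_\beta\in\widehat{\mathcal T}_\bullet$ if $\beta\in\widehat{\mathcal H}_\bullet$. Let $\beta^*$ be the unique element of $\{V|_{\widehat T_\beta}:V\in\widehat{\mathcal Y}^k\}$ with $\int_{\widehat T_\beta}\beta^*\beta'\,dt=\delta_{\beta,\beta'}$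 for all $\beta'\in\widehat{\mathcal B}^k$. Define, for $v\in L^2(\widehat\Omega)$, $$\widehat J_\bullet v:=\sum_{\beta\in\widehat{\mathcal H}_\bullet,\ \beta|_{\partial\widehat\Omega}=0}\Big(\int_{\widehat T_\beta}\beta^*v\,dt\Big)\operatorname{Trunc}_\bullet(\beta).$$ **Lemma.** There is a constant $C_J>0$, depending only on $d$, $\widehat{\mathcal T}_0$ and $(p_1,\dots,p_d)$, such that for every admissible hierarchical mesh $\widehat{\mathcal T}_\bullet$ and every choice of the cells $\widehat T_\beta$: $\widehat J_\bullet$ is a linear map from $L^2(\widehat\Omega)$ to $\widehat{\mathcal X}_\bullet$; it is a projection, i.e. $\widehat J_\bullet V=V$ for all $V\in\widehat{\mathcal X}_\bullet$; and it is locally $L^2$-stable, i.e. for all $\widehat T\in\widehat{\mathcal T}_\bullet$ and all $v\in L^2(\widehat\Omega)$, $$\|\widehat J_\bullet v\|_{L^2(\widehat T)}\le C_J\,\|v\|_{L^2(\pi_\bullet^{2(p+1)}(\widehat T))}.$$ -/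

import Mathlib

open MeasureTheory Set

noncomputable section

/-! ### Knot vectors and their uniform refinement -/

open Classical in
/-- Uniform `h`-refinement of a knot vector: the midpoint of every non-trivial knot span is inserted
with multiplicity one. -/
def refineKnots : List ℝ → List ℝ
  | a :: b :: l =>
      if a = b then a :: refineKnots (b :: l) else a :: (a + b) / 2 :: refineKnots (b :: l)
  | l => l

/-- A `d`-dimensional vector of `p i`-open knot vectors on `[0,1]`; the knots in direction `i` are
`t 0 ≤ … ≤ t (N i + p i)`, the first and the last `p i + 1` of them are `0` and `1`, and the interior
ones have multiplicity at most `p i`. -/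
structure OpenKnots {d : ℕ} (p : Fin d → ℕ) where
  knots : Fin d → List ℝ
  N : Fin d → ℕ
  length_eq : ∀ i, (knots i).length = N i + p i + 1
  sorted : ∀ i, (knots i).Pairwise (· ≤ ·)
  first : ∀ i j, j ≤ p i → (knots i).getD j 0 = 0
  last : ∀ i j, N i ≤ j → j ≤ N i + p i → (knots i).getD j 0 = 1
  mult : ∀ i j, p i + 1 ≤ j → j < N i → (knots i).count ((knots i).getD j 0) ≤ p i

/-- The normalized B-spline of degree `p` on the knots `t j ≤ … ≤ t (j + p + 1)` in `[0,1]`, by the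
Cox–de Boor recursion with the usual convention `0 / 0 = 0`. As usual for splines on `[0,1]`, the
knot spans are half-open, except that a span ending in the end point `1` contains `1`; thus the
splines are continuous from the left at `1`. -/
def bspline : ℕ → (ℕ → ℝ) → ℕ → ℝ → ℝ
  | 0, t, j, s =>
      open Classical in
      if (t j ≤ s ∧ s < t (j + 1)) ∨ (t j < s ∧ s = 1 ∧ t (j + 1) = 1) then 1 else 0
  | q + 1, t, j, s =>
      (s - t j) / (t (j + q + 1) - t j) * bspline q t j s +
        (t (j + q + 2) - s) / (t (j + q + 2) - t (j + 1)) * bspline q t (j + 1) s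

/-- The parameter domain `(0,1)^d`. -/
def paramDomain (d : ℕ) : Set (Fin d → ℝ) := {x | ∀ i, x i ∈ Ioo (0 : ℝ) 1}

namespace OpenKnots

variable {d : ℕ} {p : Fin d → ℕ} (K : OpenKnots p)

/-- The knot vector of level `k` in direction `i`. -/
def level (k : ℕ) (i : Fin d) : List ℝ := refineKnots^[k] (K.knots i)

/-- The `n`-th knot (counted from `0`) of level `k` in direction `i`. -/
def knot (k : ℕ) (i : Fin d) (n : ℕ) : ℝ := (K.level k i).getD n 0

/-- The number of univariate B-splines of level `k` in direction `i`. -/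
def num (k : ℕ) (i : Fin d) : ℕ := (K.level k i).length - (p i + 1)

/-- The index set of the tensor-product B-spline basis of level `k`. -/
abbrev Index (k : ℕ) : Type := (i : Fin d) → Fin (K.num k i)

/-- The tensor-product B-splines of level `k`, as functions on `ℝ^d`. -/
def B (k : ℕ) (j : K.Index k) (s : Fin d → ℝ) : ℝ :=
  ∏ i, bspline (p i) (K.knot k i) (j i) (s i)

/-- The tensor-product spline space of level `k`. -/
def Y (k : ℕ) : Submodule ℝ ((Fin d → ℝ) → ℝ) := Submodule.span ℝ (range (K.B k))

/-- The non-trivial closed cells of level `k`. -/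
def cells (k : ℕ) : Set (Set (Fin d → ℝ)) :=
  {T | ∃ j : Fin d → ℕ, (∀ i, j i + 1 < (K.level k i).length) ∧
    T = Icc (fun i => K.knot k i (j i)) (fun i => K.knot k i (j i + 1)) ∧ 0 < volume T}

open Classical in
/-- The coefficients of `f` in the basis of level `k` (they are unique since the B-splines of one
level are linearly independent; the value `0` is never relevant for `f` in the space of level `k`). -/
def coeff (k : ℕ) (f : (Fin d → ℝ) → ℝ) : K.Index k → ℝ :=
  if h : ∃ c : K.Index k → ℝ, f = ∑ j, c j • K.B k j then h.choose else 0

/-- The defining property of the dual function of the B-spline with index `j` of level `k` on the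
set `T`: it is the restriction to `T` (extended by zero) of a spline of level `k`, and it is
biorthogonal on `T` to the B-splines of level `k`. -/
def IsDual (k : ℕ) (j : K.Index k) (T : Set (Fin d → ℝ)) (g : (Fin d → ℝ) → ℝ) : Prop :=
  (∃ V ∈ K.Y k, g = T.indicator V) ∧
    ∀ j' : K.Index k, ∫ x in T, g x * K.B k j' x = if j' = j then 1 else 0

open Classical in
/-- The dual function on `T` (unique if `T` is a cell of level `k` in the support of the B-spline). -/
def dual (k : ℕ) (j : K.Index k) (T : Set (Fin d → ℝ)) : (Fin d → ℝ) → ℝ :=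
  if h : ∃ g, K.IsDual k j T g then h.choose else 0

end OpenKnots

/-! ### Hierarchical meshes and splines -/

/-- A hierarchical mesh, given by its nested sequence of closed subdomains of `[0,1]^d`. -/
structure HierMesh {d : ℕ} {p : Fin d → ℕ} (K : OpenKnots p) where
  Om : ℕ → Set (Fin d → ℝ)
  closed : ∀ k, IsClosed (Om k)
  zero : Om 0 = Icc 0 1
  nested : ∀ k, Om (k + 1) ⊆ Om k
  union : ∀ k, Om (k + 1) = ⋃₀ {T | T ∈ K.cells k ∧ T ⊆ Om (k + 1)}
  eventually_empty : ∃ M, Om M = ∅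

namespace HierMesh

variable {d : ℕ} {p : Fin d → ℕ} {K : OpenKnots p} (H : HierMesh K)

/-- The minimal `M` such that the subdomain of level `M` is empty. -/
def M : ℕ := sInf {M | H.Om M = ∅}

/-- The elements of the hierarchical mesh. -/
def mesh : Set (Set (Fin d → ℝ)) :=
  {T | ∃ k, T ∈ K.cells k ∧ T ⊆ H.Om k ∧ ¬ T ⊆ H.Om (k + 1)}

/-- The level of an element: the unique `k` with `T ⊆ Om k` and `T ⊄ Om (k + 1)`. -/
def level (T : Set (Fin d → ℝ)) : ℕ := sInf {k | T ⊆ H.Om k ∧ ¬ T ⊆ H.Om (k + 1)}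

/-- The recursion for the hierarchical basis; a B-spline is represented by its level and index, and
`tsupport` is its (closed) support. -/
def stage : ℕ → Set (Σ k, K.Index k)
  | 0 => {q | q.1 = 0}
  | n + 1 => {q | q ∈ stage n ∧ ¬ tsupport (K.B q.1 q.2) ⊆ H.Om (n + 1)} ∪
      {q | q.1 = n + 1 ∧ tsupport (K.B q.1 q.2) ⊆ H.Om (n + 1)}

/-- The hierarchical B-splines. -/
def basis : Set (Σ k, K.Index k) := H.stage (H.M - 1)

/-- The hierarchical spline space. -/
def Y : Submodule ℝ ((Fin d → ℝ) → ℝ) :=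
  Submodule.span ℝ ((fun q : Σ k, K.Index k => K.B q.1 q.2) '' H.basis)

/-- The hierarchical splines with zero boundary values. -/
def X : Set ((Fin d → ℝ) → ℝ) := {V | V ∈ H.Y ∧ ∀ s ∈ frontier (paramDomain d), V s = 0}

/-- `T'` is a neighbor of `T`. -/
def Neighbor (T T' : Set (Fin d → ℝ)) : Prop :=
  T' ∈ H.mesh ∧ ∃ q ∈ H.basis, T ⊆ tsupport (K.B q.1 q.2) ∧ T' ⊆ tsupport (K.B q.1 q.2)

/-- Admissible hierarchical meshes: the levels of neighbors differ at most by one. -/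
def Admissible : Prop :=
  ∀ T ∈ H.mesh, ∀ T' ∈ H.mesh, H.Neighbor T T' → |(H.level T : ℤ) - (H.level T' : ℤ)| ≤ 1

/-- The patch of order `n` of a set. -/
def patch : ℕ → Set (Fin d → ℝ) → Set (Fin d → ℝ)
  | 0, ω => ω
  | n + 1, ω => ⋃₀ {T | T ∈ H.mesh ∧ (T ∩ patch n ω).Nonempty}

open Classical in
/-- The truncation with respect to level `k`: from the representation in the basis of level `k`, the
B-splines with support in `Om k` are dropped. -/
def trunc (k : ℕ) (f : (Fin d → ℝ) → ℝ) : (Fin d → ℝ) → ℝ :=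
  ∑ j : K.Index k, if tsupport (K.B k j) ⊆ H.Om k then 0 else K.coeff k f j • K.B k j

/-- `truncIter k n f` is `trunc (k + n) (… (trunc (k + 1) f))`. -/
def truncIter (k : ℕ) : ℕ → ((Fin d → ℝ) → ℝ) → (Fin d → ℝ) → ℝ
  | 0, f => f
  | n + 1, f => H.trunc (k + n + 1) (truncIter k n f)

/-- The truncated hierarchical B-spline: truncation with respect to the levels `k + 1, …, M - 1`. -/
def Trunc (k : ℕ) (j : K.Index k) : (Fin d → ℝ) → ℝ := H.truncIter k (H.M - 1 - k) (K.B k j)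

/-- A choice of a cell of level `k` in the support of each B-spline of level `k`, which is an element
of the hierarchical mesh if the B-spline belongs to the hierarchical basis. -/
structure CellChoice where
  cell : (k : ℕ) → K.Index k → Set (Fin d → ℝ)
  mem_cells : ∀ k j, cell k j ∈ K.cells k
  subset_supp : ∀ k j, cell k j ⊆ tsupport (K.B k j)
  mem_mesh : ∀ k j, (⟨k, j⟩ : Σ k, K.Index k) ∈ H.basis → cell k j ∈ H.mesh

variable {H}

/-- The functional `v ↦ ∫ β* v` over the cell chosen for the B-spline `β`. -/
def CellChoice.functional (S : H.CellChoice) (k : ℕ) (j : K.Index k) (v : (Fin d → ℝ) → ℝ) : ℝ :=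
  ∫ x in S.cell k j, K.dual k j (S.cell k j) x * v x

open Classical in
/-- The Scott–Zhang-type operator. -/
def CellChoice.scottZhang (S : H.CellChoice) (v : (Fin d → ℝ) → ℝ) : (Fin d → ℝ) → ℝ :=
  ∑ k ∈ Finset.range H.M, ∑ j : K.Index k,
    if (⟨k, j⟩ : Σ k, K.Index k) ∈ H.basis ∧ ∀ s ∈ frontier (paramDomain d), K.B k j s = 0 then
      S.functional k j v • H.Trunc k j
    else 0

end HierMesh

end

/-! # The Scott–Zhang-type operator on hierarchical splines

The operator is `v ↦ ∑ λ_β(v) • Trunc β`, where `λ_β(v) = ∫ β* v` over the chosen cell of the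
hierarchical B-spline `β`. Three facts about B-splines carry the proof.

*Nestedness with nonnegative coefficients* (`OpenKnots.exists_B_refine`, from knot insertion,
`mspline_skip`). Truncation drops nonnegative terms, so that `0 ≤ Trunc β ≤ β`
(`HierMesh.Trunc_nonneg`, `HierMesh.Trunc_le`); hence `Trunc β` vanishes on the boundary if `β` does.
Moreover `β - Trunc β` is a combination of finer B-splines with support in the subdomain of their
level; these are hierarchical splines (`HierMesh.fine_le_Y`), and they vanish on the mesh elements of
the level of `β` (`HierMesh.fine_eq_zero`).

*Dual functions of size `1 / |T|`* (`exists_dual_bspline`, `OpenKnots.exists_isDual`). Marsden's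
identity expresses the polynomials `(u - r) ^ p` in the B-splines that are active on a span, and the
Gram matrix of the B-splines is inverted by means of the one of these polynomials, which does not
depend on the knots. The constant depends only on the degree and the ratio of the lengths of the spans
of one level, which is controlled by the shortest span of level `0`.

*Biorthogonality* (`HierMesh.CellChoice.functional_sum_Trunc`). On an element of level `k`, a truncated
B-spline is a combination of B-splines of level `k`, in which other hierarchical B-splines of that
level do not occur; therefore `λ_β (Trunc β')` is `1` if `β' = β` and `0` otherwise. By a dimension
count the truncated B-splines form a basis of the hierarchical splines with coefficient functionals
`λ_β`. If the spline vanishes on the boundary, then so do the coefficients of the B-splines that do not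
(`HierMesh.CellChoice.functional_eq_zero_of_boundary`). This proves the projection property.

For the stability on an element `T` of level `k`, admissibility leaves only B-splines of the levels
`k - 1` and `k` (`HierMesh.active_elem`), whose values add up to at most `2`. Their chosen cells lie in
the patch of `T`: the cells of the level of `β` in its support are elements or are divided into
elements that share the center, so that a chain of at most `p + 1` such cells (with the maximal degree `p`) from `T` to the chosen
cell costs `2 (p + 1)` layers of elements (`HierMesh.cell_choice_subset_patch`). The bound of the dual
functions and `|T| ≤ C |T_β|` give the estimate.
-/

/-! ### Univariate B-splines: support, positivity and sums -/

theorem bspline_zero (t : ℕ → ℝ) (j : ℕ) (s : ℝ)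
    [Decidable ((t j ≤ s ∧ s < t (j + 1)) ∨ (t j < s ∧ s = 1 ∧ t (j + 1) = 1))] :
    bspline 0 t j s =
      if (t j ≤ s ∧ s < t (j + 1)) ∨ (t j < s ∧ s = 1 ∧ t (j + 1) = 1) then 1 else 0 := by
  rw [bspline]
  congr

/-- A B-spline is determined by the knots in its support, up to a shift of the index. -/
theorem bspline_congr {t t' : ℕ → ℝ} (c : ℕ) (s : ℝ) :
    ∀ q j, (∀ n, j ≤ n → n ≤ j + q + 1 → t n = t' (n + c)) →
      bspline q t j s = bspline q t' (j + c) s := by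
  intro q
  induction q with
  | zero =>
    intro j h
    classical
    have h0 := h j le_rfl (by omega)
    have h1 := h (j + 1) (by omega) (by omega)
    rw [show j + 1 + c = j + c + 1 by omega] at h1
    simp only [bspline_zero, h0, h1]
  | succ q ih =>
    intro j h
    have h0 := h j le_rfl (by omega)
    have h1 := h (j + 1) (by omega) (by omega)
    have h2 := h (j + q + 1) (by omega) (by omega)
    have h3 := h (j + q + 2) (by omega) (by omega)
    rw [show j + 1 + c = j + c + 1 by omega] at h1
    rw [show j + q + 1 + c = j + c + q + 1 by omega] at h2
    rw [show j + q + 2 + c = j + c + q + 2 by omega] at h3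
    rw [bspline, bspline, ih j fun n hn hn' => h n hn (by omega),
      ih (j + 1) fun n hn hn' => h n (by omega) (by omega), h0, h1, h2, h3,
      show j + 1 + c = j + c + 1 by omega]

section Monotone

variable {t : ℕ → ℝ}

theorem bspline_ne_zero (ht : Monotone t) (s : ℝ) :
    ∀ q j, bspline q t j s ≠ 0 → t j ≤ s ∧ s ≤ t (j + q + 1) ∧ t j < t (j + q + 1) := by
  intro q
  induction q with
  | zero =>
    intro j h
    classical
    rw [bspline_zero] at h
    have h' : (t j ≤ s ∧ s < t (j + 1)) ∨ (t j < s ∧ s = 1 ∧ t (j + 1) = 1) := by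
      by_contra hc
      exact h (if_neg hc)
    rcases h' with ⟨h1, h2⟩ | ⟨h1, h2, h3⟩
    · exact ⟨h1, h2.le, h1.trans_lt h2⟩
    · exact ⟨h1.le, by simp [h2, h3], by simp only [Nat.add_zero]; linarith⟩
  | succ q ih =>
    intro j h
    have h' : bspline q t j s ≠ 0 ∨ bspline q t (j + 1) s ≠ 0 := by
      by_contra! hc
      simp [bspline, hc.1, hc.2] at h
    have m1 : t j ≤ t (j + 1) := ht (by omega)
    have m2 : t (j + q + 1) ≤ t (j + (q + 1) + 1) := ht (by omega)
    rcases h' with h' | h'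
    · obtain ⟨h1, h2, h3⟩ := ih j h'
      exact ⟨h1, by linarith, by linarith⟩
    · obtain ⟨h1, h2, h3⟩ := ih (j + 1) h'
      rw [show j + 1 + q + 1 = j + (q + 1) + 1 by omega] at h2 h3
      exact ⟨by linarith, by linarith, by linarith⟩

/-- On an open knot span only the B-splines whose support contains the span are active. -/
theorem bspline_index_of_ne_zero (ht : Monotone t) {s : ℝ} {q j m : ℕ}
    (hs : s ∈ Ioo (t m) (t (m + 1))) (h : bspline q t j s ≠ 0) : j ≤ m ∧ m ≤ j + q := by
  obtain ⟨h1, h2, -⟩ := bspline_ne_zero ht s q j h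
  have a := ht.reflect_lt (h1.trans_lt hs.2)
  have b := ht.reflect_lt (hs.1.trans_le h2)
  omega

theorem bspline_nonneg (ht : Monotone t) (s : ℝ) : ∀ q j, 0 ≤ bspline q t j s := by
  intro q
  induction q with
  | zero =>
    intro j
    classical
    rw [bspline_zero]
    split_ifs <;> norm_num
  | succ q ih =>
    intro j
    rw [bspline]
    apply add_nonneg
    · by_cases h : bspline q t j s = 0
      · simp [h]
      · obtain ⟨h1, h2, h3⟩ := bspline_ne_zero ht s q j h
        exact mul_nonneg (div_nonneg (by linarith) (by linarith)) (ih j)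
    · by_cases h : bspline q t (j + 1) s = 0
      · simp [h]
      · obtain ⟨h1, h2, h3⟩ := bspline_ne_zero ht s q (j + 1) h
        rw [show j + 1 + q + 1 = j + q + 2 by omega] at h2 h3
        exact mul_nonneg (div_nonneg (by linarith) (by linarith)) (ih (j + 1))

theorem bspline_pos (ht : Monotone t) {s : ℝ} {m : ℕ} (hs : s ∈ Ioo (t m) (t (m + 1))) :
    ∀ q j, j ≤ m → m ≤ j + q → 0 < bspline q t j s := by
  intro q
  induction q with
  | zero =>
    intro j h1 h2
    obtain rfl : j = m := by omega
    classical
    rw [bspline_zero, if_pos (Or.inl ⟨hs.1.le, hs.2⟩)]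
    norm_num
  | succ q ih =>
    intro j h1 h2
    have m1 : t j ≤ t m := ht h1
    have m2 : t (m + 1) ≤ t (j + q + 2) := ht (by omega)
    have hs1 := hs.1
    have hs2 := hs.2
    have hl : 0 ≤ (s - t j) / (t (j + q + 1) - t j) * bspline q t j s :=
      mul_nonneg (div_nonneg (by linarith) (sub_nonneg.2 (ht (by omega)))) (bspline_nonneg ht _ _ _)
    have hr : 0 ≤ (t (j + q + 2) - s) / (t (j + q + 2) - t (j + 1)) * bspline q t (j + 1) s :=
      mul_nonneg (div_nonneg (by linarith) (sub_nonneg.2 (ht (by omega)))) (bspline_nonneg ht _ _ _)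
    rw [bspline]
    rcases Nat.lt_or_ge (j + q) m with h | h
    · refine add_pos_of_nonneg_of_pos hl (mul_pos (div_pos (by linarith) ?_)
        (ih (j + 1) (by omega) (by omega)))
      have : t (j + 1) ≤ t m := ht (by omega)
      linarith
    · refine add_pos_of_pos_of_nonneg (mul_pos (div_pos (by linarith) ?_) (ih j h1 h)) hr
      have : t (m + 1) ≤ t (j + q + 1) := ht (by omega)
      linarith

end Monotone

/-- The B-spline divided by the length of its support, with value `0` if the support is trivial.
In this scaling the Cox–de Boor recursion and knot insertion hold without exceptional cases. -/
noncomputable def mspline (q : ℕ) (t : ℕ → ℝ) (j : ℕ) (s : ℝ) : ℝ :=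
  bspline q t j s / (t (j + q + 1) - t j)

theorem bspline_succ (q : ℕ) (t : ℕ → ℝ) (j : ℕ) (s : ℝ) :
    bspline (q + 1) t j s =
      (s - t j) * mspline q t j s + (t (j + q + 2) - s) * mspline q t (j + 1) s := by
  rw [bspline, mspline, mspline, show j + 1 + q + 1 = j + q + 2 by omega]
  ring

theorem mspline_congr {t t' : ℕ → ℝ} (c : ℕ) (s : ℝ) (q j : ℕ)
    (h : ∀ n, j ≤ n → n ≤ j + q + 1 → t n = t' (n + c)) :
    mspline q t j s = mspline q t' (j + c) s := by
  rw [mspline, mspline, bspline_congr c s q j h, h j le_rfl (by omega),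
    h (j + q + 1) (by omega) le_rfl, show j + q + 1 + c = j + c + q + 1 by omega]

section Monotone

variable {t : ℕ → ℝ}

theorem mul_mspline (ht : Monotone t) (q j : ℕ) (s : ℝ) :
    (t (j + q + 1) - t j) * mspline q t j s = bspline q t j s := by
  by_cases h : bspline q t j s = 0
  · simp [mspline, h]
  · have := (bspline_ne_zero ht s q j h).2.2
    rw [mspline, mul_div_cancel₀]
    linarith

theorem mspline_eq_zero {q j : ℕ} {s : ℝ} (h : t (j + q + 1) = t j) : mspline q t j s = 0 := by
  simp [mspline, h]

theorem sum_bspline_le_one (ht : Monotone t) (h1 : ∀ n, t n ≤ 1) (s : ℝ) :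
    ∀ q n, ∑ j ∈ Finset.range n, bspline q t j s ≤ 1 := by
  intro q
  induction q with
  | zero =>
    intro n
    classical
    -- the spans `[t j, t (j + 1))`, closed at `1`, are disjoint
    by_cases h : ∃ m ∈ Finset.range n, bspline 0 t m s ≠ 0
    · obtain ⟨m, hm, h⟩ := h
      rw [Finset.sum_eq_single_of_mem m hm]
      · rw [bspline_zero]; split_ifs <;> norm_num
      · intro j _ hj
        by_contra h'
        have key : ∀ a b : ℕ, a < b → bspline 0 t a s ≠ 0 → bspline 0 t b s ≠ 0 → False := by
          intro a b hab ha hb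
          rw [bspline_zero] at ha hb
          have ha' := not_imp_comm.1 (if_neg (α := ℝ)) ha
          have hb' := not_imp_comm.1 (if_neg (α := ℝ)) hb
          have : t (a + 1) ≤ t b := ht hab
          have := h1 (b + 1)
          rcases ha' with ⟨_, h2⟩ | ⟨_, h2, h3⟩ <;> rcases hb' with ⟨h4, h5⟩ | ⟨h4, h5, h6⟩ <;>
            linarith
        rcases lt_or_gt_of_ne hj with hlt | hlt
        · exact key _ _ hlt h' h
        · exact key _ _ hlt h h'
    · push Not at h
      rw [Finset.sum_eq_zero h]
      norm_num
  | succ q ih =>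
    intro n
    have hM : ∀ j, 0 ≤ mspline q t j s := fun j =>
      div_nonneg (bspline_nonneg ht _ _ _) (sub_nonneg.2 (ht (by omega)))
    have hl : ∀ j, 0 ≤ (s - t j) * mspline q t j s := by
      intro j
      by_cases h : bspline q t j s = 0
      · simp [mspline, h]
      · exact mul_nonneg (by linarith [(bspline_ne_zero ht s q j h).1]) (hM j)
    have hr : ∀ j, 0 ≤ (t (j + q + 1) - s) * mspline q t j s := by
      intro j
      by_cases h : bspline q t j s = 0
      · simp [mspline, h]
      · exact mul_nonneg (by linarith [(bspline_ne_zero ht s q j h).2.1]) (hM j)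
    calc ∑ j ∈ Finset.range n, bspline (q + 1) t j s
        = ∑ j ∈ Finset.range n, (s - t j) * mspline q t j s
          + ∑ j ∈ Finset.range n, (t (j + 1 + q + 1) - s) * mspline q t (j + 1) s := by
          rw [← Finset.sum_add_distrib]
          refine Finset.sum_congr rfl fun j _ => ?_
          rw [bspline_succ, show j + 1 + q + 1 = j + q + 2 by omega]
      _ ≤ ∑ j ∈ Finset.range (n + 1), (s - t j) * mspline q t j s
          + ∑ j ∈ Finset.range (n + 1), (t (j + q + 1) - s) * mspline q t j s := by
          rw [Finset.sum_range_succ (fun j => (s - t j) * mspline q t j s),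
            Finset.sum_range_succ' (fun j => (t (j + q + 1) - s) * mspline q t j s)]
          linarith [hl n, hr 0]
      _ = ∑ j ∈ Finset.range (n + 1), bspline q t j s := by
          rw [← Finset.sum_add_distrib]
          refine Finset.sum_congr rfl fun j _ => ?_
          rw [← mul_mspline ht]
          ring
      _ ≤ 1 := ih (n + 1)

end Monotone

/-! ### Knot insertion -/

/-- The increasing enumeration of the natural numbers different from `r`. -/
def skipIndex (r n : ℕ) : ℕ := if n < r then n else n + 1

theorem monotone_skipIndex (r : ℕ) : Monotone (skipIndex r) := by
  intro a b h
  unfold skipIndex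
  split_ifs <;> omega

/-- Omitting the knot `τ r` among `τ j, …, τ (j + q + 2)`, in the scaling of `mspline`. -/
theorem mspline_skip {τ : ℕ → ℝ} (hτ : Monotone τ) (h1 : ∀ n, τ n ≤ 1) (s : ℝ) :
    ∀ q j r, j ≤ r → r ≤ j + q + 2 →
      (τ (j + q + 2) - τ j) * mspline q (τ ∘ skipIndex r) j s =
        (τ r - τ j) * mspline q τ j s + (τ (j + q + 2) - τ r) * mspline q τ (j + 1) s := by
  have first : ∀ q r, (τ (r + q + 2) - τ r) * mspline q (τ ∘ skipIndex r) r s =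
        (τ r - τ r) * mspline q τ r s + (τ (r + q + 2) - τ r) * mspline q τ (r + 1) s := by
    intro q r
    rw [mspline_congr (t' := τ) 1 s q r]
    · ring
    · intro n hn _
      simp [skipIndex, Nat.not_lt.2 hn]
  have last : ∀ q j, (τ (j + q + 2) - τ j) * mspline q (τ ∘ skipIndex (j + q + 2)) j s =
        (τ (j + q + 2) - τ j) * mspline q τ j s
          + (τ (j + q + 2) - τ (j + q + 2)) * mspline q τ (j + 1) s := by
    intro q j
    rw [mspline_congr (t' := τ) 0 s q j]
    · simp
    · intro n _ hn
      simp [skipIndex, show n < j + q + 2 by omega]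
  have ht : ∀ r, Monotone (τ ∘ skipIndex r) := fun r => hτ.comp (monotone_skipIndex r)
  intro q
  induction q with
  | zero =>
    intro j r hj hr
    rcases (by omega : r = j ∨ r = j + 0 + 2 ∨ r = j + 1) with rfl | rfl | rfl
    · exact first 0 r
    · exact last 0 j
    · have e1 : (τ ∘ skipIndex (j + 1)) j = τ j := by simp [skipIndex]
      have e2 : (τ ∘ skipIndex (j + 1)) (j + 1) = τ (j + 2) := by simp [skipIndex]
      have h := mul_mspline (ht (j + 1)) 0 j s
      have h' := mul_mspline hτ 0 j s
      have h'' := mul_mspline hτ 0 (j + 1) s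
      simp only [Nat.add_zero] at h h' h'' ⊢
      rw [e1, e2] at h
      rw [h, h', h'']
      classical
      rw [bspline_zero, bspline_zero, bspline_zero, e1, e2]
      have := hτ (show j ≤ j + 1 by omega)
      have := hτ (show j + 1 ≤ j + 1 + 1 by omega)
      have a1 := h1 (j + 1 + 1)
      rw [show j + 2 = j + 1 + 1 by omega]
      by_cases c1 : s < τ (j + 1)
      · rw [if_neg (c := (τ (j + 1) ≤ s ∧ s < τ (j + 1 + 1)) ∨ _), add_zero]
        · congr 1
          apply propext
          constructor
          · rintro (h | h)
            · exact Or.inl ⟨h.1, c1⟩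
            · exfalso; linarith
          · rintro (h | h)
            · exact Or.inl ⟨h.1, by linarith⟩
            · exfalso; linarith
        · rintro (h | h) <;> linarith [h.1]
      · push Not at c1
        by_cases c2 : τ (j + 1) = 1 ∧ s = 1
        · rw [if_neg (c := (τ (j + 1) ≤ s ∧ s < τ (j + 1 + 1)) ∨ _), add_zero]
          · have : τ (j + 1 + 1) = 1 := by linarith
            rw [this, c2.1]
          · rintro (h | h)
            · linarith [h.2, c2.1, c2.2]
            · linarith [h.1, c2.1, c2.2]
        · rw [if_neg (c := (τ j ≤ s ∧ s < τ (j + 1)) ∨ _), zero_add]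
          · congr 1
            apply propext
            constructor
            · rintro (h | h)
              · exact Or.inl ⟨c1, h.2⟩
              · refine Or.inr ⟨lt_of_le_of_ne c1 fun h' => c2 ⟨?_, h.2.1⟩, h.2⟩
                linarith [h.2.1]
            · rintro (h | h)
              · exact Or.inl ⟨by linarith, h.2⟩
              · exact Or.inr ⟨by linarith [h.1], h.2⟩
          · rintro (h | h)
            · linarith [h.2]
            · exact c2 ⟨h.2.2, h.2.1⟩
  | succ q ih =>
    intro j r hj hr
    rcases (by omega : r = j ∨ r = j + (q + 1) + 2 ∨ (j + 1 ≤ r ∧ r ≤ j + q + 2))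
      with rfl | rfl | ⟨hj', hr'⟩
    · exact first _ r
    · exact last _ j
    have i1 := ih j r hj hr'
    have i2 := ih (j + 1) r hj' (by omega)
    have e1 : (τ ∘ skipIndex r) j = τ j := by simp [skipIndex, show j < r by omega]
    have e2 : (τ ∘ skipIndex r) (j + q + 2) = τ (j + q + 3) := by
      simp [skipIndex, show ¬ j + q + 2 < r by omega]
    have d1 := mul_mspline hτ (q + 1) j s
    have d2 := mul_mspline hτ (q + 1) (j + 1) s
    have d3 := mul_mspline (ht r) (q + 1) j s
    rw [bspline_succ] at d1 d2 d3
    rw [show j + (q + 1) + 1 = j + q + 2 by omega] at d1 d3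
    rw [show j + 1 + (q + 1) + 1 = j + q + 3 by omega,
      show j + 1 + q + 2 = j + q + 3 by omega, show j + 1 + 1 = j + 2 by omega] at d2
    rw [show j + 1 + q + 2 = j + q + 3 by omega, show j + 1 + 1 = j + 2 by omega] at i2
    rw [e1, e2] at d3
    rw [show j + (q + 1) + 2 = j + q + 3 by omega, d3]
    have m1 := hτ (show j ≤ r by omega)
    have m2 := hτ (show r ≤ j + q + 2 by omega)
    have m3 := hτ (show j + 1 ≤ r by omega)
    have m4 := hτ (show j + q + 2 ≤ j + q + 3 by omega)
    by_cases hA : τ (j + q + 2) = τ j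
    · have z0 : mspline q τ j s = 0 := mspline_eq_zero (by
        have := hτ (show j ≤ j + q + 1 by omega)
        have := hτ (show j + q + 1 ≤ j + q + 2 by omega)
        linarith)
      have z1 : mspline q τ (j + 1) s = 0 := mspline_eq_zero (by
        have := hτ (show j ≤ j + 1 by omega)
        have := hτ (show j + 1 ≤ j + q + 2 by omega)
        rw [show j + 1 + q + 1 = j + q + 2 by omega]
        linarith)
      have z2 : mspline q (τ ∘ skipIndex r) j s = 0 := mspline_eq_zero (by
        have := (ht r) (show j ≤ j + q + 1 by omega)
        have h3 : (τ ∘ skipIndex r) (j + q + 1) ≤ τ (j + q + 2) := hτ (by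
          unfold skipIndex; split_ifs <;> omega)
        linarith)
      have hx : τ r = τ j := by linarith
      rw [z0, z1] at i1 d1
      rw [z1] at i2 d2
      rw [z2, hx]
      by_cases hB : τ (j + q + 3) = τ (j + 1)
      · have : τ (j + q + 3) = τ j := by linarith
        have z3 : mspline q (τ ∘ skipIndex r) (j + 1) s = 0 := mspline_eq_zero (by
          have := (ht r) (show j + 1 ≤ j + 1 + q + 1 by omega)
          have h3 : (τ ∘ skipIndex r) (j + 1 + q + 1) ≤ τ (j + q + 3) := hτ (by
            unfold skipIndex; split_ifs <;> omega)
          have h4 : τ (j + 1) ≤ (τ ∘ skipIndex r) (j + 1) := hτ (by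
            unfold skipIndex; split_ifs <;> omega)
          linarith)
        rw [z3, this]
        ring
      · have hB' : τ (j + q + 3) - τ (j + 1) ≠ 0 := sub_ne_zero.2 hB
        apply mul_left_cancel₀ hB'
        rw [hx] at i2
        linear_combination (τ (j + q + 3) - s) * i2 - (τ (j + q + 3) - τ j) * d2
    · have hA' : τ (j + q + 2) - τ j ≠ 0 := sub_ne_zero.2 hA
      by_cases hB : τ (j + q + 3) = τ (j + 1)
      · have z3 : mspline q (τ ∘ skipIndex r) (j + 1) s = 0 := mspline_eq_zero (by
          have := (ht r) (show j + 1 ≤ j + 1 + q + 1 by omega)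
          have h3 : (τ ∘ skipIndex r) (j + 1 + q + 1) ≤ τ (j + q + 3) := hτ (by
            unfold skipIndex; split_ifs <;> omega)
          have h4 : τ (j + 1) ≤ (τ ∘ skipIndex r) (j + 1) := hτ (by
            unfold skipIndex; split_ifs <;> omega)
          linarith)
        have z1 : mspline q τ (j + 1) s = 0 := mspline_eq_zero (by
          have := hτ (show j + 1 ≤ j + q + 2 by omega)
          rw [show j + 1 + q + 1 = j + q + 2 by omega]
          linarith)
        have hx : τ r = τ (j + q + 3) := by linarith
        rw [z1] at i1 d1
        rw [z3, hx]
        rw [hx] at i1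
        apply mul_left_cancel₀ hA'
        linear_combination (s - τ j) * i1 - (τ (j + q + 3) - τ j) * d1
      · have hB' : τ (j + q + 3) - τ (j + 1) ≠ 0 := sub_ne_zero.2 hB
        apply mul_left_cancel₀ hA'
        apply mul_left_cancel₀ hB'
        linear_combination (τ (j + q + 3) - τ (j + 1)) * (s - τ j) * i1
          + (τ (j + q + 2) - τ j) * (τ (j + q + 3) - s) * i2
          - (τ (j + q + 3) - τ (j + 1)) * (τ r - τ j) * d1
          - (τ (j + q + 2) - τ j) * (τ (j + q + 3) - τ r) * d2

/-- **Knot insertion** (Boehm): a B-spline on the coarse knots is a nonnegative combination of at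
most two consecutive B-splines on the knots with one more knot. -/
theorem bspline_skip {τ : ℕ → ℝ} (hτ : Monotone τ) (h1 : ∀ n, τ n ≤ 1) (q j r : ℕ) :
    ∃ α β : ℝ, 0 ≤ α ∧ 0 ≤ β ∧ ∀ s, bspline q (τ ∘ skipIndex r) j s =
      α * bspline q τ j s + β * bspline q τ (j + 1) s := by
  by_cases hj : r ≤ j
  · refine ⟨0, 1, le_rfl, zero_le_one, fun s => ?_⟩
    rw [bspline_congr (t' := τ) 1 s q j]
    · ring
    · intro n hn _
      simp [skipIndex, show ¬ n < r by omega]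
  by_cases hr : j + q + 1 < r
  · refine ⟨1, 0, zero_le_one, le_rfl, fun s => ?_⟩
    rw [bspline_congr (t' := τ) 0 s q j]
    · simp
    · intro n _ hn
      simp [skipIndex, show n < r by omega]
  refine ⟨(τ r - τ j) / (τ (j + q + 1) - τ j),
    (τ (j + q + 2) - τ r) / (τ (j + 1 + q + 1) - τ (j + 1)), ?_, ?_, fun s => ?_⟩
  · exact div_nonneg (sub_nonneg.2 (hτ (by omega))) (sub_nonneg.2 (hτ (by omega)))
  · exact div_nonneg (sub_nonneg.2 (hτ (by omega))) (sub_nonneg.2 (hτ (by omega)))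
  · have h := mspline_skip hτ h1 s q j r (by omega) (by omega)
    have e1 : (τ ∘ skipIndex r) j = τ j := by simp [skipIndex, show j < r by omega]
    have e2 : (τ ∘ skipIndex r) (j + q + 1) = τ (j + q + 2) := by
      simp [skipIndex, show ¬ j + q + 1 < r by omega]
    rw [← mul_mspline (hτ.comp (monotone_skipIndex r)), e1, e2, h, mspline, mspline]
    ring

/-! ### Marsden's identity and values at the end points -/

/-- **Marsden's identity** on the open knot span with left end `t (a + q)`. -/
theorem marsden {t : ℕ → ℝ} (ht : Monotone t) (y x : ℝ) :
    ∀ q a, x ∈ Ioo (t (a + q)) (t (a + q + 1)) →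
      ∑ i ∈ Finset.range (q + 1),
        (∏ l ∈ Finset.range q, (t (a + i + l + 1) - y)) * bspline q t (a + i) x = (x - y) ^ q := by
  intro q
  induction q with
  | zero =>
    intro a hx
    classical
    simp only [zero_add, Finset.range_one, Finset.range_zero, Finset.prod_empty, one_mul,
      Finset.sum_singleton, pow_zero, add_zero]
    rw [bspline_zero, if_pos (Or.inl ⟨hx.1.le, hx.2⟩)]
  | succ q ih =>
    intro a hx
    rw [show a + (q + 1) = a + 1 + q by omega] at hx
    have hI := ih (a + 1) hx
    have vanish : ∀ j, j = a ∨ j = a + q + 2 → mspline q t j x = 0 := by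
      intro j hj
      by_contra h
      have h' : bspline q t j x ≠ 0 := fun h0 => h (by simp [mspline, h0])
      have := bspline_index_of_ne_zero ht hx h'
      omega
    set P : ℕ → ℝ := fun j => ∏ l ∈ Finset.range (q + 1), (t (j + l + 1) - y) with hP
    calc ∑ i ∈ Finset.range (q + 1 + 1), P (a + i) * bspline (q + 1) t (a + i) x
        = ∑ i ∈ Finset.range (q + 2), P (a + i) * ((x - t (a + i)) * mspline q t (a + i) x)
          + ∑ i ∈ Finset.range (q + 2),
            P (a + i) * ((t (a + i + q + 2) - x) * mspline q t (a + i + 1) x) := by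
          rw [← Finset.sum_add_distrib]
          refine Finset.sum_congr rfl fun i _ => ?_
          rw [bspline_succ]
          ring
      _ = ∑ i ∈ Finset.range (q + 1),
            P (a + (i + 1)) * ((x - t (a + (i + 1))) * mspline q t (a + (i + 1)) x)
          + ∑ i ∈ Finset.range (q + 1),
            P (a + i) * ((t (a + i + q + 2) - x) * mspline q t (a + i + 1) x) := by
          rw [Finset.sum_range_succ', Finset.sum_range_succ _ (q + 1), add_zero,
            vanish a (Or.inl rfl), show a + (q + 1) + 1 = a + q + 2 by omega,
            vanish (a + q + 2) (Or.inr rfl)]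
          ring
      _ = (x - y) * ∑ i ∈ Finset.range (q + 1),
            (∏ l ∈ Finset.range q, (t (a + 1 + i + l + 1) - y)) * bspline q t (a + 1 + i) x := by
          rw [← Finset.sum_add_distrib, Finset.mul_sum]
          refine Finset.sum_congr rfl fun i _ => ?_
          rw [← mul_mspline ht, show a + (i + 1) = a + 1 + i by omega,
            show a + i + 1 = a + 1 + i by omega]
          have p1 : P (a + 1 + i) = (∏ l ∈ Finset.range q, (t (a + 1 + i + l + 1) - y)) *
              (t (a + 1 + i + q + 1) - y) := by
            rw [hP]; simp only; rw [Finset.prod_range_succ]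
          have p2 : P (a + i) = (∏ l ∈ Finset.range q, (t (a + 1 + i + l + 1) - y)) *
              (t (a + 1 + i) - y) := by
            rw [hP]; simp only; rw [Finset.prod_range_succ', show a + i + 0 + 1 = a + 1 + i by omega]
            congr 1
            refine Finset.prod_congr rfl fun l _ => ?_
            rw [show a + i + (l + 1) + 1 = a + 1 + i + l + 1 by omega]
          rw [p1, p2, show a + i + q + 2 = a + 1 + i + q + 1 by omega]
          ring
      _ = (x - y) ^ (q + 1) := by rw [hI]; ring

/-- The knots `0 = t 0 = … = t p ≤ … ≤ t N = t (N + 1) = … = 1` of an open knot vector, continued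
by the constant `1`. -/
structure IsOpenSeq (p N : ℕ) (t : ℕ → ℝ) : Prop where
  mono : Monotone t
  zero : ∀ n, n ≤ p → t n = 0
  one : ∀ n, N ≤ n → t n = 1

namespace IsOpenSeq

variable {p N : ℕ} {t : ℕ → ℝ} (h : IsOpenSeq p N t)

include h

theorem nonneg (n : ℕ) : 0 ≤ t n := by
  rw [← h.zero 0 (Nat.zero_le p)]
  exact h.mono (Nat.zero_le n)

theorem le_one (n : ℕ) : t n ≤ 1 := by
  rw [← h.one (max n N) (le_max_right _ _)]
  exact h.mono (le_max_left _ _)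

theorem lt : p < N := by
  by_contra! hc
  have := h.zero N hc
  rw [h.one N le_rfl] at this
  norm_num at this

/-- The index range of the nontrivial spans. -/
theorem span_index {m : ℕ} (hm : t m < t (m + 1)) : p ≤ m ∧ m < N := by
  constructor
  · by_contra! hc
    rw [h.zero m hc.le, h.zero (m + 1) hc] at hm
    exact lt_irrefl _ hm
  · by_contra! hc
    rw [h.one m hc, h.one (m + 1) (by omega)] at hm
    exact lt_irrefl _ hm

theorem bspline_at_zero (h0 : 0 < t (p + 1)) :
    ∀ q j, bspline q t j 0 = if j + q = p then 1 else 0 := by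
  have pos : ∀ j, p < j → 0 < t j := fun j hj => h0.trans_le (h.mono hj)
  intro q
  induction q with
  | zero =>
    intro j
    classical
    rw [bspline_zero]
    congr 1
    apply propext
    constructor
    · rintro (⟨h1, h2⟩ | h1)
      · have : j ≤ p := by
          by_contra! hc
          linarith [pos j hc]
        have : ¬ j + 1 ≤ p := fun hc => by linarith [h.zero _ hc]
        omega
      · norm_num at h1
    · intro hj
      have hj : j = p := by omega
      subst hj
      exact Or.inl ⟨(h.zero j le_rfl).le, h0⟩
  | succ q ih =>
    intro j
    rw [bspline, ih, ih]
    have : (0 - t j) / (t (j + q + 1) - t j) * (if j + q = p then 1 else 0) = 0 := by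
      split_ifs with hj
      · rw [h.zero j (by omega)]; simp
      · simp
    rw [this, zero_add]
    by_cases hj : j + (q + 1) = p
    · rw [if_pos (by omega), if_pos hj, h.zero (j + 1) (by omega),
        show j + q + 2 = p + 1 by omega, sub_zero, div_self h0.ne', one_mul]
    · rw [if_neg (by omega), if_neg hj, mul_zero]

theorem bspline_at_one (h0 : t (N - 1) < 1) :
    ∀ q, q ≤ p → ∀ j, bspline q t j 1 = if j + 1 = N then 1 else 0 := by
  have hN := h.lt
  have ltone : ∀ j, j < N → t j < 1 := fun j hj => (h.mono (by omega)).trans_lt h0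
  intro q
  induction q with
  | zero =>
    intro _ j
    classical
    rw [bspline_zero]
    congr 1
    apply propext
    constructor
    · rintro (⟨h1, h2⟩ | ⟨h1, -, h2⟩)
      · linarith [h.le_one (j + 1)]
      · have a : j < N := by
          by_contra! hc
          linarith [h.one j hc]
        have b : N ≤ j + 1 := by
          by_contra! hc
          linarith [ltone _ hc]
        omega
    · rintro rfl
      exact Or.inr ⟨h0, rfl, h.one _ le_rfl⟩
  | succ q ih =>
    intro hq j
    rw [bspline, ih (by omega), ih (by omega)]
    have : (t (j + q + 2) - 1) / (t (j + q + 2) - t (j + 1)) *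
        (if j + 1 + 1 = N then 1 else 0) = 0 := by
      split_ifs with hj
      · rw [h.one (j + q + 2) (by omega)]; simp
      · simp
    rw [this, add_zero]
    by_cases hj : j + 1 = N
    · rw [if_pos hj, h.one (j + q + 1) (by omega), mul_one]
      have := ltone j (by omega)
      exact div_self (by linarith)
    · rw [if_neg hj, mul_zero]

end IsOpenSeq

/-! ### Refinement of knot vectors -/

theorem refineKnots_cons_cons_of_eq {a b : ℝ} (l : List ℝ) (h : a = b) :
    refineKnots (a :: b :: l) = a :: refineKnots (b :: l) := by
  rw [refineKnots, if_pos h]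

theorem refineKnots_cons_cons_of_ne {a b : ℝ} (l : List ℝ) (h : a ≠ b) :
    refineKnots (a :: b :: l) = a :: (a + b) / 2 :: refineKnots (b :: l) := by
  rw [refineKnots, if_neg h]

theorem refineKnots_singleton (a : ℝ) : refineKnots [a] = [a] := by
  rw [refineKnots]
  intro a b l h
  simp at h

theorem exists_refineKnots_cons (a : ℝ) (l : List ℝ) : ∃ l', refineKnots (a :: l) = a :: l' := by
  cases l with
  | nil => exact ⟨[], refineKnots_singleton a⟩
  | cons b l =>
    by_cases h : a = b
    · exact ⟨_, refineKnots_cons_cons_of_eq l h⟩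
    · exact ⟨_, refineKnots_cons_cons_of_ne l h⟩

theorem sublist_refineKnots (L : List ℝ) : L.Sublist (refineKnots L) := by
  induction L with
  | nil => simp
  | cons a l ih =>
    cases l with
    | nil => rw [refineKnots_singleton]
    | cons b l =>
      by_cases h : a = b
      · rw [refineKnots_cons_cons_of_eq l h]
        exact ih.cons_cons a
      · rw [refineKnots_cons_cons_of_ne l h]
        exact (ih.cons _).cons_cons a

theorem exists_le_of_mem_refineKnots {L : List ℝ} (hL : L.Pairwise (· ≤ ·)) {x : ℝ}
    (hx : x ∈ refineKnots L) : ∃ lo ∈ L, ∃ hi ∈ L, lo ≤ x ∧ x ≤ hi := by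
  induction L with
  | nil => simp [refineKnots] at hx
  | cons a l ih =>
    cases l with
    | nil =>
      rw [refineKnots_singleton] at hx
      exact ⟨x, hx, x, hx, le_rfl, le_rfl⟩
    | cons b l =>
      have hab : a ≤ b := (List.pairwise_cons.1 hL).1 b (by simp)
      have key : x ∈ refineKnots (b :: l) → ∃ lo ∈ a :: b :: l, ∃ hi ∈ a :: b :: l,
          lo ≤ x ∧ x ≤ hi := by
        intro hx
        obtain ⟨lo, h1, hi, h2, h3⟩ := ih (List.pairwise_cons.1 hL).2 hx
        exact ⟨lo, List.mem_cons_of_mem _ h1, hi, List.mem_cons_of_mem _ h2, h3⟩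
      by_cases h : a = b
      · rw [refineKnots_cons_cons_of_eq l h, List.mem_cons] at hx
        rcases hx with rfl | hx
        · exact ⟨x, by simp, x, by simp, le_rfl, le_rfl⟩
        · exact key hx
      · rw [refineKnots_cons_cons_of_ne l h, List.mem_cons, List.mem_cons] at hx
        rcases hx with rfl | rfl | hx
        · exact ⟨x, by simp, x, by simp, le_rfl, le_rfl⟩
        · exact ⟨a, by simp, b, by simp, by linarith, by linarith⟩
        · exact key hx

theorem pairwise_refineKnots {L : List ℝ} (hL : L.Pairwise (· ≤ ·)) :
    (refineKnots L).Pairwise (· ≤ ·) := by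
  induction L with
  | nil => simp [refineKnots]
  | cons a l ih =>
    cases l with
    | nil => simp [refineKnots_singleton]
    | cons b l =>
      obtain ⟨h1, h2⟩ := List.pairwise_cons.1 hL
      have hab : a ≤ b := h1 b (by simp)
      have key : ∀ x ∈ refineKnots (b :: l), b ≤ x := by
        intro x hx
        obtain ⟨lo, hlo, -, -, h, -⟩ := exists_le_of_mem_refineKnots h2 hx
        rcases List.mem_cons.1 hlo with rfl | hlo
        · exact h
        · exact ((List.pairwise_cons.1 h2).1 _ hlo).trans h
      by_cases h : a = b
      · rw [refineKnots_cons_cons_of_eq l h]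
        exact List.pairwise_cons.2 ⟨fun x hx => hab.trans (key x hx), ih h2⟩
      · rw [refineKnots_cons_cons_of_ne l h]
        refine List.pairwise_cons.2 ⟨fun x hx => ?_, List.pairwise_cons.2 ⟨fun x hx => ?_, ih h2⟩⟩
        · rcases List.mem_cons.1 hx with rfl | hx
          · linarith
          · exact hab.trans (key x hx)
        · have := key x hx
          linarith

/-- Every nontrivial span after refinement is one half of a nontrivial span before. -/
theorem refineKnots_parent (L : List ℝ) : ∀ n, n + 1 < (refineKnots L).length →
    (refineKnots L).getD n 1 ≠ (refineKnots L).getD (n + 1) 1 →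
    ∃ m, m + 1 < L.length ∧ L.getD m 1 ≠ L.getD (m + 1) 1 ∧
      (((refineKnots L).getD n 1 = L.getD m 1 ∧
          (refineKnots L).getD (n + 1) 1 = (L.getD m 1 + L.getD (m + 1) 1) / 2) ∨
        ((refineKnots L).getD n 1 = (L.getD m 1 + L.getD (m + 1) 1) / 2 ∧
          (refineKnots L).getD (n + 1) 1 = L.getD (m + 1) 1)) := by
  induction L with
  | nil => intro n hn; simp [refineKnots] at hn
  | cons a l ih =>
    cases l with
    | nil => intro n hn; simp [refineKnots_singleton] at hn
    | cons b l =>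
      obtain ⟨l', hl'⟩ := exists_refineKnots_cons b l
      have key : ∀ n, n + 1 < (refineKnots (b :: l)).length →
          (refineKnots (b :: l)).getD n 1 ≠ (refineKnots (b :: l)).getD (n + 1) 1 →
          ∃ m, m + 1 < (a :: b :: l).length ∧
            (a :: b :: l).getD m 1 ≠ (a :: b :: l).getD (m + 1) 1 ∧
            (((refineKnots (b :: l)).getD n 1 = (a :: b :: l).getD m 1 ∧
              (refineKnots (b :: l)).getD (n + 1) 1 =
                ((a :: b :: l).getD m 1 + (a :: b :: l).getD (m + 1) 1) / 2) ∨
            ((refineKnots (b :: l)).getD n 1 =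
                ((a :: b :: l).getD m 1 + (a :: b :: l).getD (m + 1) 1) / 2 ∧
              (refineKnots (b :: l)).getD (n + 1) 1 = (a :: b :: l).getD (m + 1) 1)) := by
        intro n h1 h2
        obtain ⟨m, hm, h⟩ := ih n h1 h2
        refine ⟨m + 1, by simpa using hm, ?_⟩
        simpa only [List.getD_cons_succ] using h
      by_cases h : a = b
      · rw [refineKnots_cons_cons_of_eq l h]
        intro n hn hne
        cases n with
        | zero => simp [hl', h] at hne
        | succ n =>
          simp only [List.getD_cons_succ (x := a) (xs := refineKnots (b :: l))] at hne ⊢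
          exact key n (by simpa using hn) hne
      · rw [refineKnots_cons_cons_of_ne l h]
        intro n hn hne
        match n with
        | 0 => exact ⟨0, by simp, by simpa using h, Or.inl (by simp)⟩
        | 1 => exact ⟨0, by simp, by simpa using h, Or.inr (by simp [hl'])⟩
        | n + 2 =>
          simp only [List.getD_cons_succ (x := a), List.getD_cons_succ (x := (a + b) / 2)] at hne
          have := key n (by simp at hn; omega) hne
          rw [List.getD_cons_succ, List.getD_cons_succ, List.getD_cons_succ (n := n + 1 + 1),
            List.getD_cons_succ (n := n + 1)]
          exact this

/-- Every nontrivial span gives two consecutive spans after refinement. -/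
theorem refineKnots_children (L : List ℝ) : ∀ m, m + 1 < L.length →
    L.getD m 1 ≠ L.getD (m + 1) 1 →
    ∃ n, n + 2 < (refineKnots L).length ∧ (refineKnots L).getD n 1 = L.getD m 1 ∧
      (refineKnots L).getD (n + 1) 1 = (L.getD m 1 + L.getD (m + 1) 1) / 2 ∧
      (refineKnots L).getD (n + 2) 1 = L.getD (m + 1) 1 := by
  induction L with
  | nil => intro n hn; simp at hn
  | cons a l ih =>
    cases l with
    | nil => intro n hn; simp at hn
    | cons b l =>
      obtain ⟨l', hl'⟩ := exists_refineKnots_cons b l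
      intro m hm hne
      by_cases h : a = b
      · rw [refineKnots_cons_cons_of_eq l h]
        cases m with
        | zero => simp [h] at hne
        | succ m =>
          simp only [List.getD_cons_succ (x := a) (xs := b :: l)] at hne ⊢
          obtain ⟨n, h1, h2⟩ := ih m (by simpa using hm) hne
          exact ⟨n + 1, by simp; omega, h2⟩
      · rw [refineKnots_cons_cons_of_ne l h]
        cases m with
        | zero => exact ⟨0, by simp [hl'], by simp, by simp, by simp [hl']⟩
        | succ m =>
          simp only [List.getD_cons_succ (x := a) (xs := b :: l)] at hne ⊢
          obtain ⟨n, h1, h2⟩ := ih m (by simpa using hm) hne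
          exact ⟨n + 2, by simp; omega, h2⟩

/-- The part of the openness of a knot vector on `[0,1]` that is inherited by its refinements. -/
structure IsOpenList (p : ℕ) (L : List ℝ) : Prop where
  sorted : L.Pairwise (· ≤ ·)
  mem_Icc : ∀ x ∈ L, x ∈ Icc (0 : ℝ) 1
  count_zero : p + 1 ≤ L.count 0
  count_one : p + 1 ≤ L.count 1

theorem IsOpenList.refine {p : ℕ} {L : List ℝ} (h : IsOpenList p L) :
    IsOpenList p (refineKnots L) where
  sorted := pairwise_refineKnots h.sorted
  mem_Icc x hx := by
    obtain ⟨lo, h1, hi, h2, h3, h4⟩ := exists_le_of_mem_refineKnots h.sorted hx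
    exact ⟨(h.mem_Icc lo h1).1.trans h3, h4.trans (h.mem_Icc hi h2).2⟩
  count_zero := h.count_zero.trans ((sublist_refineKnots L).count_le 0)
  count_one := h.count_one.trans ((sublist_refineKnots L).count_le 1)

theorem monotone_getD {L : List ℝ} (hL : L.Pairwise (· ≤ ·)) (h1 : ∀ x ∈ L, x ≤ 1) :
    Monotone fun n => L.getD n 1 := by
  intro a b hab
  simp only
  rcases Nat.lt_or_ge b L.length with hb | hb
  · rw [List.getD_eq_getElem _ _ hb, List.getD_eq_getElem _ _ (hab.trans_lt hb)]
    rcases hab.eq_or_lt with rfl | hab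
    · exact le_rfl
    · exact List.pairwise_iff_getElem.1 hL a b _ _ hab
  · rw [List.getD_eq_default _ _ hb]
    rcases Nat.lt_or_ge a L.length with ha | ha
    · rw [List.getD_eq_getElem _ _ ha]
      exact h1 _ (List.getElem_mem _)
    · rw [List.getD_eq_default _ _ ha]

theorem IsOpenList.isOpenSeq {p : ℕ} {L : List ℝ} (h : IsOpenList p L) :
    IsOpenSeq p (L.length - (p + 1)) fun n => L.getD n 1 := by
  have hmono := monotone_getD h.sorted fun x hx => (h.mem_Icc x hx).2
  have hlen : p + 1 ≤ L.length := h.count_zero.trans List.count_le_length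
  refine ⟨hmono, fun n hn => ?_, fun n hn => ?_⟩
  · have hp : L.getD p 1 = 0 := by
      by_contra hne
      have hpos : 0 < L.getD p 1 := lt_of_le_of_ne
        (by rw [List.getD_eq_getElem _ _ (by omega)]; exact (h.mem_Icc _ (List.getElem_mem _)).1)
        (Ne.symm hne)
      have hc : (L.drop p).count 0 = 0 := by
        rw [List.count_eq_zero]
        intro hmem
        obtain ⟨i, hi, hi'⟩ := List.getElem_of_mem hmem
        rw [List.getElem_drop] at hi'
        have := hmono (show p ≤ p + i by omega)
        simp only at this
        rw [List.getD_eq_getElem L _ (n := p + i) (by simp at hi; omega), hi'] at this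
        linarith
      have := h.count_zero
      rw [← List.take_append_drop p L, List.count_append, hc] at this
      have h2 := List.count_le_length (a := (0 : ℝ)) (l := L.take p)
      rw [List.length_take] at h2
      omega
    have h0 := hmono hn
    simp only [hp] at h0
    refine le_antisymm h0 ?_
    rw [List.getD_eq_getElem _ _ (by omega)]
    exact (h.mem_Icc _ (List.getElem_mem _)).1
  · have hle : ∀ n, L.getD n 1 ≤ 1 := by
      intro n
      rcases Nat.lt_or_ge n L.length with ha | ha
      · rw [List.getD_eq_getElem _ _ ha]
        exact (h.mem_Icc _ (List.getElem_mem _)).2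
      · rw [List.getD_eq_default _ _ ha]
    set N := L.length - (p + 1) with hN
    have hp : L.getD N 1 = 1 := by
      by_contra hne
      have hlt : L.getD N 1 < 1 := lt_of_le_of_ne (hle N) hne
      have hc : (L.take (N + 1)).count 1 = 0 := by
        rw [List.count_eq_zero]
        intro hmem
        obtain ⟨i, hi, hi'⟩ := List.getElem_of_mem hmem
        rw [List.getElem_take] at hi'
        have hi2 : i < N + 1 := by simp at hi; omega
        have := hmono (show i ≤ N by omega)
        simp only at this
        rw [List.getD_eq_getElem L _ (n := i) (by simp at hi; omega), hi'] at this
        linarith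
      have := h.count_one
      rw [← List.take_append_drop (N + 1) L, List.count_append, hc] at this
      have h2 := List.count_le_length (a := (1 : ℝ)) (l := L.drop (N + 1))
      rw [List.length_drop] at h2
      omega
    have h0 := hmono hn
    simp only [hp] at h0
    exact le_antisymm (hle n) h0

open NNReal in
/-- The convex cone generated by the B-splines on the knot vector `L`. -/
noncomputable def bsplineCone (p : ℕ) (L : List ℝ) : Submodule ℝ≥0 (ℝ → ℝ) :=
  Submodule.span ℝ≥0 (range fun j : Fin (L.length - (p + 1)) =>
    bspline p (fun n => L.getD n 1) j)

theorem bsplineCone_insert (p : ℕ) (u v : List ℝ) (a x b : ℝ)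
    (hL : (u ++ a :: x :: b :: v).Pairwise (· ≤ ·))
    (h1 : ∀ y ∈ u ++ a :: x :: b :: v, y ≤ 1) :
    bsplineCone p (u ++ a :: b :: v) ≤ bsplineCone p (u ++ a :: x :: b :: v) := by
  set L' := u ++ a :: x :: b :: v with hL'
  set τ : ℕ → ℝ := fun n => L'.getD n 1 with hτ
  have hmono : Monotone τ := monotone_getD hL h1
  have hle : ∀ n, τ n ≤ 1 := by
    intro n
    rcases Nat.lt_or_ge n L'.length with ha | ha
    · rw [hτ]; simp only
      rw [List.getD_eq_getElem _ _ ha]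
      exact h1 _ (List.getElem_mem _)
    · rw [hτ]; simp only
      rw [List.getD_eq_default _ _ ha]
  have hskip : (fun n => (u ++ a :: b :: v).getD n 1) = τ ∘ skipIndex (u.length + 1) := by
    funext n
    simp only [hτ, hL', Function.comp, skipIndex]
    rcases Nat.lt_trichotomy n u.length with h | h | h
    · rw [if_pos (by omega), List.getD_append _ _ _ _ h, List.getD_append _ _ _ _ h]
    · subst h
      rw [if_pos (by omega), List.getD_append_right _ _ _ _ le_rfl,
        List.getD_append_right _ _ _ _ le_rfl]
      simp
    · rw [if_neg (by omega), List.getD_append_right _ _ _ _ (by omega),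
        List.getD_append_right _ _ _ _ (by omega)]
      obtain ⟨k, rfl⟩ : ∃ k, n = u.length + 1 + k := ⟨n - u.length - 1, by omega⟩
      rw [show u.length + 1 + k - u.length = k + 1 by omega,
        show u.length + 1 + k + 1 - u.length = k + 1 + 1 by omega]
      simp only [List.getD_cons_succ]
  have hlen : L'.length = (u ++ a :: b :: v).length + 1 := by
    simp [hL']; omega
  unfold bsplineCone
  rw [Submodule.span_le]
  rintro _ ⟨j, rfl⟩
  obtain ⟨α, β, hα, hβ, h⟩ := bspline_skip hmono hle p j (u.length + 1)
  have hj := j.2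
  have e : bspline p (fun n => (u ++ a :: b :: v).getD n 1) j =
      (⟨α, hα⟩ : NNReal) • bspline p τ j + (⟨β, hβ⟩ : NNReal) • bspline p τ (j + 1) := by
    rw [hskip]
    funext s
    exact h s
  simp only [e]
  refine Submodule.add_mem _ (Submodule.smul_mem _ _ (Submodule.subset_span ?_))
    (Submodule.smul_mem _ _ (Submodule.subset_span ?_))
  · exact ⟨⟨j, by omega⟩, rfl⟩
  · exact ⟨⟨j + 1, by omega⟩, rfl⟩

theorem bsplineCone_refine (p : ℕ) (l : List ℝ) : ∀ u : List ℝ,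
    (u ++ l).Pairwise (· ≤ ·) → (∀ y ∈ u ++ l, y ≤ 1) →
    bsplineCone p (u ++ l) ≤ bsplineCone p (u ++ refineKnots l) := by
  induction l with
  | nil => intro u _ _; simp [refineKnots]
  | cons a l ih =>
    cases l with
    | nil => intro u _ _; rw [refineKnots_singleton]
    | cons b l =>
      intro u hs h1
      by_cases h : a = b
      · rw [refineKnots_cons_cons_of_eq l h]
        simpa using ih (u ++ [a]) (by simpa using hs) (by simpa using h1)
      · rw [refineKnots_cons_cons_of_ne l h]
        have hs' : (u ++ a :: (a + b) / 2 :: b :: l).Pairwise (· ≤ ·) := by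
          simp only [List.pairwise_append, List.pairwise_cons, List.mem_cons, forall_eq_or_imp] at hs ⊢
          obtain ⟨h1, ⟨⟨h2, h3⟩, h4, h5⟩, h6⟩ := hs
          refine ⟨h1, ⟨⟨by linarith, h2, h3⟩, ⟨by linarith, fun y hy => ?_⟩, h4, h5⟩,
            fun y hy => ⟨(h6 y hy).1, ?_, (h6 y hy).2.1, (h6 y hy).2.2⟩⟩
          · linarith [h4 y hy]
          · linarith [(h6 y hy).1]
        have h1' : ∀ y ∈ u ++ a :: (a + b) / 2 :: b :: l, y ≤ 1 := by
          intro y hy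
          simp only [List.mem_append, List.mem_cons] at hy
          have ha := h1 a (by simp)
          have hb := h1 b (by simp)
          rcases hy with hy | rfl | rfl | rfl | hy
          · exact h1 y (by simp [hy])
          · exact ha
          · linarith
          · exact hb
          · exact h1 y (by simp [hy])
        refine (bsplineCone_insert p u l a ((a + b) / 2) b hs' h1').trans ?_
        simpa using ih (u ++ [a, (a + b) / 2]) (by simpa using hs') (by simpa using h1')

/-- **Nestedness with nonnegative coefficients**: a B-spline on an open knot vector is a nonnegative
combination of the B-splines on the refined knot vector. -/
theorem exists_bspline_refineKnots {p : ℕ} {L : List ℝ} (h : IsOpenList p L)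
    (j : Fin (L.length - (p + 1))) :
    ∃ c : Fin ((refineKnots L).length - (p + 1)) → ℝ, (∀ n, 0 ≤ c n) ∧
      ∀ s, bspline p (fun n => L.getD n 1) j s =
        ∑ n, c n * bspline p (fun n => (refineKnots L).getD n 1) n s := by
  have hmem : bspline p (fun n => L.getD n 1) j ∈ bsplineCone p (refineKnots L) := by
    have := bsplineCone_refine p L [] (by simpa using h.sorted)
      (by simpa using fun y hy => (h.mem_Icc y hy).2)
    simp only [List.nil_append] at this
    exact this (Submodule.subset_span ⟨j, rfl⟩)
  unfold bsplineCone at hmem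
  obtain ⟨c, hc⟩ := (Submodule.mem_span_range_iff_exists_fun NNReal).1 hmem
  refine ⟨fun n => c n, fun n => (c n).2, fun s => ?_⟩
  rw [← hc, Finset.sum_apply]
  rfl

/-! ### Univariate dual functions -/

theorem measurable_bspline (t : ℕ → ℝ) : ∀ q j, Measurable (bspline q t j) := by
  intro q
  induction q with
  | zero =>
    intro j
    classical
    have : bspline 0 t j = fun s =>
        if (t j ≤ s ∧ s < t (j + 1)) ∨ (t j < s ∧ s = 1 ∧ t (j + 1) = 1) then 1 else 0 := by
      funext s
      exact bspline_zero t j s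
    rw [this]
    refine Measurable.ite ?_ measurable_const measurable_const
    refine MeasurableSet.union (measurableSet_le measurable_const measurable_id |>.inter
      (measurableSet_lt measurable_id measurable_const)) ?_
    refine (measurableSet_lt measurable_const measurable_id).inter ?_
    exact (measurableSet_eq_fun measurable_id measurable_const).inter (MeasurableSet.const _)
  | succ q ih =>
    intro j
    have : bspline (q + 1) t j = fun s => (s - t j) / (t (j + q + 1) - t j) * bspline q t j s +
        (t (j + q + 2) - s) / (t (j + q + 2) - t (j + 1)) * bspline q t (j + 1) s := by
      funext s
      rw [bspline]
    rw [this]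
    have h1 := ih j
    have h2 := ih (j + 1)
    fun_prop

theorem bspline_le_one {t : ℕ → ℝ} (ht : Monotone t) (h1 : ∀ n, t n ≤ 1) (q j : ℕ) (s : ℝ) :
    bspline q t j s ≤ 1 :=
  (Finset.single_le_sum (f := fun j => bspline q t j s) (fun i _ => bspline_nonneg ht s q i)
    (Finset.self_mem_range_succ j)).trans (sum_bspline_le_one ht h1 s q (j + 1))

/-- The Gram matrix of the polynomials `(u - r) ^ p`, `r = 0, …, p`, on the unit interval. -/
noncomputable def shiftedPowerGram (p : ℕ) : Matrix (Fin (p + 1)) (Fin (p + 1)) ℝ :=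
  Matrix.of fun r r' => ∫ u in (0 : ℝ)..1, (u - r) ^ p * (u - r') ^ p

/-- By the Vandermonde determinant, the polynomials `(u - r) ^ p` are linearly independent. -/
theorem sum_shifted_pow_eq_zero {p : ℕ} {v : Fin (p + 1) → ℝ}
    (h : ∀ u ∈ Icc (0 : ℝ) 1, ∑ r, v r * (u - r) ^ p = 0) : v = 0 := by
  open Polynomial in
  have hQ : ∑ r : Fin (p + 1), C (v r) * (X + C (-(r : ℝ))) ^ p = 0 := by
    apply Polynomial.eq_zero_of_infinite_isRoot
    refine (Icc_infinite (zero_lt_one' ℝ)).mono fun u hu => ?_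
    simpa [Polynomial.eval_finsetSum, sub_eq_add_neg] using h u hu
  apply Matrix.eq_zero_of_forall_pow_sum_mul_pow_eq_zero (f := fun r : Fin (p + 1) => -(r : ℝ))
  · intro a b hab
    simpa [Fin.val_inj] using hab
  · intro i
    have hc := congrArg (fun P => Polynomial.coeff P (p - i)) hQ
    simp only [Polynomial.finsetSum_coeff, Polynomial.coeff_C_mul, Polynomial.coeff_X_add_C_pow,
      Polynomial.coeff_zero] at hc
    have hi : p - (p - (i : ℕ)) = i := by omega
    rw [hi] at hc
    have hch : ((p.choose (p - i) : ℕ) : ℝ) ≠ 0 := by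
      exact_mod_cast (Nat.choose_pos (by omega)).ne'
    apply mul_right_cancel₀ hch
    rw [zero_mul, Finset.sum_mul, ← hc]
    refine Finset.sum_congr rfl fun r _ => ?_
    ring

theorem isUnit_det_shiftedPowerGram (p : ℕ) : IsUnit (shiftedPowerGram p).det := by
  rw [isUnit_iff_ne_zero]
  intro hdet
  obtain ⟨v, hv, hv0⟩ := Matrix.exists_mulVec_eq_zero_iff.2 hdet
  apply hv
  apply sum_shifted_pow_eq_zero
  have hint : ∫ u in (0 : ℝ)..1, (∑ r : Fin (p + 1), v r * (u - r) ^ p) ^ 2 = 0 := by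
    have : ∀ u : ℝ, (∑ r : Fin (p + 1), v r * (u - r) ^ p) ^ 2 =
        ∑ r : Fin (p + 1), ∑ r' : Fin (p + 1), v r * v r' * ((u - r) ^ p * (u - r') ^ p) := by
      intro u
      rw [sq, Finset.sum_mul_sum]
      refine Finset.sum_congr rfl fun r _ => Finset.sum_congr rfl fun r' _ => ?_
      ring
    simp_rw [this]
    rw [intervalIntegral.integral_finsetSum fun r _ =>
      (by fun_prop : Continuous _).intervalIntegrable _ _]
    have h0 : ∀ r, ∑ r' : Fin (p + 1), shiftedPowerGram p r r' * v r' = 0 := fun r =>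
      congrFun hv0 r
    refine Finset.sum_eq_zero fun r _ => ?_
    rw [intervalIntegral.integral_finsetSum fun r _ =>
      (by fun_prop : Continuous _).intervalIntegrable _ _]
    simp_rw [intervalIntegral.integral_const_mul]
    have h1 := congrArg (v r * ·) (h0 r)
    simp only [mul_zero, Finset.mul_sum, shiftedPowerGram, Matrix.of_apply] at h1
    refine Eq.trans (Finset.sum_congr rfl fun r' _ => ?_) h1
    ring
  intro u hu
  by_contra hne
  have hpos : 0 < ∫ u in (0 : ℝ)..1, (∑ r : Fin (p + 1), v r * (u - r) ^ p) ^ 2 :=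
    intervalIntegral.integral_pos zero_lt_one (by fun_prop) (fun x _ => sq_nonneg _)
      ⟨u, hu, lt_of_le_of_ne (sq_nonneg _) (pow_ne_zero 2 hne).symm⟩
  exact hpos.ne' hint

theorem sub_le_mul_of_span_le {t : ℕ → ℝ} {D : ℝ} (hD : ∀ n, t (n + 1) - t n ≤ D) (k n : ℕ) :
    t (n + k) - t n ≤ k * D := by
  induction k with
  | zero => simp
  | succ k ih =>
    have := hD (n + k)
    rw [← add_assoc]
    push_cast
    linarith

/-- The transformation matrix from Marsden's identity: row `r` holds the coefficients, with respect
to the B-splines that are active on a span `[x₀, x₀ + h]`, of the polynomial `(u - r) ^ p` in the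
local variable `u = (x - x₀) / h`. -/
noncomputable def marsdenMatrix (p : ℕ) (t : ℕ → ℝ) (a : ℕ) (x₀ h : ℝ) :
    Matrix (Fin (p + 1)) (Fin (p + 1)) ℝ :=
  Matrix.of fun r i => ∏ l ∈ Finset.range p, (t (a + i + l + 1) - (x₀ + h * r)) / h

theorem sum_marsdenMatrix_mul {p : ℕ} {t : ℕ → ℝ} (ht : Monotone t) {a : ℕ} {x h : ℝ}
    (hh : 0 < h) (hx : x ∈ Ioo (t (a + p)) (t (a + p + 1))) (r : Fin (p + 1)) :
    ∑ i, marsdenMatrix p t a (t (a + p)) h r i * bspline p t (a + i) x =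
      ((x - t (a + p)) / h - r) ^ p := by
  have hM := marsden ht (t (a + p) + h * r) x p a hx
  rw [Finset.sum_range] at hM
  have e : (x - t (a + p)) / h - r = (x - (t (a + p) + h * r)) / h := by
    field_simp
    ring
  rw [e, div_pow, ← hM, Finset.sum_div]
  refine Finset.sum_congr rfl fun i _ => ?_
  simp only [marsdenMatrix, Matrix.of_apply]
  rw [Finset.prod_div_distrib, Finset.prod_const, Finset.card_range]
  ring

theorem abs_marsdenMatrix_le {p : ℕ} {t : ℕ → ℝ} (ht : Monotone t) {a : ℕ} {ρ h : ℝ}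
    (hh : 0 < h) (hρ : 0 ≤ ρ) (hspan : ∀ n, t (n + 1) - t n ≤ ρ * h) (r i : Fin (p + 1)) :
    |marsdenMatrix p t a (t (a + p)) h r i| ≤ (ρ * p + p) ^ p := by
  simp only [marsdenMatrix, Matrix.of_apply]
  rw [Finset.abs_prod]
  calc ∏ l ∈ Finset.range p, |(t (a + i + l + 1) - (t (a + p) + h * r)) / h|
      ≤ ∏ _l ∈ Finset.range p, (ρ * p + p) := by
        refine Finset.prod_le_prod (fun _ _ => abs_nonneg _) fun l hl => ?_
        have hl := Finset.mem_range.1 hl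
        have hr : (r : ℝ) ≤ p := by exact_mod_cast (by omega : (r : ℕ) ≤ p)
        have hr0 : (0 : ℝ) ≤ r := Nat.cast_nonneg _
        have hrh := mul_le_mul_of_nonneg_left hr hh.le
        have hrh0 := mul_nonneg hh.le hr0
        have hρh : 0 ≤ ρ * h := mul_nonneg hρ hh.le
        rw [abs_div, abs_of_pos hh, div_le_iff₀ hh, abs_le]
        have hi := i.2
        rcases le_total (a + i + l + 1) (a + p) with hle | hle
        · obtain ⟨k, hk⟩ := Nat.exists_eq_add_of_le hle
          have h1 := sub_le_mul_of_span_le hspan k (a + i + l + 1)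
          have hk' : (k : ℝ) ≤ p := by exact_mod_cast (by omega : k ≤ p)
          have := mul_le_mul_of_nonneg_right hk' hρh
          have := ht hle
          rw [← hk] at h1
          constructor <;> nlinarith
        · obtain ⟨k, hk⟩ := Nat.exists_eq_add_of_le hle
          have h1 := sub_le_mul_of_span_le hspan k (a + p)
          have hk' : (k : ℝ) ≤ p := by exact_mod_cast (by omega : k ≤ p)
          have := mul_le_mul_of_nonneg_right hk' hρh
          have := ht hle
          rw [← hk] at h1
          constructor <;> nlinarith
    _ = (ρ * p + p) ^ p := by simp

theorem integrableOn_bspline_mul {t : ℕ → ℝ} (ht : Monotone t) (h1 : ∀ n, t n ≤ 1)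
    (p i j : ℕ) (a b : ℝ) :
    IntegrableOn (fun x => bspline p t i x * bspline p t j x) (Ioo a b) := by
  apply Integrable.of_bound (C := 1)
  · exact ((measurable_bspline t p i).mul (measurable_bspline t p j)).aestronglyMeasurable
  · refine Filter.Eventually.of_forall fun x => ?_
    have n1 := bspline_nonneg ht x p i
    have n2 := bspline_nonneg ht x p j
    rw [Real.norm_of_nonneg (mul_nonneg n1 n2)]
    exact mul_le_one₀ (bspline_le_one ht h1 p i x) n2 (bspline_le_one ht h1 p j x)

/-- On each nontrivial knot span `[t m, t (m + 1)]` and for each B-spline that is active there, there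
is a dual spline whose size is controlled by the degree and the ratio `ρ` of the lengths of the
knot spans. With the Gram matrices `Γ` of the active B-splines and `G` of the polynomials
`(u - r) ^ p`, Marsden's identity gives `A Γ Aᵀ = h G`; hence `h⁻¹ Aᵀ G⁻¹ A` is the inverse of `Γ`,
and it is bounded since `A` is. -/
theorem exists_dual_bspline (p : ℕ) {ρ : ℝ} (hρ : 0 ≤ ρ) :
    ∃ C : ℝ, 0 < C ∧ ∀ (N : ℕ) (t : ℕ → ℝ), IsOpenSeq p N t → ∀ m, t m < t (m + 1) →
      (∀ n, t (n + 1) - t n ≤ ρ * (t (m + 1) - t m)) → ∀ j, j ≤ m → m ≤ j + p →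
      ∃ c : Fin N → ℝ,
        (∀ j' : Fin N, ∫ x in Icc (t m) (t (m + 1)),
          (∑ n, c n * bspline p t n x) * bspline p t j' x = if (j' : ℕ) = j then 1 else 0) ∧
        ∀ x ∈ Ioo (t m) (t (m + 1)), |∑ n, c n * bspline p t n x| ≤ C / (t (m + 1) - t m) := by
  set G := shiftedPowerGram p with hG
  set α : ℝ := (ρ * p + p) ^ p with hα
  have hα0 : 0 ≤ α := by positivity
  set g : ℝ := ∑ r, ∑ r', |G⁻¹ r r'| with hg
  have hg0 : 0 ≤ g := by positivity
  refine ⟨(p + 1) * (α * g * α) + 1, by positivity, ?_⟩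
  intro N t ht m hm hspan j hjm hmj
  obtain ⟨hpm, hmN⟩ := ht.span_index hm
  obtain ⟨a, rfl⟩ : ∃ a, m = a + p := ⟨m - p, by omega⟩
  obtain ⟨i₀, rfl⟩ : ∃ i₀ : Fin (p + 1), j = a + i₀ := ⟨⟨j - a, by omega⟩, by simp; omega⟩
  set h := t (a + p + 1) - t (a + p) with hh
  have hpos : 0 < h := sub_pos.2 hm
  set A := marsdenMatrix p t a (t (a + p)) h with hA
  set I := Ioo (t (a + p)) (t (a + p + 1)) with hI
  set Γ : Matrix (Fin (p + 1)) (Fin (p + 1)) ℝ :=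
    Matrix.of fun i i' => ∫ x in I, bspline p t (a + i) x * bspline p t (a + i') x with hΓ
  have hint : ∀ i i' : ℕ, IntegrableOn (fun x => bspline p t i x * bspline p t i' x) I :=
    fun i i' => integrableOn_bspline_mul ht.mono ht.le_one p i i' _ _
  have hGram : A * Γ * A.transpose = h • G := by
    ext r r'
    have e1 : (A * Γ * A.transpose) r r' = ∫ x in I,
        (∑ i, A r i * bspline p t (a + i) x) * ∑ i, A r' i * bspline p t (a + i) x := by
      simp_rw [Finset.sum_mul_sum]
      rw [integral_finsetSum]
      swap
      · intro i _
        refine integrable_finsetSum _ fun i' _ => ?_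
        refine ((hint (a + i) (a + i')).const_mul (A r i * A r' i')).congr ?_
        exact Filter.Eventually.of_forall fun x => by simp only; ring
      simp only [Matrix.mul_apply, Matrix.transpose_apply, Finset.sum_mul]
      rw [Finset.sum_comm]
      refine Finset.sum_congr rfl fun i _ => ?_
      rw [integral_finsetSum]
      swap
      · intro i' _
        refine ((hint (a + i) (a + i')).const_mul (A r i * A r' i')).congr ?_
        exact Filter.Eventually.of_forall fun x => by simp only; ring
      refine Finset.sum_congr rfl fun i' _ => ?_
      have : ∀ x, A r i * bspline p t (a + i) x * (A r' i' * bspline p t (a + i') x) =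
          A r i * A r' i' * (bspline p t (a + i) x * bspline p t (a + i') x) := fun x => by ring
      simp_rw [this]
      rw [integral_const_mul]
      simp only [hΓ, Matrix.of_apply]
      ring
    rw [e1]
    have e2 : ∫ x in I,
        (∑ i, A r i * bspline p t (a + i) x) * ∑ i, A r' i * bspline p t (a + i) x =
        ∫ x in I, ((x - t (a + p)) / h - r) ^ p * ((x - t (a + p)) / h - r') ^ p := by
      refine setIntegral_congr_fun measurableSet_Ioo fun x hx => ?_
      rw [hA, sum_marsdenMatrix_mul ht.mono hpos hx, sum_marsdenMatrix_mul ht.mono hpos hx]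
    rw [e2, hI, ← integral_Ioc_eq_integral_Ioo, ← intervalIntegral.integral_of_le hm.le]
    have e3 := intervalIntegral.integral_comp_div_sub (a := t (a + p)) (b := t (a + p + 1))
      (fun u : ℝ => (u - r) ^ p * (u - r') ^ p) hpos.ne' (t (a + p) / h)
    rw [sub_self, ← sub_div, ← hh, div_self hpos.ne'] at e3
    rw [Matrix.smul_apply, hG, shiftedPowerGram, Matrix.of_apply, ← e3]
    simp_rw [sub_div]
  have hinv : Γ * (h⁻¹ • (A.transpose * G⁻¹ * A)) = 1 := by
    have h1 : A * (h⁻¹ • (Γ * A.transpose * G⁻¹)) = 1 := by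
      rw [Matrix.mul_smul, ← Matrix.mul_assoc, ← Matrix.mul_assoc, hGram, Matrix.smul_mul,
        Matrix.mul_nonsing_inv _ (isUnit_det_shiftedPowerGram p), smul_smul,
        inv_mul_cancel₀ hpos.ne', one_smul]
    have h2 := mul_eq_one_comm.1 h1
    rw [← h2]
    simp only [Matrix.mul_smul, Matrix.smul_mul, Matrix.mul_assoc]
  set w : Fin (p + 1) → ℝ := fun i => (h⁻¹ • (A.transpose * G⁻¹ * A)) i i₀ with hw
  set e : Fin (p + 1) → Fin N := fun i => ⟨a + i, by omega⟩ with he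
  have hsum : ∀ x, ∑ n, (∑ i, w i * if e i = n then 1 else 0) * bspline p t n x =
      ∑ i, w i * bspline p t (a + i) x := by
    intro x
    simp_rw [Finset.sum_mul]
    rw [Finset.sum_comm]
    refine Finset.sum_congr rfl fun i _ => ?_
    rw [Finset.sum_eq_single (e i)]
    · simp [he]
    · intro b _ hb
      simp [hb.symm]
    · simp
  refine ⟨fun n => ∑ i, w i * if e i = n then 1 else 0, fun j' => ?_, fun x hx => ?_⟩
  · simp_rw [hsum]
    rw [integral_Icc_eq_integral_Ioo]
    by_cases hj' : a ≤ j' ∧ (j' : ℕ) ≤ a + p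
    · obtain ⟨i, hi⟩ : ∃ i : Fin (p + 1), (j' : ℕ) = a + i := ⟨⟨j' - a, by omega⟩, by simp; omega⟩
      have := congrFun (congrFun hinv i) i₀
      rw [Matrix.mul_apply, Matrix.one_apply] at this
      rw [hi]
      simp only [Nat.add_left_cancel_iff, Fin.val_inj]
      rw [← this]
      simp_rw [Finset.sum_mul]
      rw [integral_finsetSum]
      · refine Finset.sum_congr rfl fun i' _ => ?_
        have : ∀ x, w i' * bspline p t (a + i') x * bspline p t (a + i) x =
            w i' * (bspline p t (a + i') x * bspline p t (a + i) x) := fun x => mul_assoc _ _ _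
        simp_rw [this]
        rw [integral_const_mul, mul_comm]
        simp only [hΓ, Matrix.of_apply]
        congr 1
        refine integral_congr_ae (Filter.Eventually.of_forall fun x => ?_)
        simp only
        ring
      · intro i' _
        simp_rw [mul_assoc]
        exact (hint _ _).const_mul _
    · rw [if_neg (by omega)]
      apply setIntegral_eq_zero_of_forall_eq_zero
      intro x hx
      have : bspline p t j' x = 0 := by
        by_contra hne
        have := bspline_index_of_ne_zero ht.mono hx hne
        omega
      rw [this, mul_zero]
  · rw [hsum]
    have hW : ∀ i, |w i| ≤ h⁻¹ * (α * g * α) := by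
      intro i
      simp only [hw, Matrix.smul_apply, smul_eq_mul]
      rw [abs_mul, abs_of_pos (inv_pos.2 hpos)]
      refine mul_le_mul_of_nonneg_left ?_ (inv_pos.2 hpos).le
      have hAb : ∀ r i, |A r i| ≤ α := abs_marsdenMatrix_le ht.mono hpos hρ hspan
      simp only [Matrix.mul_apply, Matrix.transpose_apply]
      calc |∑ r', (∑ r, A r i * G⁻¹ r r') * A r' i₀|
          ≤ ∑ r', ∑ r, α * |G⁻¹ r r'| * α := by
            refine (Finset.abs_sum_le_sum_abs _ _).trans (Finset.sum_le_sum fun r' _ => ?_)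
            rw [Finset.sum_mul]
            refine (Finset.abs_sum_le_sum_abs _ _).trans (Finset.sum_le_sum fun r _ => ?_)
            rw [abs_mul, abs_mul]
            have := abs_nonneg (G⁻¹ r r')
            gcongr
            · exact hAb r i
            · exact hAb r' i₀
        _ = α * g * α := by
            rw [Finset.sum_comm, hg]
            simp_rw [Finset.mul_sum, Finset.sum_mul]
    calc |∑ i, w i * bspline p t (a + i) x|
        ≤ ∑ _i : Fin (p + 1), h⁻¹ * (α * g * α) := by
          refine (Finset.abs_sum_le_sum_abs _ _).trans (Finset.sum_le_sum fun i _ => ?_)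
          rw [abs_mul, abs_of_nonneg (bspline_nonneg ht.mono x p _)]
          calc |w i| * bspline p t (a + i) x ≤ |w i| * 1 :=
                mul_le_mul_of_nonneg_left (bspline_le_one ht.mono ht.le_one _ _ _) (abs_nonneg _)
            _ ≤ _ := by rw [mul_one]; exact hW i
      _ = (p + 1) * (α * g * α) / h := by
          rw [Finset.sum_const, Finset.card_univ, Fintype.card_fin]
          simp only [nsmul_eq_mul]
          push_cast
          field_simp
      _ ≤ _ := by
          apply div_le_div_of_nonneg_right _ hpos.le
          linarith

/-! ### Knots and cells of all levels -/

namespace OpenKnots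

variable {d : ℕ} {p : Fin d → ℕ} (K : OpenKnots p)

/-- The knots of level `k` in direction `i`, continued by the constant `1`. Unlike `OpenKnots.knot`
this is a monotone sequence on all of `ℕ`. -/
noncomputable def seq (k : ℕ) (i : Fin d) (n : ℕ) : ℝ := (K.level k i).getD n 1

theorem isOpenList_knots (i : Fin d) : IsOpenList (p i) (K.knots i) := by
  have hl := K.length_eq i
  have getD_eq : ∀ n (hn : n < (K.knots i).length), (K.knots i).getD n 0 = (K.knots i)[n] :=
    fun n hn => List.getD_eq_getElem _ _ hn
  have hz : (K.knots i).take (p i + 1) = List.replicate (p i + 1) 0 := by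
    rw [List.eq_replicate_iff]
    refine ⟨by simp; omega, fun x hx => ?_⟩
    obtain ⟨n, hn, rfl⟩ := List.getElem_of_mem hx
    rw [List.getElem_take, ← getD_eq]
    exact K.first i n (by simp at hn; omega)
  have ho : (K.knots i).drop (K.N i) = List.replicate (p i + 1) 1 := by
    rw [List.eq_replicate_iff]
    refine ⟨by simp; omega, fun x hx => ?_⟩
    obtain ⟨n, hn, rfl⟩ := List.getElem_of_mem hx
    rw [List.getElem_drop, ← getD_eq]
    exact K.last i _ (by omega) (by simp at hn; omega)
  have hs := List.pairwise_iff_getElem.1 (K.sorted i)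
  refine ⟨K.sorted i, fun x hx => ?_, ?_, ?_⟩
  · obtain ⟨n, hn, rfl⟩ := List.getElem_of_mem hx
    constructor
    · rw [← K.first i 0 (Nat.zero_le _), getD_eq 0 (by omega)]
      rcases Nat.eq_zero_or_pos n with rfl | h
      · exact le_rfl
      · exact hs 0 n _ _ h
    · rw [← K.last i (K.N i + p i) (by omega) le_rfl, getD_eq _ (by omega)]
      rcases (by omega : n = K.N i + p i ∨ n < K.N i + p i) with h | h
      · simp [h]
      · exact hs n _ _ _ h
  · refine le_trans ?_ ((List.take_sublist (p i + 1) _).count_le 0)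
    rw [hz]; simp
  · refine le_trans ?_ ((List.drop_sublist (K.N i) _).count_le 1)
    rw [ho]; simp

theorem level_succ (k : ℕ) (i : Fin d) : K.level (k + 1) i = refineKnots (K.level k i) := by
  rw [level, Function.iterate_succ_apply', level]

theorem isOpenList_level (k : ℕ) (i : Fin d) : IsOpenList (p i) (K.level k i) := by
  induction k with
  | zero => exact K.isOpenList_knots i
  | succ k ih => rw [level_succ]; exact ih.refine

theorem isOpenSeq (k : ℕ) (i : Fin d) : IsOpenSeq (p i) (K.num k i) (K.seq k i) :=
  (K.isOpenList_level k i).isOpenSeq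

theorem knot_eq_seq {k : ℕ} {i : Fin d} {n : ℕ} (hn : n < (K.level k i).length) :
    K.knot k i n = K.seq k i n := by
  rw [knot, seq, List.getD_eq_getElem _ _ hn, List.getD_eq_getElem _ _ hn]

theorem num_add (k : ℕ) (i : Fin d) : K.num k i + (p i + 1) = (K.level k i).length := by
  have h1 := (K.isOpenList_level k i).count_zero.trans List.count_le_length
  rw [num]
  omega

theorem bspline_knot {k : ℕ} {i : Fin d} {n : ℕ} (hn : n < K.num k i) (s : ℝ) :
    bspline (p i) (K.knot k i) n s = bspline (p i) (K.seq k i) n s := by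
  have := K.num_add k i
  exact bspline_congr 0 s (p i) n fun l _ hl => K.knot_eq_seq (by omega)

theorem B_eq (k : ℕ) (j : K.Index k) (s : Fin d → ℝ) :
    K.B k j s = ∏ i, bspline (p i) (K.seq k i) (j i) (s i) :=
  Finset.prod_congr rfl fun i _ => K.bspline_knot (j i).2 _

/-- The multi-index `m` belongs to a nontrivial cell of level `k`. -/
def IsCell (k : ℕ) (m : Fin d → ℕ) : Prop := ∀ i, K.seq k i (m i) < K.seq k i (m i + 1)

/-- The closed cell of level `k` with multi-index `m`. -/
def cell (k : ℕ) (m : Fin d → ℕ) : Set (Fin d → ℝ) :=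
  Icc (fun i => K.seq k i (m i)) (fun i => K.seq k i (m i + 1))

/-- The interior of the cell of level `k` with multi-index `m`. -/
def openCell (k : ℕ) (m : Fin d → ℕ) : Set (Fin d → ℝ) :=
  {s | ∀ i, s i ∈ Ioo (K.seq k i (m i)) (K.seq k i (m i + 1))}

/-- The support of the B-spline with index `j` contains the cell with multi-index `m`. -/
def Active (k : ℕ) (j : K.Index k) (m : Fin d → ℕ) : Prop :=
  ∀ i, (j i : ℕ) ≤ m i ∧ m i ≤ j i + p i

theorem mem_cells {k : ℕ} {T : Set (Fin d → ℝ)} :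
    T ∈ K.cells k ↔ ∃ m, K.IsCell k m ∧ T = K.cell k m := by
  constructor
  · rintro ⟨j, hj, rfl, hvol⟩
    have e1 : ∀ i, K.knot k i (j i) = K.seq k i (j i) := fun i =>
      K.knot_eq_seq ((Nat.lt_succ_self _).trans (hj i))
    have e2 : ∀ i, K.knot k i (j i + 1) = K.seq k i (j i + 1) := fun i => K.knot_eq_seq (hj i)
    refine ⟨j, fun i => ?_, ?_⟩
    · rw [Real.volume_Icc_pi] at hvol
      have := (CanonicallyOrderedAdd.prod_pos.1 hvol) i (Finset.mem_univ i)
      rw [ENNReal.ofReal_pos, e1, e2] at this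
      linarith
    · simp only [cell, e1, e2]
  · rintro ⟨m, hm, rfl⟩
    have hlt : ∀ i, m i + 1 < (K.level k i).length := fun i => by
      have h1 := (K.isOpenSeq k i).span_index (hm i)
      have h2 := K.num_add k i
      omega
    refine ⟨m, hlt, ?_, ?_⟩
    · simp only [cell, K.knot_eq_seq (hlt _),
        K.knot_eq_seq ((Nat.lt_succ_self _).trans (hlt _))]
    · rw [cell, Real.volume_Icc_pi, CanonicallyOrderedAdd.prod_pos]
      intro i _
      rw [ENNReal.ofReal_pos]
      linarith [hm i]

theorem seq_parent {k : ℕ} {i : Fin d} {n : ℕ} (h : K.seq (k + 1) i n < K.seq (k + 1) i (n + 1)) :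
    ∃ m, K.seq k i m < K.seq k i (m + 1) ∧
      ((K.seq (k + 1) i n = K.seq k i m ∧
          K.seq (k + 1) i (n + 1) = (K.seq k i m + K.seq k i (m + 1)) / 2) ∨
        (K.seq (k + 1) i n = (K.seq k i m + K.seq k i (m + 1)) / 2 ∧
          K.seq (k + 1) i (n + 1) = K.seq k i (m + 1))) := by
  have h1 := (K.isOpenSeq (k + 1) i).span_index h
  have h2 := K.num_add (k + 1) i
  have hl : n + 1 < (K.level (k + 1) i).length := by omega
  simp only [seq] at h ⊢
  rw [level_succ] at h hl ⊢
  obtain ⟨m, -, hne, hm⟩ := refineKnots_parent _ n hl h.ne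
  exact ⟨m, lt_of_le_of_ne ((K.isOpenSeq k i).mono (Nat.le_succ m)) hne, hm⟩

theorem seq_children {k : ℕ} {i : Fin d} {m : ℕ} (h : K.seq k i m < K.seq k i (m + 1)) :
    ∃ n, K.seq (k + 1) i n = K.seq k i m ∧
      K.seq (k + 1) i (n + 1) = (K.seq k i m + K.seq k i (m + 1)) / 2 ∧
      K.seq (k + 1) i (n + 2) = K.seq k i (m + 1) := by
  have h1 := (K.isOpenSeq k i).span_index h
  have h2 := K.num_add k i
  simp only [seq] at h ⊢
  rw [level_succ]
  obtain ⟨n, -, hn⟩ := refineKnots_children (K.level k i) m (by omega) h.ne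
  exact ⟨n, hn⟩

/-- Every nontrivial span of level `k + e` lies in a span of level `k` that is `2 ^ e` times as
long. -/
theorem seq_ancestor {k : ℕ} {i : Fin d} : ∀ (e : ℕ) {n : ℕ},
    K.seq (k + e) i n < K.seq (k + e) i (n + 1) →
    ∃ m, K.seq k i m < K.seq k i (m + 1) ∧ K.seq k i m ≤ K.seq (k + e) i n ∧
      K.seq (k + e) i (n + 1) ≤ K.seq k i (m + 1) ∧
      K.seq (k + e) i (n + 1) - K.seq (k + e) i n =
        (1 / 2) ^ e * (K.seq k i (m + 1) - K.seq k i m) := by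
  intro e
  induction e with
  | zero => intro n h; exact ⟨n, h, le_rfl, le_rfl, by simp⟩
  | succ e ih =>
    intro n h
    rw [← add_assoc] at h ⊢
    obtain ⟨l, hl, h'⟩ := K.seq_parent h
    obtain ⟨m, h1, h2, h3, h4⟩ := ih hl
    refine ⟨m, h1, ?_⟩
    rw [pow_succ]
    rcases h' with ⟨a, b⟩ | ⟨a, b⟩ <;> rw [a, b] <;>
      exact ⟨by linarith, by linarith, by linarith⟩

theorem exists_cell_ancestor {k : ℕ} (e : ℕ) {n : Fin d → ℕ} (h : K.IsCell (k + e) n) :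
    ∃ m, K.IsCell k m ∧ K.cell (k + e) n ⊆ K.cell k m ∧ K.openCell (k + e) n ⊆ K.openCell k m ∧
      ∀ i, K.seq (k + e) i (n i + 1) - K.seq (k + e) i (n i) =
        (1 / 2) ^ e * (K.seq k i (m i + 1) - K.seq k i (m i)) := by
  choose m h1 h2 h3 h4 using fun i => K.seq_ancestor e (h i)
  refine ⟨m, h1, Icc_subset_Icc h2 h3, fun s hs i => ?_, h4⟩
  exact ⟨(h2 i).trans_lt (hs i).1, (hs i).2.trans_le (h3 i)⟩

theorem span_le (k : ℕ) (i : Fin d) (n : ℕ) :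
    K.seq k i (n + 1) - K.seq k i n ≤ (1 / 2) ^ k := by
  rcases ((K.isOpenSeq k i).mono (Nat.le_succ n)).eq_or_lt with h | h
  · rw [Nat.succ_eq_add_one] at h
    rw [h, sub_self]; positivity
  · obtain ⟨m, h1, h2, h3, h4⟩ := K.seq_ancestor (k := 0) k (by simpa using h)
    rw [zero_add] at h4
    rw [h4]
    have := (K.isOpenSeq 0 i).nonneg m
    have := (K.isOpenSeq 0 i).le_one (m + 1)
    have h5 : (0 : ℝ) < (1 / 2) ^ k := by positivity
    nlinarith

/-- The nontrivial knot spans of level `0` have length at least `δ`. -/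
def SpanBound (δ : ℝ) : Prop :=
  ∀ i n, K.seq 0 i n < K.seq 0 i (n + 1) → δ ≤ K.seq 0 i (n + 1) - K.seq 0 i n

variable {K}

theorem SpanBound.le_span {δ : ℝ} (hδ : K.SpanBound δ) {k : ℕ} {i : Fin d} {n : ℕ}
    (h : K.seq k i n < K.seq k i (n + 1)) :
    (1 / 2) ^ k * δ ≤ K.seq k i (n + 1) - K.seq k i n := by
  obtain ⟨m, h1, h2, h3, h4⟩ := K.seq_ancestor (k := 0) k (by simpa using h)
  rw [zero_add] at h4
  rw [h4]
  exact mul_le_mul_of_nonneg_left (hδ i m h1) (by positivity)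

variable (K)

theorem openCell_subset (k : ℕ) (m : Fin d → ℕ) : K.openCell k m ⊆ K.cell k m := fun _ hs =>
  ⟨fun i => (hs i).1.le, fun i => (hs i).2.le⟩

theorem openCell_eq_pi (k : ℕ) (m : Fin d → ℕ) :
    K.openCell k m = univ.pi fun i => Ioo (K.seq k i (m i)) (K.seq k i (m i + 1)) := by
  ext s
  simp [openCell]

theorem openCell_ae_eq_cell (k : ℕ) (m : Fin d → ℕ) :
    K.openCell k m =ᵐ[volume] K.cell k m := by
  rw [openCell_eq_pi]
  exact Measure.univ_pi_Ioo_ae_eq_Icc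

theorem ae_mem_openCell (k : ℕ) (m : Fin d → ℕ) :
    ∀ᵐ s ∂volume.restrict (K.cell k m), s ∈ K.openCell k m := by
  rw [← Measure.restrict_congr_set (K.openCell_ae_eq_cell k m)]
  refine ae_restrict_mem ?_
  rw [openCell_eq_pi]
  exact MeasurableSet.univ_pi fun i => measurableSet_Ioo

variable {K}

theorem IsCell.closure_openCell {k : ℕ} {m : Fin d → ℕ} (h : K.IsCell k m) :
    closure (K.openCell k m) = K.cell k m := by
  rw [openCell_eq_pi, closure_pi_set, cell, ← pi_univ_Icc]
  congr 1
  funext i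
  exact closure_Ioo (h i).ne

theorem IsCell.openCell_nonempty {k : ℕ} {m : Fin d → ℕ} (h : K.IsCell k m) :
    (K.openCell k m).Nonempty :=
  ⟨fun i => (K.seq k i (m i) + K.seq k i (m i + 1)) / 2, fun i =>
    ⟨by simp only; linarith [h i], by simp only; linarith [h i]⟩⟩

/-- Cells of the same level do not overlap. -/
theorem eq_of_mem_openCell {k : ℕ} {m m' : Fin d → ℕ} {s : Fin d → ℝ} (hs : s ∈ K.openCell k m)
    (hs' : s ∈ K.cell k m') : m = m' := by
  funext i
  have hm := (K.isOpenSeq k i).mono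
  have h1 := hm.reflect_lt ((hs'.1 i).trans_lt (hs i).2)
  have h2 := hm.reflect_lt ((hs i).1.trans_le (hs'.2 i))
  omega

theorem cell_subset_unit {k : ℕ} {m : Fin d → ℕ} : K.cell k m ⊆ Icc 0 1 :=
  Icc_subset_Icc (fun i => (K.isOpenSeq k i).nonneg _) (fun i => (K.isOpenSeq k i).le_one _)

theorem volume_cell {k : ℕ} {m : Fin d → ℕ} (h : K.IsCell k m) :
    volume (K.cell k m) =
      ENNReal.ofReal (∏ i, (K.seq k i (m i + 1) - K.seq k i (m i))) := by
  rw [cell, Real.volume_Icc_pi, ENNReal.ofReal_prod_of_nonneg]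
  intro i _
  linarith [h i]

theorem measurableSet_cell (k : ℕ) (m : Fin d → ℕ) : MeasurableSet (K.cell k m) :=
  measurableSet_Icc

/-! ### Tensor-product B-splines -/

theorem B_nonneg (k : ℕ) (j : K.Index k) (s : Fin d → ℝ) : 0 ≤ K.B k j s := by
  rw [B_eq]
  exact Finset.prod_nonneg fun i _ => bspline_nonneg (K.isOpenSeq k i).mono _ _ _

theorem sum_B_le_one (k : ℕ) (s : Fin d → ℝ) : ∑ j, K.B k j s ≤ 1 := by
  simp_rw [B_eq]
  have := Finset.prod_univ_sum (fun i : Fin d => (Finset.univ : Finset (Fin (K.num k i))))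
    fun i n => bspline (p i) (K.seq k i) n (s i)
  rw [Fintype.piFinset_univ] at this
  rw [← this]
  refine Finset.prod_le_one (fun i _ => Finset.sum_nonneg fun n _ =>
    bspline_nonneg (K.isOpenSeq k i).mono _ _ _) fun i _ => ?_
  rw [← Finset.sum_range (fun n => bspline (p i) (K.seq k i) n (s i))]
  exact sum_bspline_le_one (K.isOpenSeq k i).mono (K.isOpenSeq k i).le_one _ _ _

theorem B_le_one (k : ℕ) (j : K.Index k) (s : Fin d → ℝ) : K.B k j s ≤ 1 :=
  (Finset.single_le_sum (f := fun j => K.B k j s) (fun j _ => B_nonneg k j s)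
    (Finset.mem_univ j)).trans (sum_B_le_one k s)

theorem measurable_B (k : ℕ) (j : K.Index k) : Measurable (K.B k j) := by
  have : K.B k j = fun s => ∏ i, bspline (p i) (K.seq k i) (j i) (s i) := funext (B_eq K k j)
  rw [this]
  exact Finset.measurable_fun_prod _ fun i _ =>
    (measurable_bspline _ _ _).comp (measurable_pi_apply i)

theorem tsupport_subset_Icc (k : ℕ) (j : K.Index k) :
    tsupport (K.B k j) ⊆
      Icc (fun i => K.seq k i (j i)) (fun i => K.seq k i (j i + p i + 1)) := by
  refine closure_minimal (fun s hs => ?_) isClosed_Icc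
  rw [Function.mem_support, B_eq, Finset.prod_ne_zero_iff] at hs
  have h := fun i => bspline_ne_zero (K.isOpenSeq k i).mono _ _ _ (hs i (Finset.mem_univ i))
  exact ⟨fun i => (h i).1, fun i => (h i).2.1⟩

theorem Active.B_pos {k : ℕ} {j : K.Index k} {m : Fin d → ℕ} (h : K.Active k j m)
    {s : Fin d → ℝ} (hs : s ∈ K.openCell k m) : 0 < K.B k j s := by
  rw [B_eq]
  exact Finset.prod_pos fun i _ =>
    bspline_pos (K.isOpenSeq k i).mono (hs i) _ _ (h i).1 (h i).2

theorem active_of_B_ne_zero {k : ℕ} {j : K.Index k} {m : Fin d → ℕ} {s : Fin d → ℝ}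
    (hs : s ∈ K.openCell k m) (h : K.B k j s ≠ 0) : K.Active k j m := by
  rw [B_eq, Finset.prod_ne_zero_iff] at h
  exact fun i => bspline_index_of_ne_zero (K.isOpenSeq k i).mono (hs i) (h i (Finset.mem_univ i))

theorem Active.cell_subset {k : ℕ} {j : K.Index k} {m : Fin d → ℕ} (h : K.Active k j m)
    (hm : K.IsCell k m) : K.cell k m ⊆ tsupport (K.B k j) := by
  rw [← hm.closure_openCell]
  exact closure_mono fun s hs => (h.B_pos hs).ne'

theorem active_of_cell_subset {k : ℕ} {j : K.Index k} {m : Fin d → ℕ} (hm : K.IsCell k m)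
    (h : K.cell k m ⊆ tsupport (K.B k j)) : K.Active k j m := by
  have h' := h.trans (tsupport_subset_Icc k j)
  rw [cell, Icc_subset_Icc_iff fun i => (hm i).le] at h'
  intro i
  have hmono := (K.isOpenSeq k i).mono
  have h1 := hmono.reflect_lt ((h'.1 i).trans_lt (hm i))
  have h2 := hmono.reflect_lt ((hm i).trans_le (h'.2 i))
  omega

/-- B-splines of level `k` are nonnegative combinations of B-splines of level `k + 1`. -/
theorem exists_B_refine (k : ℕ) (j : K.Index k) :
    ∃ c : K.Index (k + 1) → ℝ, (∀ j', 0 ≤ c j') ∧ K.B k j = ∑ j', c j' • K.B (k + 1) j' := by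
  have h1 : ∀ i, ∃ c : Fin (K.num (k + 1) i) → ℝ, (∀ n, 0 ≤ c n) ∧
      ∀ s, bspline (p i) (K.seq k i) (j i) s =
        ∑ n, c n * bspline (p i) (K.seq (k + 1) i) n s := by
    intro i
    have h := exists_bspline_refineKnots (K.isOpenList_level k i) (j i)
    unfold num seq
    rw [level_succ]
    exact h
  choose c hc hB using h1
  refine ⟨fun j' => ∏ i, c i (j' i), fun j' => Finset.prod_nonneg fun i _ => hc i _, ?_⟩
  funext s
  rw [Finset.sum_apply, B_eq]
  simp only [Pi.smul_apply, smul_eq_mul, B_eq, hB]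
  rw [Finset.prod_univ_sum, Fintype.piFinset_univ]
  refine Finset.sum_congr rfl fun x _ => ?_
  rw [Finset.prod_mul_distrib]

theorem B_mem_Y (k : ℕ) (j : K.Index k) : K.B k j ∈ K.Y k := Submodule.subset_span ⟨j, rfl⟩

theorem mem_Y {k : ℕ} {V : (Fin d → ℝ) → ℝ} :
    V ∈ K.Y k ↔ ∃ c : K.Index k → ℝ, ∑ j, c j • K.B k j = V :=
  Submodule.mem_span_range_iff_exists_fun ℝ

theorem Y_le_succ (k : ℕ) : K.Y k ≤ K.Y (k + 1) := by
  rw [Y, Submodule.span_le]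
  rintro _ ⟨j, rfl⟩
  obtain ⟨c, -, hc⟩ := K.exists_B_refine k j
  exact mem_Y.2 ⟨c, hc.symm⟩

theorem monotone_Y : Monotone K.Y := monotone_nat_of_le_succ Y_le_succ

theorem measurable_of_mem_Y {k : ℕ} {V : (Fin d → ℝ) → ℝ} (h : V ∈ K.Y k) : Measurable V := by
  obtain ⟨c, rfl⟩ := mem_Y.1 h
  have : ∑ j, c j • K.B k j = fun s => ∑ j, c j * K.B k j s := by
    funext s; simp
  rw [this]
  exact Finset.measurable_fun_sum _ fun j _ => (measurable_B k j).const_mul _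

theorem bounded_of_mem_Y {k : ℕ} {V : (Fin d → ℝ) → ℝ} (h : V ∈ K.Y k) :
    ∃ C, ∀ s, |V s| ≤ C := by
  obtain ⟨c, rfl⟩ := mem_Y.1 h
  refine ⟨∑ j, |c j|, fun s => ?_⟩
  rw [Finset.sum_apply]
  refine (Finset.abs_sum_le_sum_abs _ _).trans (Finset.sum_le_sum fun j _ => ?_)
  rw [Pi.smul_apply, smul_eq_mul, abs_mul, abs_of_nonneg (B_nonneg k j s)]
  exact mul_le_of_le_one_right (abs_nonneg _) (B_le_one k j s)

theorem integrableOn_mul_of_mem_Y {k l : ℕ} {V W : (Fin d → ℝ) → ℝ} (hV : V ∈ K.Y k)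
    (hW : W ∈ K.Y l) (k' : ℕ) (m : Fin d → ℕ) :
    IntegrableOn (fun s => V s * W s) (K.cell k' m) := by
  obtain ⟨C, hC⟩ := bounded_of_mem_Y hV
  obtain ⟨D, hD⟩ := bounded_of_mem_Y hW
  have : IsFiniteMeasure (volume.restrict (K.cell k' m)) :=
    isFiniteMeasure_restrict.2 isCompact_Icc.measure_ne_top
  apply Integrable.of_bound (C := C * D)
  · exact ((measurable_of_mem_Y hV).mul (measurable_of_mem_Y hW)).aestronglyMeasurable
  · refine Filter.Eventually.of_forall fun x => ?_
    rw [Real.norm_eq_abs, abs_mul]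
    exact mul_le_mul (hC x) (hD x) (abs_nonneg _) ((abs_nonneg _).trans (hC x))

/-! ### Tensor-product dual functions -/

theorem setIntegral_Icc_prod (a b : Fin d → ℝ) (f : Fin d → ℝ → ℝ) :
    ∫ x in Icc a b, ∏ i, f i (x i) = ∏ i, ∫ x in Icc (a i) (b i), f i x := by
  rw [← pi_univ_Icc, volume_pi, Measure.restrict_pi_pi]
  exact integral_fintype_prod_eq_prod (μ := fun i => volume.restrict (Icc (a i) (b i))) f

/-- A dual function whose size is inversely proportional to the volume of the cell, with a constant
that depends only on the degrees and on the lengths of the knot spans of level `0`. -/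
theorem exists_isDual (p : Fin d → ℕ) {δ : ℝ} (hδ : 0 < δ) :
    ∃ C : ℝ, 0 < C ∧ ∀ K : OpenKnots p, K.SpanBound δ → ∀ (k : ℕ) (m : Fin d → ℕ)
      (j : K.Index k), K.IsCell k m → K.Active k j m →
      ∃ V, K.IsDual k j (K.cell k m) ((K.cell k m).indicator V) ∧
        ∀ s ∈ K.openCell k m, |V s| ≤ C / ∏ i, (K.seq k i (m i + 1) - K.seq k i (m i)) := by
  have hρ : 0 ≤ 1 / δ := by positivity
  choose C hC hdual using fun i => exists_dual_bspline (p i) hρ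
  refine ⟨∏ i, C i, Finset.prod_pos fun i _ => hC i, ?_⟩
  intro K hK k m j hm hj
  have hratio : ∀ i n, K.seq k i (n + 1) - K.seq k i n ≤
      1 / δ * (K.seq k i (m i + 1) - K.seq k i (m i)) := by
    intro i n
    have h1 := K.span_le k i n
    have h2 := hK.le_span (hm i)
    rw [div_mul_eq_mul_div, one_mul, le_div_iff₀ hδ]
    exact (mul_le_mul_of_nonneg_right h1 hδ.le).trans h2
  choose c hc hbound using fun i => hdual i (K.num k i) (K.seq k i) (K.isOpenSeq k i) (m i) (hm i)
    (hratio i) (j i) (hj i).1 (hj i).2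
  set V : (Fin d → ℝ) → ℝ := fun s =>
    ∏ i, ∑ n : Fin (K.num k i), c i n * bspline (p i) (K.seq k i) n (s i) with hV
  refine ⟨V, ⟨⟨V, ?_, rfl⟩, fun j' => ?_⟩, fun s hs => ?_⟩
  · refine mem_Y.2 ⟨fun j' => ∏ i, c i (j' i), ?_⟩
    funext s
    rw [Finset.sum_apply, hV]
    simp only [Pi.smul_apply, smul_eq_mul, B_eq]
    rw [Finset.prod_univ_sum, Fintype.piFinset_univ]
    refine Finset.sum_congr rfl fun x _ => ?_
    rw [Finset.prod_mul_distrib]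
  · let F : Fin d → ℝ → ℝ := fun i y => (∑ n : Fin (K.num k i), c i n *
      bspline (p i) (K.seq k i) n y) * bspline (p i) (K.seq k i) (j' i) y
    have e1 : ∫ x in K.cell k m, (K.cell k m).indicator V x * K.B k j' x =
        ∫ x in K.cell k m, ∏ i, F i (x i) := by
      refine setIntegral_congr_fun (K.measurableSet_cell k m) fun x hx => ?_
      simp only [F, indicator_of_mem hx, hV, B_eq, Finset.prod_mul_distrib]
    refine e1.trans ((setIntegral_Icc_prod _ _ F).trans ?_)
    simp only [F, hc]
    rw [Finset.prod_ite_zero]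
    simp [funext_iff, Fin.val_inj]
  · rw [hV]
    simp only
    rw [Finset.abs_prod, ← Finset.prod_div_distrib]
    exact Finset.prod_le_prod (fun _ _ => abs_nonneg _) fun i _ => hbound i _ (hs i)

variable {k : ℕ} {j : K.Index k} {m : Fin d → ℕ} {g g' : (Fin d → ℝ) → ℝ}

theorem IsDual.integral_mul (hg : K.IsDual k j (K.cell k m) g) (c : K.Index k → ℝ)
    {f : (Fin d → ℝ) → ℝ} (hf : ∀ s ∈ K.openCell k m, f s = ∑ j', c j' * K.B k j' s) :
    ∫ x in K.cell k m, g x * f x = c j := by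
  obtain ⟨⟨V, hV, rfl⟩, h⟩ := hg
  have hcongr : ∀ F : (Fin d → ℝ) → ℝ, ∫ x in K.cell k m, (K.cell k m).indicator V x * F x =
      ∫ x in K.cell k m, V x * F x := fun F =>
    setIntegral_congr_fun (K.measurableSet_cell k m) fun x hx => by
      simp only [indicator_of_mem hx]
  simp_rw [hcongr] at h ⊢
  have e1 : ∫ x in K.cell k m, V x * f x =
      ∫ x in K.cell k m, ∑ j', c j' * (V x * K.B k j' x) := by
    refine integral_congr_ae ?_
    filter_upwards [K.ae_mem_openCell k m] with s hs
    rw [hf s hs, Finset.mul_sum]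
    exact Finset.sum_congr rfl fun j' _ => by ring
  rw [e1, integral_finsetSum]
  · simp_rw [integral_const_mul, h]
    simp
  · intro j' _
    exact (integrableOn_mul_of_mem_Y hV (B_mem_Y k j') k m).const_mul _

/-- Dual functions are unique almost everywhere: the difference is orthogonal to all splines,
hence to itself. -/
theorem IsDual.ae_eq (hg : K.IsDual k j (K.cell k m) g) (hg' : K.IsDual k j (K.cell k m) g') :
    g =ᵐ[volume.restrict (K.cell k m)] g' := by
  obtain ⟨V, hV, hgV⟩ := hg.1
  obtain ⟨V', hV', hgV'⟩ := hg'.1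
  have hW : V - V' ∈ K.Y k := Submodule.sub_mem _ hV hV'
  obtain ⟨c, hc⟩ := mem_Y.1 hW
  have hc' : ∀ s, V s - V' s = ∑ j', c j' * K.B k j' s := fun s => by
    rw [← Pi.sub_apply, ← hc, Finset.sum_apply]
    rfl
  have i1 := hg.integral_mul c (f := V - V') fun s _ => hc' s
  have i2 := hg'.integral_mul c (f := V - V') fun s _ => hc' s
  have e1 : ∀ G U : (Fin d → ℝ) → ℝ, G = (K.cell k m).indicator U →
      ∫ x in K.cell k m, G x * (V - V') x = ∫ x in K.cell k m, U x * (V - V') x := by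
    rintro _ U rfl
    exact setIntegral_congr_fun (K.measurableSet_cell k m) fun x hx => by
      simp only [indicator_of_mem hx]
  rw [e1 _ _ hgV] at i1
  rw [e1 _ _ hgV'] at i2
  have i3 : ∫ x in K.cell k m, (V - V') x * (V - V') x = 0 := by
    have : ∀ x, (V - V') x * (V - V') x = V x * (V - V') x - V' x * (V - V') x := fun x => by
      simp only [Pi.sub_apply]; ring
    simp_rw [this]
    rw [integral_sub (integrableOn_mul_of_mem_Y hV hW k m) (integrableOn_mul_of_mem_Y hV' hW k m),
      i1, i2, sub_self]
  rw [integral_eq_zero_iff_of_nonneg (fun x => mul_self_nonneg _)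
    (integrableOn_mul_of_mem_Y hW hW k m)] at i3
  filter_upwards [i3, ae_restrict_mem (K.measurableSet_cell k m)] with s hs hs'
  rw [hgV, hgV', indicator_of_mem hs', indicator_of_mem hs']
  have := mul_self_eq_zero.1 hs
  exact sub_eq_zero.1 this

theorem isDual_dual (h : ∃ g, K.IsDual k j (K.cell k m) g) :
    K.IsDual k j (K.cell k m) (K.dual k j (K.cell k m)) := by
  rw [dual, dif_pos h]
  exact h.choose_spec

end OpenKnots

/-! ### Linear independence and lengths of spans -/

theorem IsOpenSeq.exists_span {p N : ℕ} {t : ℕ → ℝ} (h : IsOpenSeq p N t) :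
    ∃ m, t m < t (m + 1) := by
  by_contra! hc
  have : ∀ n, t n ≤ 0 := by
    intro n
    induction n with
    | zero => exact (h.zero 0 (Nat.zero_le _)).le
    | succ n ih => exact (hc n).trans ih
  have h1 := this N
  rw [h.one N le_rfl] at h1
  norm_num at h1

theorem endpoints_eq_of_Icc_eq {α : Type*} [PartialOrder α] {a b a' b' : α} (h : a ≤ b)
    (h' : a' ≤ b') (e : Icc a b = Icc a' b') : a = a' ∧ b = b' := by
  have h1 := (Icc_subset_Icc_iff h).1 e.subset
  have h2 := (Icc_subset_Icc_iff h').1 e.symm.subset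
  exact ⟨le_antisymm h2.1 h1.1, le_antisymm h1.2 h2.2⟩

namespace OpenKnots

variable {d : ℕ} {p : Fin d → ℕ} (K : OpenKnots p)

theorem exists_spanBound : ∃ δ, 0 < δ ∧ K.SpanBound δ := by
  set S : Set ℝ := (fun x : (Σ i, Fin (K.num 0 i)) => K.seq 0 x.1 (x.2 + 1) - K.seq 0 x.1 x.2) ''
    {x | K.seq 0 x.1 x.2 < K.seq 0 x.1 (x.2 + 1)} with hS
  have hfin : S.Finite := (Set.toFinite _).image _
  have hmem : ∀ i n, K.seq 0 i n < K.seq 0 i (n + 1) → K.seq 0 i (n + 1) - K.seq 0 i n ∈ S :=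
    fun i n h => ⟨⟨i, ⟨n, ((K.isOpenSeq 0 i).span_index h).2⟩⟩, h, rfl⟩
  rcases S.eq_empty_or_nonempty with he | hne
  · refine ⟨1, one_pos, fun i n h => ?_⟩
    have := hmem i n h
    rw [he] at this
    exact this.elim
  · obtain ⟨δ, hδ, hmin⟩ := S.exists_min_image id hfin hne
    refine ⟨δ, ?_, fun i n h => hmin _ (hmem i n h)⟩
    obtain ⟨x, hx, rfl⟩ := hδ
    exact sub_pos.2 hx

variable {K}

/-- The lengths of the spans of level `0` can be read off from the set of cells. -/
theorem SpanBound.of_cells_eq {K' : OpenKnots p} {δ : ℝ} (h : K.SpanBound δ)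
    (hcells : K'.cells 0 = K.cells 0) : K'.SpanBound δ := by
  intro i n hn
  choose m₀ hm₀ using fun i => (K'.isOpenSeq 0 i).exists_span
  have hm : K'.IsCell 0 (Function.update m₀ i n) := by
    intro i'
    rcases eq_or_ne i' i with rfl | hi
    · simpa using hn
    · simpa [hi] using hm₀ i'
  have hmem : K'.cell 0 (Function.update m₀ i n) ∈ K'.cells 0 := mem_cells _ |>.2 ⟨_, hm, rfl⟩
  rw [hcells, mem_cells] at hmem
  obtain ⟨m, hm', he⟩ := hmem
  obtain ⟨h1, h2⟩ := endpoints_eq_of_Icc_eq (fun i => (hm i).le) (fun i => (hm' i).le) he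
  have h1 := congrFun h1 i
  have h2 := congrFun h2 i
  simp only [Function.update_self] at h1 h2
  rw [h1, h2]
  exact h i _ (hm' i)

theorem isDual_dual_of_active {k : ℕ} {j : K.Index k} {m : Fin d → ℕ} (hm : K.IsCell k m)
    (hj : K.Active k j m) : K.IsDual k j (K.cell k m) (K.dual k j (K.cell k m)) := by
  obtain ⟨δ, hδ, hK⟩ := K.exists_spanBound
  obtain ⟨C, -, h⟩ := exists_isDual p hδ
  obtain ⟨V, hV, -⟩ := h K hK k m j hm hj
  exact isDual_dual ⟨_, hV⟩

/-- The level of a cell is unique, since cells of level `k + e` are smaller by the factor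
`2 ^ (-e)`. -/
theorem cell_level_le (hd : 1 ≤ d) {k e : ℕ} {m n : Fin d → ℕ} (hm : K.IsCell k m)
    (hn : K.IsCell (k + e) n) (h : K.cell k m = K.cell (k + e) n) : e = 0 := by
  obtain ⟨m', -, h2, h3, h4⟩ := K.exists_cell_ancestor e hn
  obtain ⟨s, hs⟩ := hn.openCell_nonempty
  have hmm : m' = m := eq_of_mem_openCell (h3 hs) (h ▸ K.openCell_subset _ _ hs)
  subst hmm
  obtain ⟨h5, h6⟩ := endpoints_eq_of_Icc_eq (fun i => (hm i).le) (fun i => (hn i).le) h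
  have h5 := congrFun h5 ⟨0, hd⟩
  have h6 := congrFun h6 ⟨0, hd⟩
  have h7 := h4 ⟨0, hd⟩
  have h8 := hm ⟨0, hd⟩
  rw [← h5, ← h6] at h7
  by_contra he
  have h9 : (1 / 2 : ℝ) ^ e < 1 := pow_lt_one₀ (by norm_num) (by norm_num) he
  nlinarith

theorem cell_level_unique (hd : 1 ≤ d) {k l : ℕ} {m n : Fin d → ℕ} (hm : K.IsCell k m)
    (hn : K.IsCell l n) (h : K.cell k m = K.cell l n) : k = l := by
  rcases le_total k l with hkl | hkl
  · obtain ⟨e, rfl⟩ := Nat.exists_eq_add_of_le hkl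
    simp [cell_level_le hd hm hn h]
  · obtain ⟨e, rfl⟩ := Nat.exists_eq_add_of_le hkl
    simp [cell_level_le hd hn hm h.symm]

variable (K) in
/-- Every B-spline of every level is active on some cell, i.e. its support is nontrivial. -/
def AllActive : Prop := ∀ k (j : K.Index k), ∃ m, K.IsCell k m ∧ K.Active k j m

namespace AllActive

variable (hK : K.AllActive)

include hK

theorem tsupport_nonempty (k : ℕ) (j : K.Index k) : (tsupport (K.B k j)).Nonempty := by
  obtain ⟨m, hm, hj⟩ := hK k j
  obtain ⟨s, hs⟩ := hm.openCell_nonempty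
  exact ⟨s, hj.cell_subset hm (K.openCell_subset _ _ hs)⟩

/-- The B-splines of one level are linearly independent. -/
theorem coeff_sum (k : ℕ) (c : K.Index k → ℝ) : K.coeff k (∑ j, c j • K.B k j) = c := by
  have hex : ∃ c' : K.Index k → ℝ, ∑ j, c j • K.B k j = ∑ j, c' j • K.B k j := ⟨c, rfl⟩
  rw [coeff, dif_pos hex]
  funext j
  obtain ⟨m, hm, hj⟩ := hK k j
  have hdual := isDual_dual_of_active hm hj
  rw [← hdual.integral_mul hex.choose (f := ∑ j, c j • K.B k j), ← hdual.integral_mul c]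
  · intro s _; simp
  · intro s _
    have := congrFun hex.choose_spec s
    simpa using this

theorem knot_pos (k : ℕ) (i : Fin d) : 0 < K.seq k i (p i + 1) := by
  have hlt : ∀ i, 0 < K.num k i := fun i => (Nat.zero_le _).trans_lt (K.isOpenSeq k i).lt
  obtain ⟨m, hm, hj⟩ := hK k fun i => ⟨0, hlt i⟩
  have h1 := (K.isOpenSeq k i).span_index (hm i)
  have h2 := hj i
  simp only [zero_add] at h2
  have h3 : m i = p i := by omega
  have h4 := hm i
  rwa [h3, (K.isOpenSeq k i).zero _ le_rfl] at h4

theorem knot_lt_one (k : ℕ) (i : Fin d) : K.seq k i (K.num k i - 1) < 1 := by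
  have hlt : ∀ i, 0 < K.num k i := fun i => (Nat.zero_le _).trans_lt (K.isOpenSeq k i).lt
  obtain ⟨m, hm, hj⟩ := hK k fun i => ⟨K.num k i - 1, by have := hlt i; omega⟩
  have h1 := (K.isOpenSeq k i).span_index (hm i)
  have h2 := hj i
  have h5 := hlt i
  simp only at h2
  have h3 : m i = K.num k i - 1 := by omega
  have h4 := hm i
  rwa [h3, (K.isOpenSeq k i).one (K.num k i - 1 + 1) (by omega)] at h4

end AllActive

end OpenKnots

/-! ### The hierarchical basis -/

namespace HierMesh

open OpenKnots

variable {d : ℕ} {p : Fin d → ℕ} {K : OpenKnots p} (H : HierMesh K)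

theorem antitone_Om : Antitone H.Om := antitone_nat_of_succ_le H.nested

theorem Om_M : H.Om H.M = ∅ := Nat.sInf_mem H.eventually_empty

theorem Om_eq_empty {k : ℕ} (h : H.M ≤ k) : H.Om k = ∅ :=
  Set.subset_eq_empty (H.antitone_Om h) H.Om_M

theorem M_pos : 0 < H.M := by
  rw [Nat.pos_iff_ne_zero]
  intro h
  have := H.Om_M
  rw [h, H.zero] at this
  exact (Set.nonempty_Icc.2 (zero_le_one' (Fin d → ℝ))).ne_empty this

theorem Om_subset_unit (k : ℕ) : H.Om k ⊆ Icc 0 1 := by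
  rw [← H.zero]
  exact H.antitone_Om (Nat.zero_le k)

theorem lt_M {k : ℕ} {T : Set (Fin d → ℝ)} (hT : T.Nonempty) (h : T ⊆ H.Om k) : k < H.M := by
  by_contra! hc
  rw [H.Om_eq_empty hc] at h
  exact hT.not_subset_empty h

theorem tsupport_subset_Om_zero (k : ℕ) (j : K.Index k) : tsupport (K.B k j) ⊆ H.Om 0 := by
  rw [H.zero]
  exact (tsupport_subset_Icc k j).trans
    (Icc_subset_Icc (fun i => (K.isOpenSeq k i).nonneg _) (fun i => (K.isOpenSeq k i).le_one _))

/-- A cell of level `k` whose interior meets the subdomain of level `k + 1` lies in it. -/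
theorem cell_subset_Om {k : ℕ} {m : Fin d → ℕ} {s : Fin d → ℝ} (hs : s ∈ K.openCell k m)
    (h : s ∈ H.Om (k + 1)) : K.cell k m ⊆ H.Om (k + 1) := by
  rw [H.union k] at h
  obtain ⟨T, ⟨hT, hsub⟩, hsT⟩ := h
  obtain ⟨m', -, rfl⟩ := K.mem_cells.1 hT
  rwa [eq_of_mem_openCell hs hsT]

theorem mem_stage (n : ℕ) (q : Σ k, K.Index k) :
    q ∈ H.stage n ↔ q.1 ≤ n ∧ tsupport (K.B q.1 q.2) ⊆ H.Om q.1 ∧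
      (q.1 < n → ¬ tsupport (K.B q.1 q.2) ⊆ H.Om (q.1 + 1)) := by
  obtain ⟨k, j⟩ := q
  induction n with
  | zero =>
    simp only [stage, mem_ofPred_eq, Nat.le_zero, Nat.not_lt_zero, false_imp_iff, and_true]
    constructor
    · rintro rfl
      exact ⟨rfl, H.tsupport_subset_Om_zero 0 j⟩
    · exact fun h => h.1
  | succ n ih =>
    simp only [stage, mem_union, mem_ofPred_eq, ih]
    constructor
    · rintro (⟨⟨h1, h2, h3⟩, h4⟩ | ⟨h1, h2⟩)
      · refine ⟨by omega, h2, fun _ => ?_⟩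
        rcases h1.lt_or_eq with h | h
        · exact h3 h
        · subst h; exact h4
      · subst h1; exact ⟨le_rfl, h2, fun h => by omega⟩
    · rintro ⟨h1, h2, h3⟩
      rcases h1.lt_or_eq with h | h
      · refine Or.inl ⟨⟨by omega, h2, fun _ => h3 h⟩, fun h4 => h3 h ?_⟩
        exact h4.trans (H.antitone_Om (by omega))
      · subst h; exact Or.inr ⟨rfl, h2⟩

/-- A B-spline of level `k` belongs to the hierarchical basis if and only if its support lies in the
subdomain of level `k`, but not in the one of level `k + 1`. -/
theorem mem_basis (hK : K.AllActive) {k : ℕ} {j : K.Index k} :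
    (⟨k, j⟩ : Σ k, K.Index k) ∈ H.basis ↔
      tsupport (K.B k j) ⊆ H.Om k ∧ ¬ tsupport (K.B k j) ⊆ H.Om (k + 1) := by
  have hM := H.M_pos
  rw [basis, mem_stage]
  simp only
  constructor
  · rintro ⟨h1, h2, h3⟩
    refine ⟨h2, fun h => ?_⟩
    have := H.lt_M (hK.tsupport_nonempty k j) h
    exact h3 (by omega) h
  · rintro ⟨h1, h2⟩
    have := H.lt_M (hK.tsupport_nonempty k j) h1
    exact ⟨by omega, h1, fun _ => h2⟩

theorem lt_M_of_mem_basis {q : Σ k, K.Index k} (h : q ∈ H.basis) : q.1 < H.M := by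
  have := ((H.mem_stage _ q).1 h).1
  have := H.M_pos
  omega

/-- Every B-spline with support in the subdomain of its level is a hierarchical spline. -/
theorem B_mem_Y_of_subset (hK : K.AllActive) :
    ∀ (n l : ℕ) (j : K.Index l), H.M ≤ l + n → tsupport (K.B l j) ⊆ H.Om l → K.B l j ∈ H.Y := by
  intro n
  induction n with
  | zero =>
    intro l j hl h
    have := H.lt_M (hK.tsupport_nonempty l j) h
    omega
  | succ n ih =>
    intro l j hl h
    by_cases hsub : tsupport (K.B l j) ⊆ H.Om (l + 1)
    · obtain ⟨c, hc, hB⟩ := K.exists_B_refine l j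
      rw [hB]
      refine Submodule.sum_mem _ fun j' _ => ?_
      rcases (hc j').eq_or_lt with h0 | h0
      · rw [← h0, zero_smul]; exact Submodule.zero_mem _
      · refine Submodule.smul_mem _ _ (ih (l + 1) j' (by omega) (subset_trans ?_ hsub))
        -- nonnegative terms do not cancel
        refine closure_mono fun s hs => ?_
        rw [Function.mem_support] at hs ⊢
        have h1 : 0 < c j' * K.B (l + 1) j' s :=
          mul_pos h0 (lt_of_le_of_ne (B_nonneg _ _ _) hs.symm)
        have h2 : c j' * K.B (l + 1) j' s ≤ K.B l j s := by
          rw [hB, Finset.sum_apply]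
          exact Finset.single_le_sum (f := fun j' => c j' * K.B (l + 1) j' s)
            (fun i _ => mul_nonneg (hc i) (B_nonneg _ _ _)) (Finset.mem_univ j')
        exact (h1.trans_le h2).ne'
    · exact Submodule.subset_span ⟨⟨l, j⟩, (H.mem_basis hK).2 ⟨h, hsub⟩, rfl⟩

/-- The splines spanned by the B-splines of levels above `k` with support in the subdomain of their
level. They vanish on the mesh elements of level `k`. -/
def fine (k : ℕ) : Submodule ℝ ((Fin d → ℝ) → ℝ) :=
  Submodule.span ℝ {f | ∃ (l : ℕ) (j : K.Index l), k < l ∧ tsupport (K.B l j) ⊆ H.Om l ∧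
    f = K.B l j}

theorem antitone_fine : Antitone H.fine := by
  intro k k' h
  refine Submodule.span_mono ?_
  rintro _ ⟨l, j, hl, hsub, rfl⟩
  exact ⟨l, j, by omega, hsub, rfl⟩

theorem fine_le_Y (hK : K.AllActive) (k : ℕ) : H.fine k ≤ H.Y := by
  rw [fine, Submodule.span_le]
  rintro _ ⟨l, j, -, hsub, rfl⟩
  exact H.B_mem_Y_of_subset hK H.M l j (by omega) hsub

theorem fine_B_eq_zero {k l : ℕ} {j : K.Index l} {m : Fin d → ℕ}
    (hm : ¬ K.cell k m ⊆ H.Om (k + 1)) (hl : k < l) (hsub : tsupport (K.B l j) ⊆ H.Om l)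
    {s : Fin d → ℝ} (hs : s ∈ K.openCell k m) : K.B l j s = 0 := by
  by_contra hne
  exact hm (H.cell_subset_Om hs (H.antitone_Om hl (hsub (subset_closure hne))))

theorem fine_eq_zero {k : ℕ} {m : Fin d → ℕ} (hm : ¬ K.cell k m ⊆ H.Om (k + 1))
    {f : (Fin d → ℝ) → ℝ} (hf : f ∈ H.fine k) {s : Fin d → ℝ} (hs : s ∈ K.openCell k m) :
    f s = 0 := by
  induction hf using Submodule.span_induction with
  | mem f h =>
    obtain ⟨l, j, hl, hsub, rfl⟩ := h
    exact H.fine_B_eq_zero hm hl hsub hs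
  | zero => rfl
  | add f g _ _ h1 h2 => rw [Pi.add_apply, h1, h2, add_zero]
  | smul a f _ h => rw [Pi.smul_apply, h, smul_zero]

/-- Up to finer parts, a hierarchical spline is a spline of level `k`. -/
theorem exists_sub_mem_fine (hK : K.AllActive) (k : ℕ) {V : (Fin d → ℝ) → ℝ} (hV : V ∈ H.Y) :
    ∃ c : K.Index k → ℝ, V - ∑ j, c j • K.B k j ∈ H.fine k := by
  have key : H.Y ≤ K.Y k ⊔ H.fine k := by
    rw [Y, Submodule.span_le]
    rintro _ ⟨⟨l, j⟩, hq, rfl⟩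
    rcases le_or_gt l k with h | h
    · exact Submodule.mem_sup_left (monotone_Y h (B_mem_Y l j))
    · exact Submodule.mem_sup_right
        (Submodule.subset_span ⟨l, j, h, ((H.mem_basis hK).1 hq).1, rfl⟩)
  obtain ⟨W, hW, r, hr, rfl⟩ := Submodule.mem_sup.1 (key hV)
  obtain ⟨c, rfl⟩ := mem_Y.1 hW
  exact ⟨c, by simpa using hr⟩

/-! ### Truncation -/

open Classical in
theorem trunc_sum (hK : K.AllActive) (k : ℕ) (c : K.Index k → ℝ) :
    H.trunc k (∑ j, c j • K.B k j) =
      ∑ j, (if tsupport (K.B k j) ⊆ H.Om k then 0 else c j) • K.B k j := by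
  rw [trunc, hK.coeff_sum]
  refine Finset.sum_congr rfl fun j _ => ?_
  split_ifs
  · rw [zero_smul]
  · rfl

/-- The nonnegative combinations of the B-splines of level `k`. -/
def IsNonnegComb (k : ℕ) (f : (Fin d → ℝ) → ℝ) : Prop :=
  ∃ c : K.Index k → ℝ, (∀ j, 0 ≤ c j) ∧ f = ∑ j, c j • K.B k j

theorem IsNonnegComb.nonneg {k : ℕ} {f : (Fin d → ℝ) → ℝ} (h : IsNonnegComb (K := K) k f)
    (s : Fin d → ℝ) : 0 ≤ f s := by
  obtain ⟨c, hc, rfl⟩ := h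
  rw [Finset.sum_apply]
  exact Finset.sum_nonneg fun j _ => mul_nonneg (hc j) (B_nonneg k j s)

theorem IsNonnegComb.succ {k : ℕ} {f : (Fin d → ℝ) → ℝ} (h : IsNonnegComb (K := K) k f) :
    IsNonnegComb (K := K) (k + 1) f := by
  obtain ⟨c, hc, rfl⟩ := h
  choose b hb hB using K.exists_B_refine k
  refine ⟨fun j' => ∑ j, c j * b j j', fun j' =>
    Finset.sum_nonneg fun j _ => mul_nonneg (hc j) (hb j j'), ?_⟩
  simp_rw [hB, Finset.smul_sum, Finset.sum_smul, mul_smul]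
  rw [Finset.sum_comm]

theorem trunc_spec (hK : K.AllActive) {k : ℕ} {f : (Fin d → ℝ) → ℝ}
    (h : IsNonnegComb (K := K) (k + 1) f) :
    (∃ c : K.Index (k + 1) → ℝ, (∀ j, 0 ≤ c j) ∧
      (∀ j, tsupport (K.B (k + 1) j) ⊆ H.Om (k + 1) → c j = 0) ∧
      H.trunc (k + 1) f = ∑ j, c j • K.B (k + 1) j) ∧
    (∀ s, H.trunc (k + 1) f s ≤ f s) ∧ f - H.trunc (k + 1) f ∈ H.fine k := by
  classical
  obtain ⟨c, hc, rfl⟩ := h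
  rw [H.trunc_sum hK]
  refine ⟨⟨_, fun j => ?_, fun j hj => ?_, rfl⟩, fun s => ?_, ?_⟩
  · split_ifs
    · exact le_rfl
    · exact hc j
  · rw [if_pos hj]
  · rw [Finset.sum_apply, Finset.sum_apply]
    refine Finset.sum_le_sum fun j _ => mul_le_mul_of_nonneg_right ?_ (B_nonneg _ j s)
    split_ifs
    · exact hc j
    · exact le_rfl
  · rw [← Finset.sum_sub_distrib]
    refine Submodule.sum_mem _ fun j _ => ?_
    rw [← sub_smul]
    split_ifs with hj
    · exact Submodule.smul_mem _ _ (Submodule.subset_span ⟨k + 1, j, Nat.lt_succ_self k, hj, rfl⟩)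
    · rw [sub_self, zero_smul]
      exact Submodule.zero_mem _

theorem isNonnegComb_B (k : ℕ) (j : K.Index k) : IsNonnegComb (K := K) k (K.B k j) := by
  classical
  refine ⟨fun j' => if j' = j then 1 else 0, fun j' => ?_, ?_⟩
  · positivity
  · simp

theorem isNonnegComb_truncIter (hK : K.AllActive) (k : ℕ) (j : K.Index k) (n : ℕ) :
    IsNonnegComb (K := K) (k + n) (H.truncIter k n (K.B k j)) := by
  induction n with
  | zero => exact isNonnegComb_B k j
  | succ n ih =>
    obtain ⟨⟨c, h1, -, h2⟩, -⟩ := H.trunc_spec hK ih.succ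
    exact ⟨c, h1, h2⟩

theorem truncIter_add (hK : K.AllActive) (k : ℕ) (j : K.Index k) (n e : ℕ) :
    (∀ s, H.truncIter k (n + e) (K.B k j) s ≤ H.truncIter k n (K.B k j) s) ∧
      H.truncIter k n (K.B k j) - H.truncIter k (n + e) (K.B k j) ∈ H.fine (k + n) := by
  induction e with
  | zero => exact ⟨fun s => le_rfl, by simp⟩
  | succ e ih =>
    obtain ⟨-, h1, h2⟩ := H.trunc_spec hK (H.isNonnegComb_truncIter hK k j (n + e)).succ
    refine ⟨fun s => (h1 s).trans (ih.1 s), ?_⟩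
    have := Submodule.add_mem _ ih.2 (H.antitone_fine (by omega : k + n ≤ k + (n + e)) h2)
    rwa [sub_add_sub_cancel] at this

theorem Trunc_nonneg (hK : K.AllActive) (k : ℕ) (j : K.Index k) (s : Fin d → ℝ) :
    0 ≤ H.Trunc k j s :=
  (H.isNonnegComb_truncIter hK k j _).nonneg s

theorem Trunc_le (hK : K.AllActive) (k : ℕ) (j : K.Index k) (s : Fin d → ℝ) :
    H.Trunc k j s ≤ K.B k j s := by
  have := (H.truncIter_add hK k j 0 (H.M - 1 - k)).1 s
  rwa [zero_add] at this

theorem sub_Trunc_mem_fine (hK : K.AllActive) (k : ℕ) (j : K.Index k) :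
    K.B k j - H.Trunc k j ∈ H.fine k := by
  have := (H.truncIter_add hK k j 0 (H.M - 1 - k)).2
  rwa [zero_add] at this

theorem Trunc_mem_Y (hK : K.AllActive) {k : ℕ} {j : K.Index k}
    (h : (⟨k, j⟩ : Σ k, K.Index k) ∈ H.basis) : H.Trunc k j ∈ H.Y := by
  have h1 : K.B k j ∈ H.Y := Submodule.subset_span ⟨_, h, rfl⟩
  have h2 := H.fine_le_Y hK k (H.sub_Trunc_mem_fine hK k j)
  have := Submodule.sub_mem _ h1 h2
  rwa [sub_sub_cancel] at this

open Classical in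
/-- Up to finer parts, the truncated B-spline of a basis element `q` is a combination of B-splines of
level `k` in which the basis elements of level `k` other than `q` do not occur: those coarser than
level `k` have been truncated, those finer than level `k` are negligible. -/
theorem Trunc_rep (hK : K.AllActive) {k : ℕ} (hk : k < H.M) {q : Σ k, K.Index k}
    (hq : q ∈ H.basis) :
    ∃ c : K.Index k → ℝ, H.Trunc q.1 q.2 - ∑ j, c j • K.B k j ∈ H.fine k ∧
      ∀ j, (⟨k, j⟩ : Σ k, K.Index k) ∈ H.basis →
        c j = if q = (⟨k, j⟩ : Σ k, K.Index k) then 1 else 0 := by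
  obtain ⟨l, i⟩ := q
  rcases lt_trichotomy l k with h | rfl | h
  · obtain ⟨n, rfl⟩ : ∃ n, k = l + n + 1 := ⟨k - l - 1, by omega⟩
    obtain ⟨⟨c, -, h1, h2⟩, -⟩ := H.trunc_spec hK (H.isNonnegComb_truncIter hK l i n).succ
    refine ⟨c, ?_, fun j hj => ?_⟩
    · rw [← h2]
      have h3 := (H.truncIter_add hK l i (n + 1) (H.M - 1 - l - (n + 1))).2
      rw [show n + 1 + (H.M - 1 - l - (n + 1)) = H.M - 1 - l by omega] at h3
      have h4 := Submodule.neg_mem _ h3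
      rw [neg_sub] at h4
      exact h4
    · rw [h1 j ((H.mem_basis hK).1 hj).1, if_neg]
      intro he
      have := congrArg Sigma.fst he
      simp only at this
      omega
  · refine ⟨fun j => if j = i then 1 else 0, ?_, fun j _ => ?_⟩
    · have := Submodule.neg_mem _ (H.sub_Trunc_mem_fine hK l i)
      rw [neg_sub] at this
      simpa using this
    · simp only [Sigma.mk.injEq, heq_eq_eq, true_and, eq_comm]
  · refine ⟨0, ?_, fun j _ => ?_⟩
    · have h1 := H.antitone_fine h.le (H.sub_Trunc_mem_fine hK l i)
      have h2 : K.B l i ∈ H.fine k :=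
        Submodule.subset_span ⟨l, i, h, ((H.mem_basis hK).1 hq).1, rfl⟩
      have := Submodule.sub_mem _ h2 h1
      simpa using this
    · rw [if_neg]
      · rfl
      · intro he
        have := congrArg Sigma.fst he
        simp only at this
        omega

end HierMesh

/-! ### The boundary of the parameter domain -/

theorem paramDomain_eq_pi (d : ℕ) : paramDomain d = univ.pi fun _ => Ioo (0 : ℝ) 1 := by
  ext s
  simp [paramDomain]

theorem mem_frontier_paramDomain {d : ℕ} {s : Fin d → ℝ} :
    s ∈ frontier (paramDomain d) ↔ (∀ i, s i ∈ Icc (0 : ℝ) 1) ∧ ∃ i, s i = 0 ∨ s i = 1 := by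
  have hopen : IsOpen (paramDomain d) := by
    rw [paramDomain_eq_pi]
    exact isOpen_set_pi finite_univ fun _ _ => isOpen_Ioo
  have hclosure : closure (paramDomain d) = univ.pi fun _ => Icc (0 : ℝ) 1 := by
    rw [paramDomain_eq_pi, closure_pi_set]
    simp only [closure_Ioo (zero_ne_one' ℝ)]
  rw [hopen.frontier_eq, hclosure]
  constructor
  · rintro ⟨h1, h2⟩
    have h1 : ∀ i, s i ∈ Icc (0 : ℝ) 1 := fun i => h1 i (mem_univ i)
    refine ⟨h1, ?_⟩
    by_contra! hc
    refine h2 fun i => ⟨lt_of_le_of_ne (h1 i).1 (hc i).1.symm, lt_of_le_of_ne (h1 i).2 (hc i).2⟩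
  · rintro ⟨h1, i, hi⟩
    refine ⟨fun i _ => h1 i, fun h => ?_⟩
    have := h i
    rcases hi with hi | hi <;> rw [hi] at this
    · exact lt_irrefl _ this.1
    · exact lt_irrefl _ this.2

theorem paramDomain_ae_eq (d : ℕ) : paramDomain d =ᵐ[volume] Icc (0 : Fin d → ℝ) 1 := by
  rw [paramDomain_eq_pi]
  exact Measure.univ_pi_Ioo_ae_eq_Icc

namespace IsOpenSeq

variable {p N : ℕ} {t : ℕ → ℝ}

/-- A B-spline that does not vanish at an end point `e` of the interval has the value `1` there, and
all others vanish at `e`. The only nontrivial span in its support is the one that ends in `e`, and it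
does not vanish identically on any interval that ends in `e`. -/
theorem endpoint (h : IsOpenSeq p N t) (h0 : 0 < t (p + 1)) (h1 : t (N - 1) < 1) {e : ℝ}
    (he : e = 0 ∨ e = 1) {n : ℕ} (hn : bspline p t n e ≠ 0) :
    (∀ n', bspline p t n' e = if n' = n then 1 else 0) ∧
      (∀ m, n ≤ m → m ≤ n + p → t m < t (m + 1) → e = t m ∨ e = t (m + 1)) ∧
      ∀ a b, a < b → (e = 0 ∧ a = 0) ∨ (e = 1 ∧ b = 1) → ∃ x ∈ Ioo a b, bspline p t n x ≠ 0 := by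
  rcases he with rfl | rfl
  · have hv := h.bspline_at_zero h0 p
    have hn0 : n = 0 := by
      by_contra hne
      rw [hv, if_neg (by omega)] at hn
      exact hn rfl
    subst hn0
    refine ⟨fun n' => by rw [hv]; congr 1; simp, fun m _ hm hlt => ?_, fun a b hab hab' => ?_⟩
    · have := h.span_index hlt
      left
      rw [h.zero m (by omega)]
    · obtain ⟨-, rfl⟩ := hab'.resolve_right fun h => zero_ne_one h.1
      set x := min b (t (p + 1)) / 2
      have hx : 0 < min b (t (p + 1)) := lt_min hab h0
      have hx1 := min_le_left b (t (p + 1))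
      have hx2 := min_le_right b (t (p + 1))
      refine ⟨x, ⟨by positivity, by simp only [x]; linarith⟩, (bspline_pos h.mono (m := p) ?_ p 0
        (Nat.zero_le _) (by omega)).ne'⟩
      rw [h.zero p le_rfl]
      exact ⟨by positivity, by simp only [x]; linarith⟩
  · have hv := h.bspline_at_one h1 p le_rfl
    have hn0 : n + 1 = N := by
      by_contra hne
      rw [hv, if_neg hne] at hn
      exact hn rfl
    subst hn0
    rw [Nat.add_sub_cancel] at h1
    refine ⟨fun n' => by rw [hv]; congr 1; simp, fun m hm _ hlt => ?_, fun a b hab hab' => ?_⟩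
    · right
      rw [h.one (m + 1) (by omega)]
    · obtain ⟨-, rfl⟩ := hab'.resolve_left fun h => one_ne_zero h.1
      set x := (max a (t n) + 1) / 2
      have hx : max a (t n) < 1 := max_lt hab h1
      have hx1 := le_max_left a (t n)
      have hx2 := le_max_right a (t n)
      refine ⟨x, ⟨by simp only [x]; linarith, by simp only [x]; linarith⟩,
        (bspline_pos h.mono (m := n) ?_ p n le_rfl (by omega)).ne'⟩
      rw [h.one (n + 1) le_rfl]
      exact ⟨by simp only [x]; linarith, by simp only [x]; linarith⟩

end IsOpenSeq

/-! ### The functionals and the projection property -/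

namespace HierMesh

open OpenKnots

variable {d : ℕ} {p : Fin d → ℕ} {K : OpenKnots p}

theorem B_update (k : ℕ) (j : K.Index k) (s : Fin d → ℝ) (i : Fin d) (e : ℝ) :
    K.B k j (Function.update s i e) = bspline (p i) (K.seq k i) (j i) e *
      ∏ i' ∈ Finset.univ.erase i, bspline (p i') (K.seq k i') (j i') (s i') := by
  rw [B_eq, ← Finset.mul_prod_erase _ _ (Finset.mem_univ i), Function.update_self]
  congr 1
  refine Finset.prod_congr rfl fun i' hi' => ?_
  rw [Function.update_of_ne (Finset.ne_of_mem_erase hi')]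

variable {H : HierMesh K}

/-- The hierarchical basis as a finite set. -/
noncomputable def basisFinset (H : HierMesh K) : Finset (Σ k, K.Index k) :=
  open Classical in
  ((Finset.range H.M).sigma fun _ => Finset.univ).filter (· ∈ H.basis)

theorem mem_basisFinset {q : Σ k, K.Index k} :
    q ∈ H.basisFinset ↔ q ∈ H.basis := by
  classical
  simp only [basisFinset, Finset.mem_filter, Finset.mem_sigma, Finset.mem_range, Finset.mem_univ,
    and_true, and_iff_right_iff_imp]
  exact H.lt_M_of_mem_basis

namespace CellChoice

variable (S : H.CellChoice)

include S in
/-- The chosen cells witness that all supports are nontrivial. -/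
theorem allActive : K.AllActive := by
  intro k j
  obtain ⟨m, hm, he⟩ := K.mem_cells.1 (S.mem_cells k j)
  exact ⟨m, hm, active_of_cell_subset hm (he ▸ S.subset_supp k j)⟩

theorem exists_cell (k : ℕ) (j : K.Index k) :
    ∃ m, K.IsCell k m ∧ K.Active k j m ∧ S.cell k j = K.cell k m := by
  obtain ⟨m, hm, he⟩ := K.mem_cells.1 (S.mem_cells k j)
  exact ⟨m, hm, active_of_cell_subset hm (he ▸ S.subset_supp k j), he⟩

theorem cell_mem_level (hd : 1 ≤ d) {k : ℕ} {j : K.Index k}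
    (h : (⟨k, j⟩ : Σ k, K.Index k) ∈ H.basis) :
    S.cell k j ⊆ H.Om k ∧ ¬ S.cell k j ⊆ H.Om (k + 1) := by
  obtain ⟨m, hm, -, he⟩ := S.exists_cell k j
  obtain ⟨l, hl, h1, h2⟩ := S.mem_mesh k j h
  obtain ⟨n, hn, he'⟩ := K.mem_cells.1 hl
  obtain rfl := cell_level_unique hd hm hn (he.symm.trans he')
  exact ⟨h1, h2⟩

/-- The functional of a hierarchical B-spline sees only the part of a spline on its own level. -/
theorem functional_eq (hd : 1 ≤ d) {k : ℕ} {j : K.Index k}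
    (h : (⟨k, j⟩ : Σ k, K.Index k) ∈ H.basis) {V : (Fin d → ℝ) → ℝ} {c : K.Index k → ℝ}
    (hV : V - ∑ j, c j • K.B k j ∈ H.fine k) : S.functional k j V = c j := by
  obtain ⟨m, hm, hj, he⟩ := S.exists_cell k j
  have hnot := (S.cell_mem_level hd h).2
  rw [functional, he]
  rw [he] at hnot
  refine (isDual_dual_of_active hm hj).integral_mul c fun s hs => ?_
  have := H.fine_eq_zero hnot hV hs
  simp only [Pi.sub_apply, Finset.sum_apply, Pi.smul_apply, smul_eq_mul] at this
  linarith

/-- If a hierarchical spline vanishes on the boundary, so do the functionals of the B-splines that do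
not: the support of such a B-spline has the width of one cell in the direction `i` normal to the
boundary, so that the chosen cell touches the boundary, and there the B-splines with the same index
in direction `i` must cancel. -/
theorem functional_eq_zero_of_boundary (hd : 1 ≤ d) {k : ℕ} {j : K.Index k}
    (h : (⟨k, j⟩ : Σ k, K.Index k) ∈ H.basis)
    (hb : ¬ ∀ s ∈ frontier (paramDomain d), K.B k j s = 0) {V : (Fin d → ℝ) → ℝ}
    (hV : V ∈ H.X) : S.functional k j V = 0 := by
  have hK := S.allActive
  obtain ⟨c, hc⟩ := H.exists_sub_mem_fine hK k hV.1
  rw [S.functional_eq hd h hc]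
  obtain ⟨m, hm, hj, he⟩ := S.exists_cell k j
  have hnot := (S.cell_mem_level hd h).2
  rw [he] at hnot
  push Not at hb
  obtain ⟨s₀, hs₀, hB⟩ := hb
  obtain ⟨-, i, hi⟩ := mem_frontier_paramDomain.1 hs₀
  rw [B_eq, Finset.prod_ne_zero_iff] at hB
  obtain ⟨hval, hspan, -⟩ := (K.isOpenSeq k i).endpoint (hK.knot_pos k i) (hK.knot_lt_one k i) hi
    (hB i (Finset.mem_univ i))
  have hspan := hspan (m i) (hj i).1 (hj i).2 (hm i)
  set e := s₀ i
  have hface : (e = 0 ∧ K.seq k i (m i) = 0) ∨ (e = 1 ∧ K.seq k i (m i + 1) = 1) := by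
    have h0 := (K.isOpenSeq k i).nonneg (m i)
    have h1 := (K.isOpenSeq k i).le_one (m i + 1)
    have h2 := hm i
    rcases hi with hi | hi <;> rcases hspan with hs | hs
    · exact Or.inl ⟨hi, by linarith⟩
    · linarith
    · linarith
    · exact Or.inr ⟨hi, by linarith⟩
  -- the finer parts vanish on the face of the cell
  have hfine : ∀ f ∈ H.fine k, ∀ s ∈ K.openCell k m, f (Function.update s i e) = 0 := by
    intro f hf s hs
    induction hf using Submodule.span_induction with
    | mem f hf =>
      obtain ⟨l, n, hl, hsub, rfl⟩ := hf
      by_contra hne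
      rw [B_update] at hne
      obtain ⟨-, -, hx⟩ := (K.isOpenSeq l i).endpoint (hK.knot_pos l i) (hK.knot_lt_one l i) hi
        (left_ne_zero_of_mul hne)
      obtain ⟨x, hx, hx'⟩ := hx _ _ (hm i) hface
      have hmem : Function.update s i x ∈ K.openCell k m := by
        intro i'
        rcases eq_or_ne i' i with rfl | hi'
        · simpa using hx
        · simpa [hi'] using hs i'
      have := H.fine_B_eq_zero hnot hl hsub hmem
      rw [B_update] at this
      exact mul_ne_zero hx' (right_ne_zero_of_mul hne) this
    | zero => rfl
    | add f g _ _ h1 h2 => rw [Pi.add_apply, h1, h2, add_zero]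
    | smul a f _ h => rw [Pi.smul_apply, h, smul_zero]
  classical
  have hzero : ∀ s ∈ K.openCell k m,
      (0 : ℝ) = ∑ j', (if j' i = j i then c j' else 0) * K.B k j' s := by
    intro s hs
    have hs1 : V (Function.update s i e) = 0 := by
      refine hV.2 _ (mem_frontier_paramDomain.2 ⟨fun i' => ?_, i, by simpa using hi⟩)
      rcases eq_or_ne i' i with rfl | hi'
      · rw [Function.update_self]
        rcases hi with hi | hi <;> rw [hi] <;> norm_num
      · rw [Function.update_of_ne hi']
        exact ⟨((K.isOpenSeq k i').nonneg _).trans (hs i').1.le,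
          (hs i').2.le.trans ((K.isOpenSeq k i').le_one _)⟩
    have hs2 := hfine _ hc s hs
    simp only [Pi.sub_apply, Finset.sum_apply, Pi.smul_apply, smul_eq_mul, hs1, zero_sub,
      neg_eq_zero] at hs2
    have hs3 := congrArg (bspline (p i) (K.seq k i) (j i) (s i) * ·) hs2
    simp only [mul_zero, Finset.mul_sum] at hs3
    refine hs3.symm.trans (Finset.sum_congr rfl fun j' _ => ?_)
    have e1 := B_update k j' s i e
    have e2 := B_update k j' s i (s i)
    rw [Function.update_eq_self] at e2
    rw [e1, e2, hval]
    simp only [Fin.val_inj]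
    split_ifs with hij
    · rw [hij]; ring
    · ring
  have := (isDual_dual_of_active hm hj).integral_mul _ (f := fun _ => 0) hzero
  simpa using this.symm

open Classical in
theorem scottZhang_eq (v : (Fin d → ℝ) → ℝ) :
    S.scottZhang v = ∑ q ∈ H.basisFinset,
      if ∀ s ∈ frontier (paramDomain d), K.B q.1 q.2 s = 0 then
        S.functional q.1 q.2 v • H.Trunc q.1 q.2 else 0 := by
  rw [scottZhang, Finset.sum_sigma', basisFinset, Finset.sum_filter]
  refine Finset.sum_congr rfl fun q _ => ?_
  by_cases h1 : q ∈ H.basis <;> simp [h1]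

/-- The functionals are biorthogonal to the truncated hierarchical B-splines. -/
theorem functional_sum_Trunc (hd : 1 ≤ d) (a : (Σ k, K.Index k) → ℝ) {q : Σ k, K.Index k}
    (hq : q ∈ H.basis) :
    S.functional q.1 q.2 (∑ r ∈ H.basisFinset, a r • H.Trunc r.1 r.2) = a q := by
  classical
  have hK := S.allActive
  obtain ⟨k, j⟩ := q
  have hrep := fun r : H.basisFinset =>
    H.Trunc_rep hK (H.lt_M_of_mem_basis hq) (mem_basisFinset.1 r.2)
  choose c hc1 hc2 using hrep
  rw [S.functional_eq hd hq (c := ∑ r : H.basisFinset, a r • c r)]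
  · rw [Finset.sum_apply]
    simp only [Pi.smul_apply, hc2 _ j hq, smul_eq_mul, mul_ite, mul_one, mul_zero]
    rw [Finset.sum_coe_sort H.basisFinset
      fun r => if r = (⟨k, j⟩ : Σ k, K.Index k) then a r else (0 : ℝ),
      Finset.sum_ite_eq', if_pos (mem_basisFinset.2 hq)]
  · have e : ∑ r ∈ H.basisFinset, a r • H.Trunc r.1 r.2 -
        ∑ j, (∑ r : H.basisFinset, a r • c r) j • K.B k j =
        ∑ r : H.basisFinset, a r • (H.Trunc r.1.1 r.1.2 - ∑ j, c r j • K.B k j) := by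
      rw [← Finset.sum_coe_sort]
      simp only [Finset.sum_apply, Pi.smul_apply, smul_sub, Finset.smul_sum, Finset.sum_smul,
        Finset.sum_sub_distrib, smul_eq_mul, mul_smul]
      congr 1
      rw [Finset.sum_comm]
    rw [e]
    exact Submodule.sum_mem _ fun r _ => Submodule.smul_mem _ _ (hc1 r)

/-- The truncated hierarchical B-splines form a basis of the hierarchical splines, and the functionals
yield the coefficients. By biorthogonality they are linearly independent, and there are as many of them
as hierarchical B-splines. -/
theorem eq_sum_functional_Trunc (hd : 1 ≤ d) {V : (Fin d → ℝ) → ℝ} (hV : V ∈ H.Y) :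
    V = ∑ q ∈ H.basisFinset, S.functional q.1 q.2 V • H.Trunc q.1 q.2 := by
  classical
  have hK := S.allActive
  set f : H.basisFinset → (Fin d → ℝ) → ℝ := fun q => K.B q.1.1 q.1.2 with hf
  set g : H.basisFinset → (Fin d → ℝ) → ℝ := fun q => H.Trunc q.1.1 q.1.2 with hg
  have hYf : H.Y = Submodule.span ℝ (range f) := by
    rw [Y]
    congr 1
    ext F
    constructor
    · rintro ⟨q, hq, rfl⟩
      exact ⟨⟨q, mem_basisFinset.2 hq⟩, rfl⟩
    · rintro ⟨q, rfl⟩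
      exact ⟨q, mem_basisFinset.1 q.2, rfl⟩
  have hext : ∀ a : H.basisFinset → ℝ, ∑ q, a q • g q = ∑ q ∈ H.basisFinset,
      (if h : q ∈ H.basisFinset then a ⟨q, h⟩ else 0) • H.Trunc q.1 q.2 := by
    intro a
    rw [← Finset.sum_coe_sort H.basisFinset]
    refine Finset.sum_congr rfl fun q _ => ?_
    rw [dif_pos q.2]
  have hcoef : ∀ (a : H.basisFinset → ℝ) (q : H.basisFinset),
      S.functional q.1.1 q.1.2 (∑ q, a q • g q) = a q := by
    intro a q
    rw [hext, S.functional_sum_Trunc hd _ (mem_basisFinset.1 q.2), dif_pos q.2]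
  have hind : LinearIndependent ℝ g := by
    rw [Fintype.linearIndependent_iff]
    intro a ha q
    rw [← hcoef a q, ha]
    simp [functional]
  have hle : Submodule.span ℝ (range g) ≤ H.Y := by
    rw [Submodule.span_le]
    rintro _ ⟨q, rfl⟩
    exact H.Trunc_mem_Y hK (mem_basisFinset.1 q.2)
  have heq : Submodule.span ℝ (range g) = H.Y := by
    have : FiniteDimensional ℝ H.Y := by
      rw [hYf]
      exact FiniteDimensional.span_of_finite ℝ (finite_range f)
    refine Submodule.eq_of_le_of_finrank_le hle ?_
    rw [finrank_span_eq_card hind, hYf]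
    exact finrank_range_le_card f
  rw [← heq, Submodule.mem_span_range_iff_exists_fun] at hV
  obtain ⟨a, rfl⟩ := hV
  rw [← Finset.sum_coe_sort H.basisFinset]
  refine Finset.sum_congr rfl fun q _ => ?_
  rw [hcoef]

theorem scottZhang_eq_self (hd : 1 ≤ d) {V : (Fin d → ℝ) → ℝ} (hV : V ∈ H.X) :
    S.scottZhang V = V := by
  classical
  conv_rhs => rw [S.eq_sum_functional_Trunc hd hV.1]
  rw [scottZhang_eq]
  refine Finset.sum_congr rfl fun q hq => ?_
  split_ifs with hb
  · rfl
  · rw [S.functional_eq_zero_of_boundary hd (mem_basisFinset.1 hq) hb hV, zero_smul]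

theorem scottZhang_mem_X (v : (Fin d → ℝ) → ℝ) : S.scottZhang v ∈ H.X := by
  classical
  have hK := S.allActive
  rw [scottZhang_eq]
  constructor
  · refine Submodule.sum_mem _ fun q hq => ?_
    split_ifs with hb
    · exact Submodule.smul_mem _ _ (H.Trunc_mem_Y hK (mem_basisFinset.1 hq))
    · exact Submodule.zero_mem _
  · intro s hs
    rw [Finset.sum_apply]
    refine Finset.sum_eq_zero fun q hq => ?_
    split_ifs with hb
    · have h1 := H.Trunc_nonneg hK q.1 q.2 s
      have h2 := H.Trunc_le hK q.1 q.2 s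
      rw [hb s hs] at h2
      rw [Pi.smul_apply, le_antisymm h2 h1, smul_zero]
    · rfl

theorem memLp_cell {v : (Fin d → ℝ) → ℝ} (hv : MemLp v 2 (volume.restrict (paramDomain d)))
    (k : ℕ) (m : Fin d → ℕ) : MemLp v 2 (volume.restrict (K.cell k m)) := by
  rw [Measure.restrict_congr_set (paramDomain_ae_eq d)] at hv
  exact hv.mono_measure (Measure.restrict_mono_set _ cell_subset_unit)

theorem integrable_dual_mul {v : (Fin d → ℝ) → ℝ}
    (hv : MemLp v 2 (volume.restrict (paramDomain d))) (k : ℕ) (j : K.Index k) :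
    Integrable (fun x => K.dual k j (S.cell k j) x * v x) (volume.restrict (S.cell k j)) := by
  obtain ⟨m, hm, hj, he⟩ := S.exists_cell k j
  rw [he]
  have : IsFiniteMeasure (volume.restrict (K.cell k m)) :=
    isFiniteMeasure_restrict.2 isCompact_Icc.measure_ne_top
  have hint : Integrable v (volume.restrict (K.cell k m)) :=
    (memLp_cell hv k m).integrable (by norm_num)
  obtain ⟨⟨V, hV, hVe⟩, -⟩ := isDual_dual_of_active hm hj
  obtain ⟨C, hC⟩ := bounded_of_mem_Y hV
  rw [hVe]
  refine hint.bdd_mul (c := |C|) ?_ (Filter.Eventually.of_forall fun x => ?_)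
  · exact ((measurable_of_mem_Y hV).indicator (K.measurableSet_cell k m)).aestronglyMeasurable
  · by_cases hx : x ∈ K.cell k m
    · rw [indicator_of_mem hx]
      exact (hC x).trans (le_abs_self C)
    · rw [indicator_of_notMem hx, norm_zero]
      exact abs_nonneg C

theorem scottZhang_linear (a b : ℝ) {v w : (Fin d → ℝ) → ℝ}
    (hv : MemLp v 2 (volume.restrict (paramDomain d)))
    (hw : MemLp w 2 (volume.restrict (paramDomain d))) :
    S.scottZhang (a • v + b • w) = a • S.scottZhang v + b • S.scottZhang w := by
  classical
  have key : ∀ k (j : K.Index k), S.functional k j (a • v + b • w) =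
      a * S.functional k j v + b * S.functional k j w := by
    intro k j
    simp only [functional]
    rw [← integral_const_mul, ← integral_const_mul,
      ← integral_add ((S.integrable_dual_mul hv k j).const_mul a)
        ((S.integrable_dual_mul hw k j).const_mul b)]
    refine integral_congr_ae (Filter.Eventually.of_forall fun x => ?_)
    simp only [Pi.add_apply, Pi.smul_apply, smul_eq_mul]
    ring
  simp only [scottZhang_eq, Finset.smul_sum, ← Finset.sum_add_distrib]
  refine Finset.sum_congr rfl fun q _ => ?_
  split_ifs
  · rw [key, add_smul, mul_smul, mul_smul]
  · simp

end CellChoice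

end HierMesh

/-! ### Chains of cells and patches -/

/-- Two nontrivial knot spans with index distance at most `r` are joined by a chain of `r` steps
between touching nontrivial spans. -/
theorem exists_span_chain_of_le {t : ℕ → ℝ} (ht : Monotone t) :
    ∀ (r m m' : ℕ), m ≤ m' → m' ≤ m + r → t m < t (m + 1) → t m' < t (m' + 1) →
      ∃ f : ℕ → ℕ, f 0 = m ∧ f r = m' ∧ ∀ n, t (f n) < t (f n + 1) ∧ m ≤ f n ∧ f n ≤ m' ∧
        (Icc (t (f n)) (t (f n + 1)) ∩ Icc (t (f (n + 1))) (t (f (n + 1) + 1))).Nonempty := by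
  have const : ∀ m, t m < t (m + 1) → (Icc (t m) (t (m + 1)) ∩ Icc (t m) (t (m + 1))).Nonempty :=
    fun m h => by rw [inter_self]; exact nonempty_Icc.2 h.le
  intro r
  induction r with
  | zero =>
    intro m m' h1 h2 hm hm'
    obtain rfl : m = m' := by omega
    exact ⟨fun _ => m, rfl, rfl, fun n => ⟨hm, le_rfl, le_rfl, const m hm⟩⟩
  | succ r ih =>
    intro m m' h1 h2 hm hm'
    rcases h1.eq_or_lt with rfl | h1
    · exact ⟨fun _ => m, rfl, rfl, fun n => ⟨hm, le_rfl, le_rfl, const m hm⟩⟩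
    · classical
      have hex : ∃ x, m < x ∧ t x < t (x + 1) := ⟨m', h1, hm'⟩
      set m₁ := Nat.find hex with hm₁
      obtain ⟨hlt, hspan⟩ := Nat.find_spec hex
      have hle : m₁ ≤ m' := Nat.find_min' hex ⟨h1, hm'⟩
      -- the spans strictly between `m` and `m₁` are trivial
      have heq : ∀ n, m + 1 + n ≤ m₁ → t (m + 1 + n) = t (m + 1) := by
        intro n
        induction n with
        | zero => intro _; rfl
        | succ n ihn =>
          intro hn
          rw [← ihn (by omega)]
          have hmin := Nat.find_min hex (m := m + 1 + n) (by omega)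
          have : ¬ t (m + 1 + n) < t (m + 1 + n + 1) := fun h => hmin ⟨by omega, h⟩
          exact le_antisymm (not_lt.1 this) (ht (by omega))
      have htouch : t m₁ = t (m + 1) := by
        have := heq (m₁ - (m + 1)) (by omega)
        rwa [show m + 1 + (m₁ - (m + 1)) = m₁ by omega] at this
      obtain ⟨f, hf0, hfr, hf⟩ := ih m₁ m' hle (by omega) hspan hm'
      refine ⟨fun n => Nat.casesOn n m f, rfl, hfr, fun n => ?_⟩
      cases n with
      | zero =>
        refine ⟨hm, le_rfl, h1.le, t (m + 1), ⟨hm.le, le_rfl⟩, ?_⟩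
        simp only [hf0]
        exact ⟨htouch.le, by rw [← htouch]; exact hspan.le⟩
      | succ n =>
        obtain ⟨a, b, c, e⟩ := hf n
        exact ⟨a, by simp only; omega, c, e⟩

theorem exists_span_chain {t : ℕ → ℝ} (ht : Monotone t) {r j m m' : ℕ} (hj : j ≤ m)
    (hj' : j ≤ m') (hm : m ≤ j + r) (hm' : m' ≤ j + r) (h : t m < t (m + 1))
    (h' : t m' < t (m' + 1)) :
    ∃ f : ℕ → ℕ, f 0 = m ∧ f r = m' ∧ (∀ n, t (f n) < t (f n + 1) ∧ j ≤ f n ∧ f n ≤ j + r) ∧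
      ∀ n < r, (Icc (t (f n)) (t (f n + 1)) ∩ Icc (t (f (n + 1))) (t (f (n + 1) + 1))).Nonempty := by
  rcases le_total m m' with hle | hle
  · obtain ⟨f, h0, hr, hf⟩ := exists_span_chain_of_le ht r m m' hle (by omega) h h'
    exact ⟨f, h0, hr, fun n => ⟨(hf n).1, hj.trans (hf n).2.1, (hf n).2.2.1.trans hm'⟩,
      fun n _ => (hf n).2.2.2⟩
  · obtain ⟨f, h0, hr, hf⟩ := exists_span_chain_of_le ht r m' m hle (by omega) h' h
    refine ⟨fun n => f (r - n), by simpa using hr, by simpa using h0,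
      fun n => ⟨(hf _).1, hj'.trans (hf _).2.1, (hf _).2.2.1.trans hm⟩, fun n hn => ?_⟩
    have := (hf (r - (n + 1))).2.2.2
    rw [show r - (n + 1) + 1 = r - n by omega, inter_comm] at this
    exact this

namespace OpenKnots

variable {d : ℕ} {p : Fin d → ℕ} {K : OpenKnots p}

/-- Each point of a cell lies in one of its children, and all children contain the center. -/
theorem exists_child {k : ℕ} {m : Fin d → ℕ} (hm : K.IsCell k m) {x : Fin d → ℝ}
    (hx : x ∈ K.cell k m) :
    ∃ n, K.IsCell (k + 1) n ∧ x ∈ K.cell (k + 1) n ∧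
      (fun i => (K.seq k i (m i) + K.seq k i (m i + 1)) / 2) ∈ K.cell (k + 1) n ∧
      K.cell (k + 1) n ⊆ K.cell k m := by
  have h1 : ∀ i, ∃ n, K.seq (k + 1) i n < K.seq (k + 1) i (n + 1) ∧
      x i ∈ Icc (K.seq (k + 1) i n) (K.seq (k + 1) i (n + 1)) ∧
      (K.seq k i (m i) + K.seq k i (m i + 1)) / 2 ∈
        Icc (K.seq (k + 1) i n) (K.seq (k + 1) i (n + 1)) ∧
      K.seq k i (m i) ≤ K.seq (k + 1) i n ∧ K.seq (k + 1) i (n + 1) ≤ K.seq k i (m i + 1) := by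
    intro i
    obtain ⟨n, e0, e1, e2⟩ := K.seq_children (hm i)
    have h := hm i
    have hx1 := hx.1 i
    have hx2 := hx.2 i
    simp only at hx1 hx2
    rcases le_total (x i) (K.seq (k + 1) i (n + 1)) with hle | hle
    · refine ⟨n, ?_, ⟨?_, hle⟩, ⟨?_, ?_⟩, ?_, ?_⟩ <;> linarith
    · refine ⟨n + 1, ?_, ⟨hle, ?_⟩, ⟨?_, ?_⟩, ?_, ?_⟩ <;>
        (try rw [show n + 1 + 1 = n + 2 from rfl]) <;> linarith
  choose n hn1 hn2 hn3 hn4 hn5 using h1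
  exact ⟨n, hn1, ⟨fun i => (hn2 i).1, fun i => (hn2 i).2⟩,
    ⟨fun i => (hn3 i).1, fun i => (hn3 i).2⟩, Icc_subset_Icc hn4 hn5⟩

end OpenKnots

namespace HierMesh

open OpenKnots

variable {d : ℕ} {p : Fin d → ℕ} {K : OpenKnots p} (H : HierMesh K)

/-- The cell of level `k` with multi-index `m` is an element of the hierarchical mesh. -/
def IsElem (k : ℕ) (m : Fin d → ℕ) : Prop :=
  K.IsCell k m ∧ K.cell k m ⊆ H.Om k ∧ ¬ K.cell k m ⊆ H.Om (k + 1)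

variable {H}

theorem mem_mesh_iff {T : Set (Fin d → ℝ)} : T ∈ H.mesh ↔ ∃ k m, H.IsElem k m ∧ T = K.cell k m := by
  constructor
  · rintro ⟨k, hT, h1, h2⟩
    obtain ⟨m, hm, rfl⟩ := K.mem_cells.1 hT
    exact ⟨k, m, ⟨hm, h1, h2⟩, rfl⟩
  · rintro ⟨k, m, ⟨hm, h1, h2⟩, rfl⟩
    exact ⟨k, K.mem_cells.2 ⟨m, hm, rfl⟩, h1, h2⟩

theorem IsElem.mem_mesh {k : ℕ} {m : Fin d → ℕ} (h : H.IsElem k m) : K.cell k m ∈ H.mesh :=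
  mem_mesh_iff.2 ⟨k, m, h, rfl⟩

theorem IsElem.level_eq {k : ℕ} {m : Fin d → ℕ} (h : H.IsElem k m) :
    H.level (K.cell k m) = k := by
  have : {l | K.cell k m ⊆ H.Om l ∧ ¬ K.cell k m ⊆ H.Om (l + 1)} = {k} := by
    ext l
    constructor
    · rintro ⟨h1, h2⟩
      by_contra hne
      rcases lt_or_gt_of_ne hne with hlt | hlt
      · exact h2 (h.2.1.trans (H.antitone_Om hlt))
      · exact h.2.2 (h1.trans (H.antitone_Om hlt))
    · rintro rfl
      exact h.2
  rw [level, this, csInf_singleton]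

/-- A cell in the subdomain of its level contains a mesh element of the same or a finer level. -/
theorem exists_elem_subset : ∀ (n l : ℕ) (m : Fin d → ℕ), H.M ≤ l + n → K.IsCell l m →
    K.cell l m ⊆ H.Om l → ∃ k m', l ≤ k ∧ H.IsElem k m' ∧ K.cell k m' ⊆ K.cell l m := by
  intro n
  induction n with
  | zero =>
    intro l m hl hm hsub
    obtain ⟨s, hs⟩ := hm.openCell_nonempty
    have := H.lt_M ⟨s, K.openCell_subset _ _ hs⟩ hsub
    omega
  | succ n ih =>
    intro l m hl hm hsub
    by_cases h : K.cell l m ⊆ H.Om (l + 1)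
    · obtain ⟨s, hs⟩ := hm.openCell_nonempty
      obtain ⟨m₁, hm₁, -, -, hsub₁⟩ := exists_child hm (K.openCell_subset _ _ hs)
      obtain ⟨k, m', hk, hE, hE'⟩ := ih (l + 1) m₁ (by omega) hm₁ (hsub₁.trans h)
      exact ⟨k, m', by omega, hE, hE'.trans hsub₁⟩
    · exact ⟨l, m, le_rfl, ⟨hm, hsub, h⟩, subset_rfl⟩

theorem mesh_subset_unit {T : Set (Fin d → ℝ)} (hT : T ∈ H.mesh) : T ⊆ Icc 0 1 := by
  obtain ⟨k, -, h, -⟩ := hT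
  exact h.trans (H.Om_subset_unit k)

theorem patch_succ_subset_unit (n : ℕ) (ω : Set (Fin d → ℝ)) : H.patch (n + 1) ω ⊆ Icc 0 1 := by
  rintro x ⟨T, ⟨hT, -⟩, hx⟩
  exact mesh_subset_unit hT hx

section Support

variable (S : H.CellChoice) (hd : 1 ≤ d) (hA : H.Admissible) {l : ℕ} {j : K.Index l}
  (hq : (⟨l, j⟩ : Σ k, K.Index k) ∈ H.basis)

include S hd hA hq

/-- In an admissible mesh, only elements of levels `l` and `l + 1` lie in the support of a basis
function of level `l`. -/
theorem level_of_elem_subset {k : ℕ} {n : Fin d → ℕ} (hE : H.IsElem k n)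
    (hsub : K.cell k n ⊆ tsupport (K.B l j)) : l ≤ k ∧ k ≤ l + 1 := by
  have hK := S.allActive
  constructor
  · by_contra! hc
    obtain ⟨s, hs⟩ := hE.1.openCell_nonempty
    have h1 := ((H.mem_basis hK).1 hq).1 (hsub (K.openCell_subset _ _ hs))
    exact hE.2.2 (H.cell_subset_Om hs (H.antitone_Om hc h1))
  · obtain ⟨m, hm, hj, he⟩ := S.exists_cell l j
    have h1 := S.cell_mem_level hd hq
    have hT := S.mem_mesh l j hq
    have hN : H.Neighbor (K.cell k n) (S.cell l j) := ⟨hT, _, hq, hsub, S.subset_supp l j⟩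
    have h2 := hA _ hE.mem_mesh _ hT hN
    rw [he] at h1
    rw [he, hE.level_eq, IsElem.level_eq ⟨hm, h1⟩, abs_le] at h2
    omega

/-- A cell of level `l` in the support of a basis function of level `l` is a mesh element, or else
all its children are. -/
theorem exists_elem_center {m : Fin d → ℕ} (hm : K.IsCell l m) (hj : K.Active l j m)
    {x : Fin d → ℝ} (hx : x ∈ K.cell l m) :
    ∃ E ∈ H.mesh, x ∈ E ∧ (fun i => (K.seq l i (m i) + K.seq l i (m i + 1)) / 2) ∈ E := by
  have hK := S.allActive
  have hsupp := hj.cell_subset hm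
  have hOm := hsupp.trans ((H.mem_basis hK).1 hq).1
  obtain ⟨n, hn, hxn, hcn, hsub⟩ := exists_child hm hx
  by_cases h : K.cell l m ⊆ H.Om (l + 1)
  · refine ⟨_, IsElem.mem_mesh ⟨hn, hsub.trans h, fun h2 => ?_⟩, hxn, hcn⟩
    obtain ⟨s, hs⟩ := hn.openCell_nonempty
    obtain ⟨n₂, hn₂, -, -, hsub₂⟩ := exists_child hn (K.openCell_subset _ _ hs)
    obtain ⟨k, m', hk, hE, hE'⟩ := exists_elem_subset H.M (l + 1 + 1) n₂ (by omega) hn₂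
      (hsub₂.trans h2)
    have := (level_of_elem_subset S hd hA hq hE
      (hE'.trans (hsub₂.trans (hsub.trans hsupp)))).2
    omega
  · exact ⟨_, IsElem.mem_mesh ⟨hm, hOm, h⟩, hx, hsub hcn⟩

theorem cell_subset_patch {m : Fin d → ℕ} (hm : K.IsCell l m) (hj : K.Active l j m)
    {n : ℕ} {ω : Set (Fin d → ℝ)} (h : (K.cell l m ∩ H.patch n ω).Nonempty) :
    K.cell l m ⊆ H.patch (n + 2) ω := by
  obtain ⟨x, hx, hxp⟩ := h
  obtain ⟨E, hE, hxE, hcE⟩ := exists_elem_center S hd hA hq hm hj hx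
  have hc : (fun i => (K.seq l i (m i) + K.seq l i (m i + 1)) / 2) ∈ H.patch (n + 1) ω :=
    ⟨E, ⟨hE, x, hxE, hxp⟩, hcE⟩
  intro y hy
  obtain ⟨E', hE', hyE', hcE'⟩ := exists_elem_center S hd hA hq hm hj hy
  exact ⟨E', ⟨hE', _, hcE', hc⟩, hyE'⟩

/-- The chosen cell of a basis function is reached from any set that meets a cell in its support: the
support has at most `p i + 1` cells in direction `i`, and each costs two layers of elements. -/
theorem cell_choice_subset_patch {m : Fin d → ℕ} (hm : K.IsCell l m) (hj : K.Active l j m)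
    {T : Set (Fin d → ℝ)} (hT : (K.cell l m ∩ T).Nonempty) :
    S.cell l j ⊆ H.patch (2 * (Finset.univ.sup p + 1)) T := by
  obtain ⟨m', hm', hj', he⟩ := S.exists_cell l j
  have hle : ∀ i, p i ≤ Finset.univ.sup p := fun i => Finset.le_sup (Finset.mem_univ i)
  -- chains in each direction, constant after the first `p i` steps
  have hchain : ∀ i, ∃ f : ℕ → ℕ, f 0 = m i ∧ f (Finset.univ.sup p) = m' i ∧
      (∀ n, K.seq l i (f n) < K.seq l i (f n + 1) ∧ (j i : ℕ) ≤ f n ∧ f n ≤ j i + p i) ∧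
      ∀ n, (Icc (K.seq l i (f n)) (K.seq l i (f n + 1)) ∩
        Icc (K.seq l i (f (n + 1))) (K.seq l i (f (n + 1) + 1))).Nonempty := by
    intro i
    obtain ⟨f, h0, hr, hf, hf'⟩ := exists_span_chain (K.isOpenSeq l i).mono (hj i).1 (hj' i).1
      (hj i).2 (hj' i).2 (hm i) (hm' i)
    refine ⟨fun n => f (min n (p i)), by simpa using h0, by simpa [hle i] using hr,
      fun n => hf _, fun n => ?_⟩
    beta_reduce
    rcases Nat.lt_or_ge n (p i) with hn | hn
    · have := hf' n hn
      rwa [min_eq_left hn.le, min_eq_left hn]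
    · rw [min_eq_right hn, min_eq_right (by omega), inter_self]
      exact nonempty_Icc.2 (hf _).1.le
  choose f h0 hr hf hf' using hchain
  have key : ∀ n, K.cell l (fun i => f i n) ⊆ H.patch (2 * (n + 1)) T := by
    intro n
    induction n with
    | zero =>
      refine cell_subset_patch S hd hA hq (n := 0) (fun i => (hf i 0).1) (fun i => (hf i 0).2) ?_
      simp only [h0]
      exact hT
    | succ n ih =>
      refine cell_subset_patch S hd hA hq (n := 2 * (n + 1)) (fun i => (hf i _).1)
        (fun i => (hf i _).2) ?_
      choose x hx using fun i => hf' i n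
      exact ⟨x, ⟨fun i => (hx i).2.1, fun i => (hx i).2.2⟩,
        ih ⟨fun i => (hx i).1.1, fun i => (hx i).1.2⟩⟩
  have := key (Finset.univ.sup p)
  simp only [hr] at this
  rw [he]
  exact this

/-- If a basis function of level `l` does not vanish in the interior of an element of level `k`, then
`k ≤ l + 1`, `l ≤ k`, and the chosen cell lies in the patch of the element. -/
theorem active_elem {k : ℕ} {n : Fin d → ℕ} (hE : H.IsElem k n) {s : Fin d → ℝ}
    (hs : s ∈ K.openCell k n) (hB : K.B l j s ≠ 0) :
    l ≤ k ∧ k ≤ l + 1 ∧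
      S.cell l j ⊆ H.patch (2 * (Finset.univ.sup p + 1)) (K.cell k n) := by
  have hK := S.allActive
  have hlk : l ≤ k := by
    by_contra! hc
    exact hB (H.fine_B_eq_zero hE.2.2 hc ((H.mem_basis hK).1 hq).1 hs)
  obtain ⟨e, rfl⟩ := Nat.exists_eq_add_of_le hlk
  obtain ⟨m, hm, h1, h2, -⟩ := K.exists_cell_ancestor e hE.1
  have hj := active_of_B_ne_zero (h2 hs) hB
  have hsub := h1.trans (hj.cell_subset hm)
  refine ⟨hlk, (level_of_elem_subset S hd hA hq hE hsub).2, ?_⟩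
  exact cell_choice_subset_patch S hd hA hq hm hj
    ⟨s, h1 (K.openCell_subset _ _ hs), K.openCell_subset _ _ hs⟩

end Support

end HierMesh

/-! ### Local stability -/

namespace OpenKnots

variable {d : ℕ} {p : Fin d → ℕ} {K : OpenKnots p}

theorem SpanBound.le_volume {δ : ℝ} (hδ : K.SpanBound δ) (hδ0 : 0 ≤ δ) {k : ℕ} {m : Fin d → ℕ}
    (hm : K.IsCell k m) :
    ((1 / 2) ^ k * δ) ^ d ≤ ∏ i, (K.seq k i (m i + 1) - K.seq k i (m i)) := by
  calc ((1 / 2) ^ k * δ) ^ d = ∏ _i : Fin d, ((1 / 2) ^ k * δ) := by simp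
    _ ≤ _ := Finset.prod_le_prod (fun _ _ => by positivity) fun i _ => hδ.le_span (hm i)

theorem volume_le {k : ℕ} {m : Fin d → ℕ} (hm : K.IsCell k m) :
    ∏ i, (K.seq k i (m i + 1) - K.seq k i (m i)) ≤ ((1 / 2) ^ k) ^ d := by
  calc ∏ i, (K.seq k i (m i + 1) - K.seq k i (m i)) ≤ ∏ _i : Fin d, ((1 / 2) ^ k : ℝ) :=
        Finset.prod_le_prod (fun i _ => by linarith [hm i]) fun i _ => K.span_le k i (m i)
    _ = _ := by simp

end OpenKnots

namespace HierMesh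

open OpenKnots ENNReal

variable {d : ℕ} {p : Fin d → ℕ}

/-- The functional of a B-spline is bounded in `L²` on the chosen cell, with a constant that is
inversely proportional to the square root of the volume of the cell. -/
theorem exists_enorm_functional_le (p : Fin d → ℕ) {δ : ℝ} (hδ : 0 < δ) :
    ∃ C : ℝ, 0 < C ∧ ∀ (K : OpenKnots p) (H : HierMesh K) (S : H.CellChoice), K.SpanBound δ →
      ∀ (k : ℕ) (j : K.Index k) (v : (Fin d → ℝ) → ℝ),
        MemLp v 2 (volume.restrict (paramDomain d)) →
        ‖S.functional k j v‖ₑ ≤ ENNReal.ofReal (C / √(((1 / 2) ^ k * δ) ^ d)) *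
          eLpNorm v 2 (volume.restrict (S.cell k j)) := by
  obtain ⟨C, hC, hdual⟩ := exists_isDual p hδ
  refine ⟨C, hC, fun K H S hK k j v hv => ?_⟩
  obtain ⟨m, hm, hj, he⟩ := S.exists_cell k j
  obtain ⟨V, hV, hVle⟩ := hdual K hK k m j hm hj
  rw [CellChoice.functional, he]
  set vol := ∏ i, (K.seq k i (m i + 1) - K.seq k i (m i)) with hvol
  have hvol0 : 0 < vol := Finset.prod_pos fun i _ => sub_pos.2 (hm i)
  set μ := volume.restrict (K.cell k m) with hμ
  have hvm : MemLp v 2 μ := CellChoice.memLp_cell hv k m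
  have hμuniv : μ univ = ENNReal.ofReal vol := by
    rw [hμ, Measure.restrict_apply_univ, volume_cell hm]
  have h1 : ‖∫ x in K.cell k m, K.dual k j (K.cell k m) x * v x‖ₑ ≤
      ENNReal.ofReal (C / vol) * eLpNorm v 1 μ := by
    rw [eLpNorm_one_eq_lintegral_enorm, ← lintegral_const_mul' _ _ ENNReal.ofReal_ne_top]
    refine (enorm_integral_le_lintegral_enorm _).trans (lintegral_mono_ae ?_)
    filter_upwards [(isDual_dual_of_active hm hj).ae_eq hV, K.ae_mem_openCell k m] with s hs hs'
    rw [hs, indicator_of_mem (K.openCell_subset k m hs'), enorm_mul]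
    gcongr
    rw [Real.enorm_eq_ofReal_abs]
    exact ENNReal.ofReal_le_ofReal (hVle s hs')
  have h2 : eLpNorm v 1 μ ≤ eLpNorm v 2 μ * ENNReal.ofReal √vol := by
    refine (eLpNorm_le_eLpNorm_mul_rpow_measure_univ (by norm_num : (1 : ℝ≥0∞) ≤ 2)
      hvm.aestronglyMeasurable).trans_eq ?_
    rw [hμuniv, ENNReal.ofReal_rpow_of_pos hvol0, Real.sqrt_eq_rpow]
    norm_num
  calc ‖∫ x in K.cell k m, K.dual k j (K.cell k m) x * v x‖ₑ
      ≤ ENNReal.ofReal (C / vol) * (eLpNorm v 2 μ * ENNReal.ofReal √vol) := by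
        refine h1.trans ?_
        gcongr
    _ = ENNReal.ofReal (C / √vol) * eLpNorm v 2 μ := by
        rw [mul_comm (eLpNorm v 2 μ), ← mul_assoc, ← ENNReal.ofReal_mul (by positivity)]
        congr 2
        have hsq := Real.mul_self_sqrt hvol0.le
        have hpos := Real.sqrt_pos.2 hvol0
        nth_rewrite 1 [← hsq]
        field_simp
    _ ≤ _ := by
        gcongr
        exact hK.le_volume hδ.le hm

/-- Local stability in terms of the lengths of the knot spans of level `0`. On an element of level
`k`, only B-splines of the levels `k - 1` and `k` are active; their values sum up to at most `2`. -/
theorem exists_eLpNorm_scottZhang_le (hd : 1 ≤ d) (p : Fin d → ℕ) {δ : ℝ} (hδ : 0 < δ) :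
    ∃ C : ℝ, 0 < C ∧ ∀ (K : OpenKnots p) (H : HierMesh K) (S : H.CellChoice), K.SpanBound δ →
      H.Admissible → ∀ T ∈ H.mesh, ∀ v : (Fin d → ℝ) → ℝ,
        MemLp v 2 (volume.restrict (paramDomain d)) →
        eLpNorm (S.scottZhang v) 2 (volume.restrict T) ≤ ENNReal.ofReal C *
          eLpNorm v 2 (volume.restrict (H.patch (2 * (Finset.univ.sup p + 1)) T)) := by
  classical
  obtain ⟨C, hC, hfun⟩ := exists_enorm_functional_le p hδ
  refine ⟨2 * C / √(δ ^ d), by positivity, fun K H S hK hA T hT v hv => ?_⟩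
  obtain ⟨k, n, hE, rfl⟩ := mem_mesh_iff.1 hT
  have hall := S.allActive
  set P := H.patch (2 * (Finset.univ.sup p + 1)) (K.cell k n) with hP
  set A : ℝ := (eLpNorm v 2 (volume.restrict P)).toReal with hAdef
  have hfin : eLpNorm v 2 (volume.restrict P) ≠ ∞ := by
    have h1 := hv
    rw [Measure.restrict_congr_set (paramDomain_ae_eq d)] at h1
    refine (h1.mono_measure (Measure.restrict_mono_set _ ?_)).eLpNorm_ne_top
    exact patch_succ_subset_unit _ _
  set w : ℝ := ((1 / 2) ^ k * δ) ^ d with hw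
  have hw0 : 0 < w := by positivity
  set L : ℝ := C / √w * A with hL
  have hL0 : 0 ≤ L := by positivity
  have hbound : ∀ s ∈ K.openCell k n, ‖S.scottZhang v s‖ ≤ 2 * L := by
    intro s hs
    have hactive : ∀ q ∈ H.basisFinset, K.B q.1 q.2 s ≠ 0 →
        (q.1 = k - 1 ∨ q.1 = k) ∧ |S.functional q.1 q.2 v| ≤ L := by
      intro q hq hB
      obtain ⟨h1, h2, h3⟩ := active_elem S hd hA (mem_basisFinset.1 hq) hE hs hB
      refine ⟨by omega, ?_⟩
      have h4 := hfun K H S hK q.1 q.2 v hv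
      have h5 : eLpNorm v 2 (volume.restrict (S.cell q.1 q.2)) ≤ ENNReal.ofReal A := by
        rw [hAdef, ENNReal.ofReal_toReal hfin]
        exact eLpNorm_mono_measure _ (Measure.restrict_mono_set _ h3)
      have h6 : C / √(((1 / 2) ^ q.1 * δ) ^ d) ≤ C / √w := by
        rw [hw]
        have hpow : (1 / 2 : ℝ) ^ k ≤ (1 / 2) ^ q.1 :=
          pow_le_pow_of_le_one (by norm_num) (by norm_num) h1
        gcongr
      rw [Real.enorm_eq_ofReal_abs] at h4
      refine (ENNReal.ofReal_le_ofReal_iff hL0).1 (h4.trans ?_)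
      rw [hL, ENNReal.ofReal_mul (by positivity)]
      gcongr
    rw [S.scottZhang_eq, Finset.sum_apply, Real.norm_eq_abs]
    calc |∑ q ∈ H.basisFinset, (if ∀ s ∈ frontier (paramDomain d), K.B q.1 q.2 s = 0 then
            S.functional q.1 q.2 v • H.Trunc q.1 q.2 else 0) s|
        ≤ ∑ q ∈ H.basisFinset, if K.B q.1 q.2 s ≠ 0 then L * K.B q.1 q.2 s else 0 := by
          refine (Finset.abs_sum_le_sum_abs _ _).trans (Finset.sum_le_sum fun q hq => ?_)
          have h1 := H.Trunc_nonneg hall q.1 q.2 s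
          have h2 := H.Trunc_le hall q.1 q.2 s
          have h3 := B_nonneg q.1 q.2 s
          have hrhs : 0 ≤ if K.B q.1 q.2 s ≠ 0 then L * K.B q.1 q.2 s else 0 := by
            split_ifs
            · positivity
            · exact le_rfl
          by_cases hb : ∀ s ∈ frontier (paramDomain d), K.B q.1 q.2 s = 0
          · rw [if_pos hb, Pi.smul_apply, smul_eq_mul, abs_mul, abs_of_nonneg h1]
            by_cases hB : K.B q.1 q.2 s = 0
            · rw [le_antisymm (h2.trans hB.le) h1, mul_zero]
              exact hrhs
            · rw [if_pos hB]
              exact mul_le_mul (hactive q hq hB).2 h2 h1 hL0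
          · rw [if_neg hb, Pi.zero_apply, abs_zero]
            exact hrhs
      _ ≤ ∑ q ∈ ({k - 1, k} : Finset ℕ).sigma fun l => (Finset.univ : Finset (K.Index l)),
            L * K.B q.1 q.2 s := by
          rw [← Finset.sum_filter]
          refine Finset.sum_le_sum_of_subset_of_nonneg (fun q hq => ?_) fun q _ _ =>
            mul_nonneg hL0 (B_nonneg _ _ _)
          rw [Finset.mem_filter] at hq
          have := (hactive q hq.1 hq.2).1
          simpa using this
      _ ≤ ∑ _l ∈ ({k - 1, k} : Finset ℕ), L := by
          rw [Finset.sum_sigma]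
          refine Finset.sum_le_sum fun l _ => ?_
          rw [← Finset.mul_sum]
          exact mul_le_of_le_one_right hL0 (sum_B_le_one l s)
      _ ≤ 2 * L := by
          rw [Finset.sum_const, nsmul_eq_mul]
          refine mul_le_mul_of_nonneg_right ?_ hL0
          exact_mod_cast Finset.card_le_two
  have hvol0 : 0 < ∏ i, (K.seq k i (n i + 1) - K.seq k i (n i)) :=
    Finset.prod_pos fun i _ => sub_pos.2 (hE.1 i)
  calc eLpNorm (S.scottZhang v) 2 (volume.restrict (K.cell k n))
      ≤ (volume.restrict (K.cell k n)) univ ^ (2 : ℝ≥0∞).toReal⁻¹ * ENNReal.ofReal (2 * L) := by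
        refine eLpNorm_le_of_ae_bound ?_
        filter_upwards [K.ae_mem_openCell k n] with s hs
        exact hbound s hs
    _ = ENNReal.ofReal (√(∏ i, (K.seq k i (n i + 1) - K.seq k i (n i))) * (2 * L)) := by
        rw [Measure.restrict_apply_univ, volume_cell hE.1, ENNReal.ofReal_rpow_of_pos hvol0,
          ENNReal.ofReal_mul (Real.sqrt_nonneg _), Real.sqrt_eq_rpow]
        norm_num
    _ ≤ ENNReal.ofReal (√(((1 / 2) ^ k) ^ d) * (2 * L)) := by
        gcongr
        exact volume_le hE.1
    _ = ENNReal.ofReal (2 * C / √(δ ^ d)) * ENNReal.ofReal A := by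
        rw [← ENNReal.ofReal_mul (by positivity), hL, hw, mul_pow, Real.sqrt_mul (by positivity)]
        congr 1
        have : √((((1 : ℝ) / 2) ^ k) ^ d) ≠ 0 := by positivity
        field_simp
    _ = _ := by rw [hAdef, ENNReal.ofReal_toReal hfin]

end HierMesh

theorem lemma4 (d : ℕ) (hd : 1 ≤ d) (p : Fin d → ℕ) (hp : ∀ i, 1 ≤ p i)
    (T₀ : Set (Set (Fin d → ℝ))) :
    ∃ C : ℝ, 0 < C ∧
      ∀ K : OpenKnots p, K.cells 0 = T₀ →
      ∀ H : HierMesh K, H.Admissible → ∀ S : H.CellChoice,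
        -- the operator is a linear map from `L²` to the space of splines with zero boundary values
        (∀ v : (Fin d → ℝ) → ℝ, MemLp v 2 (volume.restrict (paramDomain d)) →
          S.scottZhang v ∈ H.X) ∧
        (∀ (a b : ℝ) (v w : (Fin d → ℝ) → ℝ), MemLp v 2 (volume.restrict (paramDomain d)) →
          MemLp w 2 (volume.restrict (paramDomain d)) →
          S.scottZhang (a • v + b • w) = a • S.scottZhang v + b • S.scottZhang w) ∧
        -- projection property
        (∀ V ∈ H.X, S.scottZhang V = V) ∧
        -- local `L²`-stability
        ∀ T ∈ H.mesh, ∀ v : (Fin d → ℝ) → ℝ, MemLp v 2 (volume.restrict (paramDomain d)) →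
          eLpNorm (S.scottZhang v) 2 (volume.restrict T) ≤
            ENNReal.ofReal C *
              eLpNorm v 2 (volume.restrict (H.patch (2 * (Finset.univ.sup p + 1)) T)) := by
  -- the lower bound for the knot spans, hence the constant, depends on the knots only through `T₀`
  obtain ⟨δ, hδ, hspan⟩ : ∃ δ : ℝ, 0 < δ ∧
      ∀ K : OpenKnots p, K.cells 0 = T₀ → K.SpanBound δ := by
    by_cases hex : ∃ K₀ : OpenKnots p, K₀.cells 0 = T₀
    · obtain ⟨K₀, hK₀⟩ := hex
      obtain ⟨δ, hδ, h⟩ := K₀.exists_spanBound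
      exact ⟨δ, hδ, fun K hK => h.of_cells_eq (hK.trans hK₀.symm)⟩
    · exact ⟨1, one_pos, fun K hK => (hex ⟨K, hK⟩).elim⟩
  obtain ⟨C, hC, hstab⟩ := HierMesh.exists_eLpNorm_scottZhang_le hd p hδ
  refine ⟨C, hC, fun K hK H hA S => ⟨fun v _ => S.scottZhang_mem_X v,
    fun a b v w hv hw => S.scottZhang_linear a b hv hw, fun V hV => S.scottZhang_eq_self hd hV, ?_⟩⟩
  exact hstab K H S (hspan K hK) hA
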